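/- Let $x_1,x_2,x_3$ be the coordinates of $\mathbb C^3$ and put $$\mathcal H=(x_1x_2,\,x_2x_3,\,x_3x_1)\cdot(x_1,\,x_2x_3)\cdot(x_2,\,x_3x_1)^2\cdot(x_3,\,x_1x_2)^2 ,\qquad \mathcal J=(x_3,\,x_1x_2)\cdot(x_1,\,x_2x_3)\cdot(x_2,\,x_3x_1),$$ ideals of the ring of holomorphic functions on $\mathbb C^3$. The blow-up of a reduced complex space $S$ along an ideal generated by holomorphic functions $g_1,\dots,g_k$, whose common zero set has no interior point, is the closure in $S\times\mathbb P_{k-1}$ of the graph of $s\mapsto[g_1(s):\dots:g_k(s)]$, with its reduced complex structure and its projection to $S$. Let $X\subset\mathbb C^3\times\mathbb P_2$ be the blow-up of $\mathbb C^3$ along the ideal with generators $x_1x_2,\,x_2x_3,\,x_3x_1$, let $[a:b:c]$ be the corresponding homogeneous coordinates on $\mathbb P_2$, let $Y$ be the blow-up of $X$ along the pull-back of $\mathcal J$, and let $\tau:B\to\mathbb C^3$ be the blow-up of $\mathbb C^3$ along $\mathcal H$ (for $Y$ and $B$, with respect to arbitrary finite families of generators of $\mathcal J$ and $\mathcal H$).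 Then: 1. On the open set $\{a\neq0\}$ of $X$, with $u=b/a$ and $v=c/a$, one has $x_3=ux_1$, and $(x_1,x_2,u,v)$ is an isomorphism of this open set onto the quadric cone $\{x_2v=x_1u\}\subset\mathbb C^4$. The same holds on $\{b\neq0\}$ and $\{c\neq0\}$ after cyclic permutation of $(x_1,x_2,x_3)$ and $(a,b,c)$. 2. The preimage of $\{a\neq0\}$ in $Y$ is the union of two open subsets, each isomorphic to $\mathbb C^3$: one with coordinates $(u,v,z)$, in which $b/a=u$, $c/a=v$ and $x_1=vz$, $x_2=uz$, $x_3=uvz$; the other with coordinates $(s,t,z)$, in which $b/a=tz$, $c/a=sz$ and $x_1=s$, $x_2=t$, $x_3=stz$. The same holds over $\{b\ne0\}$ and $\{c\neq0\}$ after cyclic permutation. 3. $Y$ and $B$ are isomorphic over $\mathbb C^3$. 4. $B$ is a complex manifold of dimension $3$, and it is quasi-projective, that is, isomorphic to a Zariski locally closed subset of some projective space. 5. The exceptional divisor of $\tau$ over $0$, that is, the union of the two-dimensional irreducible components of the fibre $\tau^{-1}(0)$, with its reduced structure, is isomorphic to $\mathbb P_2$. -/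

import Mathlib

open Filter Topology
open scoped LinearAlgebra.Projectivization

/-! ### Reduced complex spaces as spaces with holomorphic functions

The reduced complex spaces that occur here are topological spaces with a sheaf of continuous
complex-valued functions; the sheaf is recorded by saying which functions are holomorphic at
(that is, in a neighbourhood of) a point. -/

/-- A topological space with a notion of holomorphic function germ: being holomorphic at a point
is a local and open condition, implies continuity, and is stable under analytic operations. -/
class HolSpace (X : Type*) [TopologicalSpace X] where
  /-- `IsHolAt f x`: the function `f` is holomorphic near `x`. -/
  IsHolAt : (X → ℂ) → X → Prop
  continuousAt : ∀ {f : X → ℂ} {x : X}, IsHolAt f x → ContinuousAt f x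
  congr : ∀ {f g : X → ℂ} {x : X}, IsHolAt f x → f =ᶠ[𝓝 x] g → IsHolAt g x
  eventually : ∀ {f : X → ℂ} {x : X}, IsHolAt f x → ∀ᶠ y in 𝓝 x, IsHolAt f y
  comp : ∀ {ι : Type} [Fintype ι] {a : ι → X → ℂ} {F : (ι → ℂ) → ℂ} {x : X},
    (∀ i, IsHolAt (a i) x) → AnalyticAt ℂ F (fun i => a i x) →
      IsHolAt (fun y => F (fun i => a i y)) x

/-- The complex number space, with its analytic functions. -/
instance HolSpace.instPi {κ : Type} [Fintype κ] : HolSpace (κ → ℂ) where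
  IsHolAt f x := AnalyticAt ℂ f x
  continuousAt h := h.continuousAt
  congr h e := h.congr e
  eventually h := h.eventually_analyticAt
  comp ha hF := AnalyticAt.comp (g := _) hF (AnalyticAt.pi ha)

/-- Subspaces carry the reduced induced structure: the holomorphic functions are locally the
restrictions of holomorphic functions of the ambient space. -/
instance HolSpace.instSubtype {X : Type*} [TopologicalSpace X] [HolSpace X] (p : X → Prop) :
    HolSpace (Subtype p) where
  IsHolAt f x := ∃ F : X → ℂ, HolSpace.IsHolAt F x.1 ∧ f =ᶠ[𝓝 x] fun y => F y.1
  continuousAt := by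
    rintro f x ⟨F, hF, e⟩
    exact ((HolSpace.continuousAt hF).comp continuous_subtype_val.continuousAt).congr e.symm
  congr := by
    rintro f g x ⟨F, hF, e⟩ h
    exact ⟨F, hF, h.symm.trans e⟩
  eventually := by
    rintro f x ⟨F, hF, e⟩
    have h1 := (continuous_subtype_val (p := p)).continuousAt.eventually
      (HolSpace.eventually hF)
    filter_upwards [h1, e.eventually_nhds] with y hy1 hy2
    exact ⟨F, hy1, hy2⟩
  comp := by
    intro ι _ a F x ha hF
    choose A hA e using ha
    have hx : (fun i => a i x) = fun i => A i x.1 := funext fun i => (e i).self_of_nhds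
    refine ⟨fun y => F fun i => A i y, HolSpace.comp hA (hx ▸ hF), ?_⟩
    filter_upwards [eventually_all.2 e] with y hy
    exact congrArg F (funext hy)

/-- Products: the holomorphic functions on `X × Y` are locally the analytic functions of finitely
many holomorphic functions on `X` and finitely many holomorphic functions on `Y`. -/
instance HolSpace.instProd {X Y : Type*} [TopologicalSpace X] [HolSpace X]
    [TopologicalSpace Y] [HolSpace Y] : HolSpace (X × Y) where
  IsHolAt f p := ∃ (ι κ : Type) (_ : Fintype ι) (_ : Fintype κ) (a : ι → X → ℂ) (b : κ → Y → ℂ)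
    (F : (ι ⊕ κ → ℂ) → ℂ), (∀ i, HolSpace.IsHolAt (a i) p.1) ∧
      (∀ j, HolSpace.IsHolAt (b j) p.2) ∧
      AnalyticAt ℂ F (Sum.elim (fun i => a i p.1) (fun j => b j p.2)) ∧
      f =ᶠ[𝓝 p] fun q => F (Sum.elim (fun i => a i q.1) (fun j => b j q.2))
  continuousAt := by
    rintro f p ⟨ι, κ, _, _, a, b, F, ha, hb, hF, e⟩
    refine ContinuousAt.congr ?_ e.symm
    refine ContinuousAt.comp (g := F) hF.continuousAt (continuousAt_pi.2 ?_)
    rintro (i | j)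
    · exact (HolSpace.continuousAt (ha i)).comp continuous_fst.continuousAt
    · exact (HolSpace.continuousAt (hb j)).comp continuous_snd.continuousAt
  congr := by
    rintro f g p ⟨ι, κ, _, _, a, b, F, ha, hb, hF, e⟩ h
    exact ⟨ι, κ, _, _, a, b, F, ha, hb, hF, h.symm.trans e⟩
  eventually := by
    rintro f p ⟨ι, κ, _, _, a, b, F, ha, hb, hF, e⟩
    have h1 := (continuous_fst (X := X) (Y := Y)).continuousAt (x := p) |>.eventually
      (eventually_all.2 fun i => HolSpace.eventually (ha i))
    have h2 := (continuous_snd (X := X) (Y := Y)).continuousAt (x := p) |>.eventually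
      (eventually_all.2 fun j => HolSpace.eventually (hb j))
    have hc : ContinuousAt (fun q : X × Y =>
        (Sum.elim (fun i => a i q.1) (fun j => b j q.2) : ι ⊕ κ → ℂ)) p := by
      refine continuousAt_pi.2 ?_
      rintro (i | j)
      · exact (HolSpace.continuousAt (ha i)).comp continuous_fst.continuousAt
      · exact (HolSpace.continuousAt (hb j)).comp continuous_snd.continuousAt
    have h3 := hc.eventually hF.eventually_analyticAt
    filter_upwards [h1, h2, h3, e.eventually_nhds] with q q1 q2 q3 q4
    exact ⟨ι, κ, _, _, a, b, F, q1, q2, q3, q4⟩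
  comp := by
    intro τ _ c G p hc hG
    choose ι κ hι hκ a b F ha hb hF e using hc
    have hp : (fun t => c t p) = fun t =>
        F t (Sum.elim (fun i => a t i p.1) (fun j => b t j p.2)) :=
      funext fun t => (e t).self_of_nhds
    -- restriction of the variables to the block of index `t`
    let R : ∀ t, ((Σ t, ι t) ⊕ (Σ t, κ t) → ℂ) →L[ℂ] (ι t ⊕ κ t → ℂ) := fun t =>
      ContinuousLinearMap.pi fun s => ContinuousLinearMap.proj
        (Sum.map (fun i => (⟨t, i⟩ : Σ t, ι t)) (fun j => (⟨t, j⟩ : Σ t, κ t)) s)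
    have hR : ∀ t (q : X × Y), R t (Sum.elim (fun s : Σ t, ι t => a s.1 s.2 q.1)
        (fun s : Σ t, κ t => b s.1 s.2 q.2)) =
          Sum.elim (fun i => a t i q.1) (fun j => b t j q.2) := by
      intro t q
      ext (i | j) <;> simp [R]
    refine ⟨Σ t, ι t, Σ t, κ t, inferInstance, inferInstance, fun s => a s.1 s.2,
      fun s => b s.1 s.2, fun w => G fun t => F t (R t w), fun s => ha _ _, fun s => hb _ _,
      ?_, ?_⟩
    · refine AnalyticAt.comp (g := G) ?_ (AnalyticAt.pi fun t => ?_)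
      · simp only [hR]
        exact hp ▸ hG
      · refine AnalyticAt.comp (g := F t) ?_ ((R t).analyticAt _)
        rw [hR]
        exact hF t
    · filter_upwards [eventually_all.2 e] with q hq
      simp only [hR]
      exact congrArg G (funext hq)

/-! ### Complex projective spaces -/

/-- The quotient topology on a complex projective space. -/
noncomputable instance Projectivization.instTopologicalSpaceComplex {V : Type*} [AddCommGroup V] [Module ℂ V]
    [TopologicalSpace V] : TopologicalSpace (ℙ ℂ V) :=
  TopologicalSpace.coinduced (Projectivization.mk' ℂ) inferInstance

open Classical in
/-- The function `v ↦ f [v]` on nonzero vectors (extended by `0`). -/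
noncomputable def coneFun {κ : Type} (f : ℙ ℂ (κ → ℂ) → ℂ) (v : κ → ℂ) : ℂ :=
  if h : v ≠ 0 then f (Projectivization.mk ℂ v h) else 0

theorem coneFun_of_ne {κ : Type} (f : ℙ ℂ (κ → ℂ) → ℂ) {v : κ → ℂ} (h : v ≠ 0) :
    coneFun f v = f (Projectivization.mk ℂ v h) := by
  simp [coneFun, h]

theorem coneFun_smul {κ : Type} (f : ℙ ℂ (κ → ℂ) → ℂ) (c : ℂˣ) (v : κ → ℂ) :
    coneFun f (c • v) = coneFun f v := by
  by_cases h : v = 0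
  · simp [h]
  · have h' : c • v ≠ 0 := (smul_ne_zero_iff_ne c).2 h
    rw [coneFun_of_ne f h, coneFun_of_ne f h']
    exact congrArg f ((Projectivization.mk_eq_mk_iff ℂ _ _ _ _).2 ⟨c, rfl⟩)

theorem analyticAt_coneFun_smul {κ : Type} [Fintype κ] {f : ℙ ℂ (κ → ℂ) → ℂ} (c : ℂˣ)
    {v : κ → ℂ} (h : AnalyticAt ℂ (coneFun f) (c • v)) : AnalyticAt ℂ (coneFun f) v := by
  have h1 : AnalyticAt ℂ (fun w : κ → ℂ => (c : ℂ) • w) v := by fun_prop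
  have h2 : AnalyticAt ℂ (fun w => coneFun f ((c : ℂ) • w)) v := AnalyticAt.comp (g := coneFun f) h h1
  have h3 : (fun w => coneFun f ((c : ℂ) • w)) = coneFun f := funext fun w => coneFun_smul f c w
  rwa [h3] at h2

theorem Projectivization.isOpenMap_mk' {κ : Type} :
    IsOpenMap (Projectivization.mk' ℂ : {v : κ → ℂ // v ≠ 0} → ℙ ℂ (κ → ℂ)) := by
  intro U hU
  refine isOpen_coinduced.2 ?_
  have hs : ∀ c : ℂˣ, Continuous fun v : {v : κ → ℂ // v ≠ 0} =>
      (⟨c • v.1, (smul_ne_zero_iff_ne c).2 v.2⟩ : {v : κ → ℂ // v ≠ 0}) := fun c =>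
    (continuous_subtype_val.const_smul c).subtype_mk _
  have h : Projectivization.mk' ℂ ⁻¹' (Projectivization.mk' ℂ '' U) =
      ⋃ c : ℂˣ, (fun v : {v : κ → ℂ // v ≠ 0} =>
        (⟨c • v.1, (smul_ne_zero_iff_ne c).2 v.2⟩ : {v : κ → ℂ // v ≠ 0})) ⁻¹' U := by
    ext v
    simp only [Set.mem_preimage, Set.mem_image, Set.mem_iUnion]
    constructor
    · rintro ⟨w, hw, e⟩
      obtain ⟨c, hc⟩ := (Projectivization.mk_eq_mk_iff ℂ _ _ w.2 v.2).1 e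
      refine ⟨c, ?_⟩
      convert hw
    · rintro ⟨c, hc⟩
      exact ⟨_, hc, (Projectivization.mk_eq_mk_iff ℂ _ _ _ _).2 ⟨c, rfl⟩⟩
  rw [h]
  exact isOpen_iUnion fun c => hU.preimage (hs c)

theorem Projectivization.nhds_mk {κ : Type} (v : κ → ℂ) (hv : v ≠ 0) :
    𝓝 (Projectivization.mk ℂ v hv) =
      Filter.map (Projectivization.mk' ℂ) (𝓝 (⟨v, hv⟩ : {v : κ → ℂ // v ≠ 0})) :=
  (Projectivization.isOpenMap_mk'.map_nhds_eq continuous_coinduced_rng.continuousAt).symm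

/-- Projective space: a function is holomorphic when its pull-back to the nonzero vectors is. -/
instance HolSpace.instProjectivization {κ : Type} [Fintype κ] : HolSpace (ℙ ℂ (κ → ℂ)) where
  IsHolAt f p := ∀ (v : κ → ℂ) (hv : v ≠ 0), Projectivization.mk ℂ v hv = p →
    AnalyticAt ℂ (coneFun f) v
  continuousAt := by
    intro f p h
    induction p with | h v hv
    have h1 := (h v hv rfl).continuousAt
    rw [ContinuousAt, Projectivization.nhds_mk, tendsto_map'_iff]
    have h2 : ContinuousAt (fun w : {v : κ → ℂ // v ≠ 0} => coneFun f w.1) ⟨v, hv⟩ :=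
      ContinuousAt.comp (g := coneFun f) h1 continuous_subtype_val.continuousAt
    have h3 : (fun w : {v : κ → ℂ // v ≠ 0} => coneFun f w.1) = f ∘ Projectivization.mk' ℂ :=
      funext fun w => coneFun_of_ne f w.2
    rw [ContinuousAt, h3, coneFun_of_ne f hv] at h2
    exact h2
  congr := by
    rintro f g p h e v hv rfl
    refine (h v hv rfl).congr ?_
    rw [EventuallyEq, Projectivization.nhds_mk, eventually_map, nhds_subtype_eq_comap,
      eventually_comap] at e
    filter_upwards [e, isOpen_ne.mem_nhds hv] with w hw hw0
    rw [coneFun_of_ne f hw0, coneFun_of_ne g hw0]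
    exact hw ⟨w, hw0⟩ rfl
  eventually := by
    intro f p h
    induction p with | h v hv
    rw [Projectivization.nhds_mk, eventually_map]
    have h1 := (continuous_subtype_val (p := fun v : κ → ℂ => v ≠ 0)).continuousAt
      (x := ⟨v, hv⟩) |>.eventually (h v hv rfl).eventually_analyticAt
    filter_upwards [h1] with w hw u hu e
    obtain ⟨c, hc⟩ := (Projectivization.mk_eq_mk_iff ℂ _ _ w.2 hu).1 e.symm
    refine analyticAt_coneFun_smul c ?_
    rw [hc]
    exact hw
  comp := by
    rintro ι _ a F p ha hF v hv rfl
    have hx : (fun i => coneFun (a i) v) = fun i => a i (Projectivization.mk ℂ v hv) :=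
      funext fun i => coneFun_of_ne (a i) hv
    have h1 : AnalyticAt ℂ (fun w => F fun i => coneFun (a i) w) v :=
      AnalyticAt.comp (g := F) (by rw [hx]; exact hF) (AnalyticAt.pi fun i => ha i v hv rfl)
    refine h1.congr ?_
    filter_upwards [isOpen_ne.mem_nhds hv] with w hw
    rw [coneFun_of_ne _ hw]
    exact congrArg F (funext fun i => coneFun_of_ne (a i) hw)

/-! ### Holomorphic maps, complex manifolds, holomorphic functions -/

/-- A morphism of reduced complex spaces: a continuous map that pulls holomorphic functions back
to holomorphic functions. -/
def IsHolMap {X Y : Type*} [TopologicalSpace X] [HolSpace X] [TopologicalSpace Y] [HolSpace Y]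
    (φ : X → Y) : Prop :=
  Continuous φ ∧ ∀ (x : X) (f : Y → ℂ), HolSpace.IsHolAt f (φ x) → HolSpace.IsHolAt (f ∘ φ) x

/-- Isomorphisms of reduced complex spaces (biholomorphic maps). -/
structure Bihol (X Y : Type*) [TopologicalSpace X] [HolSpace X] [TopologicalSpace Y] [HolSpace Y]
    extends X ≃ Y where
  isHolMap_toFun : IsHolMap toFun
  isHolMap_invFun : IsHolMap invFun

/-- The reduced complex space `X` is smooth of dimension `d` at `p`: a neighbourhood of `p` is
isomorphic to an open subset of `ℂ^d`. -/
def IsSmoothOfDimAt (X : Type*) [TopologicalSpace X] [HolSpace X] (d : ℕ) (p : X) : Prop :=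
  ∃ (U : Set X) (V : Set (Fin d → ℂ)), IsOpen U ∧ p ∈ U ∧ IsOpen V ∧ Nonempty (Bihol U V)

/-- The reduced complex space `X` is a complex manifold of pure dimension `d`. -/
def IsComplexManifold (X : Type*) [TopologicalSpace X] [HolSpace X] (d : ℕ) : Prop :=
  T2Space X ∧ SecondCountableTopology X ∧ ∀ p : X, IsSmoothOfDimAt X d p

/-- The union of the `d`-dimensional irreducible components of an analytic subset `A`: the closure
of the set of points at which `A`, with its reduced structure, is smooth of dimension `d`. -/
def componentsOfDim {X : Type*} [TopologicalSpace X] [HolSpace X] (A : Set X) (d : ℕ) : Set X :=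
  closure (Subtype.val '' {p : A | IsSmoothOfDimAt A d p})

/-- The ring `𝒪(X)` of global holomorphic functions on `X`. -/
def holFun (X : Type*) [TopologicalSpace X] [HolSpace X] : Subalgebra ℂ (X → ℂ) where
  carrier := {f | ∀ x, HolSpace.IsHolAt f x}
  mul_mem' := by
    intro f g hf hg x
    exact HolSpace.comp (a := fun b : Bool => bif b then f else g) (F := fun w => w true * w false)
      (by rintro (_ | _) <;> simp [hf x, hg x])
      (((ContinuousLinearMap.proj (R := ℂ) (φ := fun _ : Bool => ℂ) true).analyticAt _).mul
        ((ContinuousLinearMap.proj (R := ℂ) (φ := fun _ : Bool => ℂ) false).analyticAt _))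
  add_mem' := by
    intro f g hf hg x
    exact HolSpace.comp (a := fun b : Bool => bif b then f else g) (F := fun w => w true + w false)
      (by rintro (_ | _) <;> simp [hf x, hg x])
      (((ContinuousLinearMap.proj (R := ℂ) (φ := fun _ : Bool => ℂ) true).analyticAt _).add
        ((ContinuousLinearMap.proj (R := ℂ) (φ := fun _ : Bool => ℂ) false).analyticAt _))
  algebraMap_mem' := by
    intro c x
    exact HolSpace.comp (ι := Empty) (a := fun e => e.elim) (F := fun _ => c)
      (by rintro ⟨⟩) (by fun_prop)

/-! ### Quasi-projectivity -/

/-- The zero locus in `ℙ^N` of a set of homogeneous polynomials. -/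
def projZeros {N : ℕ} (S : Set (MvPolynomial (Fin (N + 1)) ℂ)) : Set (ℙ ℂ (Fin (N + 1) → ℂ)) :=
  {p | ∀ f ∈ S, MvPolynomial.eval p.rep f = 0}

/-- A reduced complex space is quasi-projective if it is isomorphic to a Zariski locally closed
subset of some projective space, with its reduced structure. -/
def IsQuasiProjective (X : Type*) [TopologicalSpace X] [HolSpace X] : Prop :=
  ∃ (N : ℕ) (S T : Set (MvPolynomial (Fin (N + 1)) ℂ)),
    (∀ f ∈ S ∪ T, ∃ d : ℕ, f.IsHomogeneous d) ∧
      Nonempty (Bihol X ↥(projZeros S \ projZeros T))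

/-! ### Blowing up -/

/-- The blow-up of a reduced complex space `X` along the ideal generated by the holomorphic
functions `g i` (whose common zero set has no interior point): the closure in
`X × ℙ(ℂ^ι)` of the graph of the map `x ↦ [g i x]ᵢ` from the complement of the common zeros. -/
def BlowUp {X ι : Type*} [TopologicalSpace X] (g : ι → X → ℂ) : Set (X × ℙ ℂ (ι → ℂ)) :=
  closure {q | ∃ h : (fun i => g i q.1) ≠ 0, q.2 = Projectivization.mk ℂ (fun i => g i q.1) h}

/-- The blowing-down map. -/
def BlowUp.map {X ι : Type*} [TopologicalSpace X] (g : ι → X → ℂ) (p : ↥(BlowUp g)) : X :=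
  p.1.1

/-! ### The ideals and the local models -/

/-- The coordinate functions on `ℂ³`, with `coord3 0 = x₁`,
`coord3 1 = x₂`, `coord3 2 = x₃`; the index is read modulo `3`. -/
noncomputable def coord3 (i : Fin 3) : holFun (Fin 3 → ℂ) :=
  ⟨fun x => x i, fun x =>
    (ContinuousLinearMap.proj (R := ℂ) (φ := fun _ : Fin 3 => ℂ) i).analyticAt x⟩

/-- The generators `(x₁x₂, x₂x₃, x₃x₁)` of the ideal of the union of the coordinate axes. -/
noncomputable def axesGen : Fin 3 → holFun (Fin 3 → ℂ) :=
  ![coord3 0 * coord3 1, coord3 1 * coord3 2, coord3 2 * coord3 0]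

/-- The ideal `(x₃, x₁x₂)(x₁, x₂x₃)(x₂, x₃x₁)`. -/
noncomputable def idealJ : Ideal (holFun (Fin 3 → ℂ)) :=
  Ideal.span {coord3 2, coord3 0 * coord3 1} * Ideal.span {coord3 0, coord3 1 * coord3 2} *
    Ideal.span {coord3 1, coord3 2 * coord3 0}

/-- The ideal `(x₁x₂, x₂x₃, x₃x₁)(x₁, x₂x₃)(x₂, x₃x₁)²(x₃, x₁x₂)²`. -/
noncomputable def idealH : Ideal (holFun (Fin 3 → ℂ)) :=
  Ideal.span {coord3 0 * coord3 1, coord3 1 * coord3 2, coord3 2 * coord3 0} *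
    Ideal.span {coord3 0, coord3 1 * coord3 2} *
    Ideal.span {coord3 1, coord3 2 * coord3 0} ^ 2 * Ideal.span {coord3 2, coord3 0 * coord3 1} ^ 2

/-- The blow-up `X` of `ℂ³` along `(x₁x₂, x₂x₃, x₃x₁)`. -/
abbrev FirstBlowUp : Set ((Fin 3 → ℂ) × ℙ ℂ (Fin 3 → ℂ)) :=
  BlowUp fun i => (axesGen i : (Fin 3 → ℂ) → ℂ)

/-- The open part of `X` where the `i`-th homogeneous coordinate on `ℙ²` is nonzero. -/
def firstChart (i : Fin 3) : Set FirstBlowUp := {p | p.1.2.rep i ≠ 0}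

/-- The ratio `w j / w i` of homogeneous coordinates, as a function on `X`. -/
noncomputable def ratio (j i : Fin 3) (p : FirstBlowUp) : ℂ := p.1.2.rep j / p.1.2.rep i

/-- The quadric cone `t v = s u` in `ℂ⁴` with coordinates `(s, t, u, v)`. -/
def quadricCone : Set (Fin 4 → ℂ) := {w | w 1 * w 3 = w 0 * w 2}

/-- The second blow-up `Y`: the blow-up of `X` along the pull-back of the ideal generated by the
functions `g k` on `ℂ³`. -/
abbrev SecondBlowUp {n : ℕ} (g : Fin n → holFun (Fin 3 → ℂ)) :
    Set (FirstBlowUp × ℙ ℂ (Fin n → ℂ)) :=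
  BlowUp fun k (p : FirstBlowUp) => (g k : (Fin 3 → ℂ) → ℂ) (BlowUp.map _ p)

/-! ### Holomorphic functions at a point -/

namespace HolSpace

section
variable {X Y : Type*} [TopologicalSpace X] [HolSpace X] [TopologicalSpace Y] [HolSpace Y]

/-! Everything is toric. The torus of points of ℂ³ with nonzero coordinates is dense in each of the
spaces involved, and both `Y` and `B` are the smooth toric variety of one fan subdividing the
positive octant. Its rays are e_k, e_j + e_k and (1,1,1). Its six maximal cones are of two kinds:
two of the sums e_j + e_k together with (1,1,1) (charts `true`), or one e_k with the two sums
containing it (charts `false`). The exponents in `toricBase` are the generators of these cones.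

The two cones with the same index i form a quadrilateral cone, which is the quadric cone tv = su in
`X`. There the pull-back of `J` is s²t·(t, u), so blowing it up is a small resolution: it cuts the
quadrilateral along a diagonal. On the other hand `H` is the product of the ideal of the axes, of
`J`, and of (x₂, x₃x₁)(x₃, x₁x₂), and the last factor is already principal in all six charts. Hence
blowing up `H` gives the same charts.

Arbitrary generators are compared with monomial ones by coefficient matrices `G` and `C`
(`SameIdeal`). If the monomial generators become t·μ in a chart, with some entry of μ equal to 1,
the chart lifts to the blow-up, and μ is recovered there from quotients of the linear forms given by
`C`. By density a left inverse suffices to make this a chart (`Principalization.isHolChart`).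
Relations on the graph pass to its closure (`BlowUp.eq_zero_of_graph`) and show that the charts
cover. In a Hausdorff space the gluing of charts is determined by their agreement on the torus
(`IsHolAtlas.eq_iff`). So `Y`, `B` and a locally closed subset of ℙ¹¹ with monomial coordinates, all
having the same six charts, are isomorphic.

In the charts `true` the fibre over 0 is the union of p₂ = 0 and p₀ = p₁ = 0; in the charts `false`
it is p₀ = p₁ = 0. The pieces p₂ = 0 form the divisor of the ray (1,1,1), which is a linearly
embedded ℙ²; the rest consists of curves, excluded by `IsSmoothOfDimAt.le_of_retract`. -/

theorem isHolAt_iff_analyticAt {κ : Type} [Fintype κ] {f : (κ → ℂ) → ℂ} {x : κ → ℂ} :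
    IsHolAt f x ↔ AnalyticAt ℂ f x := Iff.rfl

theorem IsHolAt.const (c : ℂ) (x : X) : IsHolAt (fun _ : X => c) x :=
  HolSpace.comp (ι := Empty) (a := fun e => e.elim) (F := fun _ => c) (by rintro ⟨⟩) (by fun_prop)

theorem IsHolAt.comp_bool {f g : X → ℂ} {x : X} (hf : IsHolAt f x) (hg : IsHolAt g x)
    {F : (Bool → ℂ) → ℂ} (hF : AnalyticAt ℂ F (fun b => bif b then f x else g x)) :
    IsHolAt (fun y => F fun b => bif b then f y else g y) x := by
  have := HolSpace.comp (a := fun b : Bool => bif b then f else g) (F := F) (x := x)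
    (by rintro (_ | _) <;> simp [hf, hg])
    (by convert hF using 2 with b; cases b <;> rfl)
  convert this using 3 with y
  funext b
  cases b <;> rfl

theorem analyticAt_proj {ι : Type} [Fintype ι] (i : ι) (x : ι → ℂ) :
    AnalyticAt ℂ (fun w : ι → ℂ => w i) x :=
  (ContinuousLinearMap.proj (R := ℂ) (φ := fun _ : ι => ℂ) i).analyticAt x

theorem IsHolAt.mul {f g : X → ℂ} {x : X} (hf : IsHolAt f x) (hg : IsHolAt g x) :
    IsHolAt (fun y => f y * g y) x :=
  hf.comp_bool hg (F := fun w => w true * w false) ((analyticAt_proj _ _).mul (analyticAt_proj _ _))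

theorem IsHolAt.pow {f : X → ℂ} {x : X} (hf : IsHolAt f x) (n : ℕ) :
    IsHolAt (fun y => f y ^ n) x := by
  induction n with
  | zero => simpa using IsHolAt.const 1 x
  | succ n ih => simpa only [pow_succ] using ih.mul hf

theorem IsHolAt.add {f g : X → ℂ} {x : X} (hf : IsHolAt f x) (hg : IsHolAt g x) :
    IsHolAt (fun y => f y + g y) x :=
  hf.comp_bool hg (F := fun w => w true + w false) ((analyticAt_proj _ _).add (analyticAt_proj _ _))

theorem IsHolAt.div {f g : X → ℂ} {x : X} (hf : IsHolAt f x) (hg : IsHolAt g x) (h : g x ≠ 0) :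
    IsHolAt (fun y => f y / g y) x :=
  hf.comp_bool hg (F := fun w => w true / w false)
    ((analyticAt_proj _ _).div (analyticAt_proj _ _) (by simpa using h))

theorem IsHolAt.sum {ι : Type*} (s : Finset ι) {f : ι → X → ℂ} {x : X}
    (hf : ∀ i ∈ s, IsHolAt (f i) x) : IsHolAt (fun y => ∑ i ∈ s, f i y) x := by
  classical
  induction s using Finset.induction_on with
  | empty => simpa using IsHolAt.const 0 x
  | insert a s ha ih =>
    simp only [Finset.sum_insert ha]
    exact (hf a (by simp)).add (ih fun i hi => hf i (by simp [hi]))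

theorem IsHolAt.subtype {p : X → Prop} {f : X → ℂ} {x : Subtype p} (hf : IsHolAt f x.1) :
    IsHolAt (fun y : Subtype p => f y.1) x := ⟨f, hf, EventuallyEq.rfl⟩

theorem IsHolAt.fst {f : X → ℂ} {p : X × Y} (hf : IsHolAt f p.1) :
    IsHolAt (fun q : X × Y => f q.1) p :=
  ⟨Unit, Empty, inferInstance, inferInstance, fun _ => f, fun e => e.elim, fun w => w (Sum.inl ()),
    fun _ => hf, fun e => e.elim, analyticAt_proj _ _, EventuallyEq.rfl⟩

theorem IsHolAt.snd {f : Y → ℂ} {p : X × Y} (hf : IsHolAt f p.2) :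
    IsHolAt (fun q : X × Y => f q.2) p :=
  ⟨Empty, Unit, inferInstance, inferInstance, fun e => e.elim, fun _ => f, fun w => w (Sum.inr ()),
    fun e => e.elim, fun _ => hf, analyticAt_proj _ _, EventuallyEq.rfl⟩

theorem isHolAt_coord {κ : Type} [Fintype κ] (i : κ) (x : κ → ℂ) :
    IsHolAt (fun y : κ → ℂ => y i) x := analyticAt_proj i x

end

end HolSpace

/-! ### Homogeneous coordinates -/

namespace Projectivization

variable {κ : Type}

theorem exists_rep_mk (v : κ → ℂ) (hv : v ≠ 0) :
    ∃ c : ℂ, c ≠ 0 ∧ (mk ℂ v hv).rep = c • v := by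
  obtain ⟨a, ha⟩ := exists_smul_eq_mk_rep ℂ v hv
  exact ⟨a, a.ne_zero, ha.symm⟩

theorem mk_smul_eq {v w : κ → ℂ} (hv : v ≠ 0) (hw : w ≠ 0) (c : ℂ) (h : v = c • w) :
    mk ℂ v hv = mk ℂ w hw := (mk_eq_mk_iff' ℂ v w hv hw).2 ⟨c, h.symm⟩

/-- The scalar chosen by `rep` cancels in a quotient, so affine coordinates may be written with
`rep` although `rep` itself is not continuous. -/
theorem rep_div_rep_mk (v : κ → ℂ) (hv : v ≠ 0) (i j : κ) :
    (mk ℂ v hv).rep j / (mk ℂ v hv).rep i = v j / v i := by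
  obtain ⟨c, hc, e⟩ := exists_rep_mk v hv
  simp only [e, Pi.smul_apply, smul_eq_mul]
  exact mul_div_mul_left _ _ hc

theorem rep_mk_ne_zero_iff (v : κ → ℂ) (hv : v ≠ 0) (i : κ) :
    (mk ℂ v hv).rep i ≠ 0 ↔ v i ≠ 0 := by
  obtain ⟨c, hc, e⟩ := exists_rep_mk v hv
  simp [e, hc]

theorem exists_rep_ne_zero (p : ℙ ℂ (κ → ℂ)) : ∃ i, p.rep i ≠ 0 :=
  Function.ne_iff.1 p.rep_nonzero

theorem surjective_mk' : Function.Surjective (mk' ℂ : {v : κ → ℂ // v ≠ 0} → ℙ ℂ (κ → ℂ)) := by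
  intro p
  exact ⟨⟨p.rep, p.rep_nonzero⟩, p.mk_rep⟩

theorem continuous_mk' : Continuous (mk' ℂ : {v : κ → ℂ // v ≠ 0} → ℙ ℂ (κ → ℂ)) :=
  continuous_coinduced_rng

theorem continuous_val_apply (i : κ) : Continuous fun v : {v : κ → ℂ // v ≠ 0} => v.1 i :=
  (continuous_apply i).comp continuous_subtype_val

theorem isOpenQuotientMap_mk' :
    IsOpenQuotientMap (mk' ℂ : {v : κ → ℂ // v ≠ 0} → ℙ ℂ (κ → ℂ)) :=
  ⟨surjective_mk', continuous_mk', isOpenMap_mk'⟩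

theorem mk_eq_mk_iff_mul_eq_mul {v w : κ → ℂ} (hv : v ≠ 0) (hw : w ≠ 0) :
    mk ℂ v hv = mk ℂ w hw ↔ ∀ i j, v i * w j = v j * w i := by
  rw [mk_eq_mk_iff']
  constructor
  · rintro ⟨a, rfl⟩ i j
    simp only [Pi.smul_apply, smul_eq_mul]
    ring
  · intro h
    obtain ⟨i, hi⟩ := Function.ne_iff.1 hw
    refine ⟨v i / w i, ?_⟩
    funext j
    have hi' : w i ≠ 0 := hi
    simp only [Pi.smul_apply, smul_eq_mul]
    field_simp
    rw [h i j, mul_comm]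

/-- Proportionality is cut out by the 2×2 minors, hence closed, and the quotient map is open. -/
instance instT2SpaceComplex [Countable κ] : T2Space (ℙ ℂ (κ → ℂ)) := by
  rw [t2Space_iff_of_isOpenQuotientMap isOpenQuotientMap_mk']
  have : {q : {v : κ → ℂ // v ≠ 0} × {v : κ → ℂ // v ≠ 0} | mk' ℂ q.1 = mk' ℂ q.2} =
      ⋂ i, ⋂ j, {q | q.1.1 i * q.2.1 j = q.1.1 j * q.2.1 i} := by
    ext q
    simp only [Set.mem_ofPred_eq, Set.mem_iInter]
    exact mk_eq_mk_iff_mul_eq_mul q.1.2 q.2.2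
  rw [this]
  refine isClosed_iInter fun i => isClosed_iInter fun j => isClosed_eq ?_ ?_
  · exact ((continuous_val_apply i).comp continuous_fst).mul
      ((continuous_val_apply j).comp continuous_snd)
  · exact ((continuous_val_apply j).comp continuous_fst).mul
      ((continuous_val_apply i).comp continuous_snd)

instance instSecondCountableComplex [Countable κ] : SecondCountableTopology (ℙ ℂ (κ → ℂ)) :=
  haveI : SecondCountableTopology {v : κ → ℂ // v ≠ 0} :=
    TopologicalSpace.Subtype.secondCountableTopology {v : κ → ℂ | v ≠ 0}
  isOpenQuotientMap_mk'.isQuotientMap.secondCountableTopology isOpenMap_mk'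

instance instCompactSpaceComplex [Fintype κ] : CompactSpace (ℙ ℂ (κ → ℂ)) := by
  let f : Metric.sphere (0 : κ → ℂ) 1 → ℙ ℂ (κ → ℂ) := fun v =>
    mk' ℂ ⟨v.1, by
      intro h
      have := v.2
      rw [h] at this
      simp at this⟩
  have hf : Continuous f := continuous_mk'.comp (continuous_subtype_val.subtype_mk _)
  refine ⟨?_⟩
  have : Set.range f = Set.univ := by
    refine Set.eq_univ_of_forall fun p => ?_
    induction p with | h v hv
    have hn : (‖v‖ : ℂ) ≠ 0 := by exact_mod_cast norm_ne_zero_iff.2 hv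
    refine ⟨⟨(‖v‖ : ℂ)⁻¹ • v, by simp [norm_smul, hv]⟩, ?_⟩
    exact mk_smul_eq _ hv _ rfl
  rw [← this]
  exact isCompact_range hf

theorem isHolAt_rep_div_rep [Fintype κ] (i j : κ) (p : ℙ ℂ (κ → ℂ)) (h : p.rep i ≠ 0) :
    HolSpace.IsHolAt (fun q : ℙ ℂ (κ → ℂ) => q.rep j / q.rep i) p := by
  rintro v hv rfl
  have hi : v i ≠ 0 := (rep_mk_ne_zero_iff v hv i).1 h
  refine ((HolSpace.analyticAt_proj j v).div (HolSpace.analyticAt_proj i v) hi).congr ?_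
  filter_upwards [isOpen_ne.mem_nhds hv] with w hw
  rw [coneFun_of_ne _ hw, rep_div_rep_mk]
  rfl

theorem isOpen_rep_ne_zero [Fintype κ] (i : κ) : IsOpen {p : ℙ ℂ (κ → ℂ) | p.rep i ≠ 0} := by
  refine isOpen_coinduced.2 ?_
  have : mk' ℂ ⁻¹' {p : ℙ ℂ (κ → ℂ) | p.rep i ≠ 0} = {v : {v : κ → ℂ // v ≠ 0} | v.1 i ≠ 0} := by
    ext v
    exact rep_mk_ne_zero_iff v.1 v.2 i
  rw [this]
  exact isOpen_ne_fun (continuous_val_apply i) continuous_const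

/-- A homogeneous closed condition that holds on a set near a point of its closure holds at that
point. -/
theorem closure_induction {S : Type*} [TopologicalSpace S] {A : Set (S × ℙ ℂ (κ → ℂ))}
    {F : S × (κ → ℂ) → ℂ} {q : S × ℙ ℂ (κ → ℂ)} (hF : ContinuousAt F (q.1, q.2.rep))
    (hA : ∀ᶠ s in 𝓝 q.1, ∀ (v : κ → ℂ) (hv : v ≠ 0), (s, mk ℂ v hv) ∈ A → F (s, v) = 0)
    (hq : q ∈ closure A) : F (q.1, q.2.rep) = 0 := by
  -- The limit is taken among nonzero vectors, where `F` makes sense; closure commutes with preimage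
  -- under the open continuous map `π`.
  let π : S × {v : κ → ℂ // v ≠ 0} → S × ℙ ℂ (κ → ℂ) := Prod.map id (mk' ℂ)
  have hπo : IsOpenMap π := IsOpenMap.id.prodMap isOpenMap_mk'
  have hπc : Continuous π := continuous_id.prodMap continuous_mk'
  let r : S × {v : κ → ℂ // v ≠ 0} := (q.1, ⟨q.2.rep, q.2.rep_nonzero⟩)
  have h1 : r ∈ π ⁻¹' closure A := by
    change (q.1, mk ℂ q.2.rep q.2.rep_nonzero) ∈ closure A
    rwa [mk_rep]
  rw [hπo.preimage_closure_eq_closure_preimage hπc] at h1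
  have hne : (𝓝[π ⁻¹' A] r).NeBot := mem_closure_iff_nhdsWithin_neBot.1 h1
  have hval : ContinuousAt (fun p : S × {v : κ → ℂ // v ≠ 0} => (p.1, p.2.1)) r :=
    (continuous_fst.prodMk (continuous_subtype_val.comp continuous_snd)).continuousAt
  have h2 : Tendsto (fun p : S × {v : κ → ℂ // v ≠ 0} => F (p.1, p.2.1)) (𝓝[π ⁻¹' A] r)
      (𝓝 (F (q.1, q.2.rep))) :=
    (ContinuousAt.comp (g := F) (f := fun p : S × {v : κ → ℂ // v ≠ 0} => (p.1, p.2.1)) (x := r)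
      hF hval).mono_left nhdsWithin_le_nhds
  have h3 : Tendsto (fun p : S × {v : κ → ℂ // v ≠ 0} => F (p.1, p.2.1)) (𝓝[π ⁻¹' A] r)
      (𝓝 0) := by
    refine tendsto_const_nhds.congr' ?_
    filter_upwards [self_mem_nhdsWithin,
      nhdsWithin_le_nhds ((continuous_fst (X := S)).continuousAt (x := r) |>.eventually hA)]
      with p hp1 hp2
    exact (hp2 p.2.1 p.2.2 hp1).symm
  exact tendsto_nhds_unique h2 h3

end Projectivization

/-! ### Holomorphic maps at a point -/

section
variable {X Y Z : Type*} [TopologicalSpace X] [HolSpace X] [TopologicalSpace Y] [HolSpace Y]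
  [TopologicalSpace Z] [HolSpace Z]

/-- A map that is holomorphic near a point. -/
def IsHolMapAt (φ : X → Y) (x : X) : Prop :=
  ContinuousAt φ x ∧ ∀ f : Y → ℂ, HolSpace.IsHolAt f (φ x) → HolSpace.IsHolAt (f ∘ φ) x

theorem isHolMap_iff {φ : X → Y} : IsHolMap φ ↔ ∀ x, IsHolMapAt φ x :=
  ⟨fun h x => ⟨h.1.continuousAt, h.2 x⟩,
    fun h => ⟨continuous_iff_continuousAt.2 fun x => (h x).1, fun x => (h x).2⟩⟩

theorem IsHolMapAt.congr {φ ψ : X → Y} {x : X} (h : IsHolMapAt φ x) (e : φ =ᶠ[𝓝 x] ψ) :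
    IsHolMapAt ψ x := by
  refine ⟨h.1.congr e, fun f hf => ?_⟩
  rw [← e.self_of_nhds] at hf
  exact HolSpace.congr (h.2 f hf) (e.fun_comp f)

theorem IsHolMapAt.comp {φ : X → Y} {ψ : Y → Z} {x : X} (hψ : IsHolMapAt ψ (φ x))
    (hφ : IsHolMapAt φ x) : IsHolMapAt (fun y => ψ (φ y)) x :=
  ⟨hψ.1.comp hφ.1, fun f hf => hφ.2 (f ∘ ψ) (hψ.2 f hf)⟩

theorem IsHolMapAt.id (x : X) : IsHolMapAt (fun y : X => y) x := ⟨continuousAt_id, fun _ h => h⟩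

theorem IsHolMapAt.const (y : Y) (x : X) : IsHolMapAt (fun _ : X => y) x :=
  ⟨continuousAt_const, fun f _ => HolSpace.IsHolAt.const (f y) x⟩

/-! ### Maps into number spaces, subspaces, products and projective spaces -/

theorem IsHolMapAt.pi {κ : Type} [Fintype κ] {φ : X → κ → ℂ} {x : X}
    (h : ∀ i, HolSpace.IsHolAt (fun y => φ y i) x) : IsHolMapAt φ x :=
  ⟨continuousAt_pi.2 fun i => HolSpace.continuousAt (h i), fun _ hf =>
    HolSpace.comp (a := fun i y => φ y i) h hf⟩

theorem IsHolMapAt.apply {κ : Type} [Fintype κ] {φ : X → κ → ℂ} {x : X} (h : IsHolMapAt φ x)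
    (i : κ) : HolSpace.IsHolAt (fun y => φ y i) x := h.2 (fun y => y i) (HolSpace.isHolAt_coord i _)

theorem IsHolMapAt.subtype_val {p : X → Prop} (x : Subtype p) :
    IsHolMapAt (fun y : Subtype p => y.1) x :=
  ⟨continuous_subtype_val.continuousAt, fun _ hf => hf.subtype⟩

theorem IsHolMapAt.val {p : Y → Prop} {φ : X → Subtype p} {x : X} (h : IsHolMapAt φ x) :
    IsHolMapAt (fun y => (φ y).1) x := (IsHolMapAt.subtype_val (φ x)).comp h

theorem IsHolMapAt.of_val {p : Y → Prop} {φ : X → Subtype p} {x : X}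
    (h : IsHolMapAt (fun y => (φ y).1) x) : IsHolMapAt φ x := by
  have hc : ContinuousAt φ x := Topology.IsInducing.subtypeVal.continuousAt_iff.2 h.1
  refine ⟨hc, ?_⟩
  rintro f ⟨F, hF, e⟩
  have e' : ∀ᶠ y in 𝓝 x, f (φ y) = F (φ y).1 := hc e
  exact HolSpace.congr (h.2 F hF) (e'.mono fun _ hy => hy.symm)

theorem IsHolMapAt.fst {φ : X → Y × Z} {x : X} (h : IsHolMapAt φ x) :
    IsHolMapAt (fun y => (φ y).1) x := ⟨h.1.fst, fun _ hf => h.2 _ hf.fst⟩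

theorem IsHolMapAt.snd {φ : X → Y × Z} {x : X} (h : IsHolMapAt φ x) :
    IsHolMapAt (fun y => (φ y).2) x := ⟨h.1.snd, fun _ hf => h.2 _ hf.snd⟩

theorem IsHolMapAt.prodMk {φ : X → Y} {ψ : X → Z} {x : X} (hφ : IsHolMapAt φ x)
    (hψ : IsHolMapAt ψ x) : IsHolMapAt (fun y => (φ y, ψ y)) x := by
  have hc : ContinuousAt (fun y => (φ y, ψ y)) x := hφ.1.prodMk hψ.1
  refine ⟨hc, ?_⟩
  rintro f ⟨ι, κ, _, _, a, b, F, ha, hb, hF, e⟩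
  have h1 : HolSpace.IsHolAt
      (fun y => F fun s => (Sum.elim (fun i => a i ∘ φ) (fun j => b j ∘ ψ) : ι ⊕ κ → X → ℂ) s y) x := by
    refine HolSpace.comp (a := Sum.elim (fun i => a i ∘ φ) (fun j => b j ∘ ψ)) ?_ ?_
    · rintro (i | j)
      · exact hφ.2 _ (ha i)
      · exact hψ.2 _ (hb j)
    · convert hF using 1
      funext s
      cases s <;> rfl
  refine HolSpace.congr h1 ?_
  filter_upwards [hc.eventually e] with y hy
  rw [Function.comp_apply, hy]
  congr 1
  funext s
  cases s <;> rfl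

/-- A holomorphic function on projective space is by definition one on the cone of nonzero vectors,
so it can be composed with a holomorphic vector of homogeneous coordinates. -/
theorem IsHolMapAt.mk {κ : Type} [Fintype κ] {φ : X → ℙ ℂ (κ → ℂ)} {f : X → κ → ℂ} {x : X}
    (hf : ∀ i, HolSpace.IsHolAt (fun y => f y i) x) (h0 : f x ≠ 0)
    (e : ∀ᶠ y in 𝓝 x, ∀ h : f y ≠ 0, φ y = Projectivization.mk ℂ (f y) h) : IsHolMapAt φ x := by
  have hc : ContinuousAt f x := continuousAt_pi.2 fun i => HolSpace.continuousAt (hf i)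
  have hne : ∀ᶠ y in 𝓝 x, f y ≠ 0 := hc.eventually_ne h0
  have hx : φ x = Projectivization.mk ℂ (f x) h0 := e.self_of_nhds h0
  refine ⟨?_, fun g hg => ?_⟩
  · rw [ContinuousAt, hx]
    intro s hs
    rw [Projectivization.nhds_mk, Filter.mem_map, nhds_subtype_eq_comap, mem_comap] at hs
    obtain ⟨t, ht, hts⟩ := hs
    have ht' : ∀ᶠ y in 𝓝 x, f y ∈ t := hc ht
    change ∀ᶠ y in 𝓝 x, φ y ∈ s
    filter_upwards [e, hne, ht'] with y hy1 hy2 hy3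
    rw [hy1 hy2]
    exact hts (show (⟨f y, hy2⟩ : {v : κ → ℂ // v ≠ 0}) ∈ _ from hy3)
  · rw [hx] at hg
    have h1 := HolSpace.comp (a := fun i y => f y i) hf (hg (f x) h0 rfl)
    refine HolSpace.congr h1 ?_
    filter_upwards [e, hne] with y hy1 hy2
    rw [Function.comp_apply, hy1 hy2]
    exact coneFun_of_ne g hy2

theorem IsHolMapAt.rep_div_rep {κ : Type} [Fintype κ] {φ : X → ℙ ℂ (κ → ℂ)} {x : X}
    (h : IsHolMapAt φ x) (i j : κ) (hi : (φ x).rep i ≠ 0) :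
    HolSpace.IsHolAt (fun y => (φ y).rep j / (φ y).rep i) x :=
  h.2 _ (Projectivization.isHolAt_rep_div_rep i j _ hi)

theorem IsHolMapAt.eventually_rep_ne_zero {κ : Type} [Fintype κ] {φ : X → ℙ ℂ (κ → ℂ)} {x : X}
    (h : IsHolMapAt φ x) (i : κ) (hi : (φ x).rep i ≠ 0) : ∀ᶠ y in 𝓝 x, (φ y).rep i ≠ 0 :=
  h.1.eventually ((Projectivization.isOpen_rep_ne_zero i).mem_nhds hi)

/-- Quotients of linear forms in the homogeneous coordinates, with holomorphic coefficients. -/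
theorem IsHolMapAt.linear_div_linear {κ : Type} [Fintype κ] {φ : X → ℙ ℂ (κ → ℂ)} {x : X}
    (h : IsHolMapAt φ x) {a b : κ → X → ℂ} (ha : ∀ k, HolSpace.IsHolAt (a k) x)
    (hb : ∀ k, HolSpace.IsHolAt (b k) x) (h0 : ∑ k, b k x * (φ x).rep k ≠ 0) :
    HolSpace.IsHolAt
      (fun y => (∑ k, a k y * (φ y).rep k) / ∑ k, b k y * (φ y).rep k) x := by
  obtain ⟨i, hi⟩ := Projectivization.exists_rep_ne_zero (φ x)
  have hs : ∀ {c : κ → X → ℂ}, (∀ k, HolSpace.IsHolAt (c k) x) →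
      HolSpace.IsHolAt (fun y => ∑ k, c k y * ((φ y).rep k / (φ y).rep i)) x := fun hc =>
    HolSpace.IsHolAt.sum _ fun k _ => (hc k).mul (h.rep_div_rep i k hi)
  have e : ∀ (c : κ → X → ℂ) (y : X), ∑ k, c k y * ((φ y).rep k / (φ y).rep i) =
      (∑ k, c k y * (φ y).rep k) / (φ y).rep i := by
    intro c y
    rw [Finset.sum_div]
    exact Finset.sum_congr rfl fun k _ => (mul_div_assoc _ _ _).symm
  have h2 := (hs ha).div (hs hb) (by
    rw [e]
    exact div_ne_zero h0 hi)
  refine HolSpace.congr h2 ?_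
  filter_upwards [h.eventually_rep_ne_zero i hi] with y hy
  rw [e, e, div_div_div_cancel_right₀ hy]

/-- Linear maps between projective spaces, where they are defined. -/
theorem IsHolMapAt.mk_linear {κ ι : Type} [Fintype κ] [Fintype ι] {φ : X → ℙ ℂ (κ → ℂ)} {x : X}
    (h : IsHolMapAt φ x) (M : Matrix ι κ ℂ) {ψ : X → ℙ ℂ (ι → ℂ)}
    (hψ : ∀ y, ∃ hy : M.mulVec (φ y).rep ≠ 0,
      ψ y = Projectivization.mk ℂ (M.mulVec (φ y).rep) hy) : IsHolMapAt ψ x := by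
  obtain ⟨i, hi⟩ := Projectivization.exists_rep_ne_zero (φ x)
  have e : ∀ y l, ∑ k, M l k * ((φ y).rep k / (φ y).rep i) =
      ((φ y).rep i)⁻¹ * M.mulVec (φ y).rep l := by
    intro y l
    rw [Matrix.mulVec, dotProduct, Finset.mul_sum]
    refine Finset.sum_congr rfl fun k _ => ?_
    rw [div_eq_mul_inv]
    ring
  refine IsHolMapAt.mk (f := fun y l => ∑ k, M l k * ((φ y).rep k / (φ y).rep i)) ?_ ?_ ?_
  · intro l
    exact HolSpace.IsHolAt.sum _ fun k _ =>
      (HolSpace.IsHolAt.const _ _).mul (h.rep_div_rep i k hi)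
  · obtain ⟨hy, -⟩ := hψ x
    obtain ⟨l, hl⟩ := Function.ne_iff.1 hy
    refine Function.ne_iff.2 ⟨l, ?_⟩
    rw [e]
    exact mul_ne_zero (inv_ne_zero hi) hl
  · filter_upwards with y hy0
    obtain ⟨hy, e2⟩ := hψ y
    rw [e2]
    refine (Projectivization.mk_smul_eq hy0 hy ((φ y).rep i)⁻¹ ?_).symm
    funext l
    exact e y l

end

/-! ### Biholomorphic maps and smooth points -/

section
variable {X Y : Type*} [TopologicalSpace X] [HolSpace X] [TopologicalSpace Y] [HolSpace Y]

theorem isSmoothOfDimAt_of_local_inverse {d : ℕ} {p : X} (U : Set X) (V : Set (Fin d → ℂ))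
    (hU : IsOpen U) (hp : p ∈ U) (hV : IsOpen V) (f : X → Fin d → ℂ) (g : (Fin d → ℂ) → X)
    (hf : ∀ x ∈ U, IsHolMapAt f x) (hg : ∀ v ∈ V, IsHolMapAt g v)
    (hfU : ∀ x ∈ U, f x ∈ V) (hgV : ∀ v ∈ V, g v ∈ U)
    (hgf : ∀ x ∈ U, g (f x) = x) (hfg : ∀ v ∈ V, f (g v) = v) : IsSmoothOfDimAt X d p := by
  refine ⟨U, V, hU, hp, hV, ⟨⟨⟨fun x => ⟨f x, hfU _ x.2⟩, fun v => ⟨g v, hgV _ v.2⟩, fun x =>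
    Subtype.ext (hgf _ x.2), fun v => Subtype.ext (hfg _ v.2)⟩, ?_, ?_⟩⟩⟩
  · exact isHolMap_iff.2 fun x => .of_val ((hf x.1 x.2).comp (.subtype_val x))
  · exact isHolMap_iff.2 fun v => .of_val ((hg v.1 v.2).comp (.subtype_val v))

/-- A point near which the space is a holomorphic retract of `ℂ^e` is not smooth of a dimension
greater than `e`. -/
theorem IsSmoothOfDimAt.le_of_retract {d e : ℕ} {p : X} (h : IsSmoothOfDimAt X d p)
    (ζ : X → Fin e → ℂ) (l : (Fin e → ℂ) → X) (hζ : IsHolMapAt ζ p) (hl : IsHolMapAt l (ζ p))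
    (hlζ : ∀ᶠ q in 𝓝 p, l (ζ q) = q) : d ≤ e := by
  classical
  obtain ⟨U, V, hU, hp, hV, ⟨Φ⟩⟩ := h
  let b : V := Φ.toFun ⟨p, hp⟩
  have hΦb : Φ.invFun b = ⟨p, hp⟩ := Φ.left_inv _
  have hVn : ∀ᶠ v in 𝓝 b.1, v ∈ V := hV.mem_nhds b.2
  have hlp : l (ζ p) = p := hlζ.self_of_nhds
  -- the inverse of the chart
  let β : (Fin d → ℂ) → X := fun v => if hv : v ∈ V then (Φ.invFun ⟨v, hv⟩).1 else p
  have hβb : β b.1 = p := by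
    have : (⟨b.1, b.2⟩ : V) = b := rfl
    simp only [β, b.2, dif_pos, this, hΦb]
  have hβV : ∀ v (hv : v ∈ V), β v = (Φ.invFun ⟨v, hv⟩).1 := fun v hv => by simp [β, hv]
  have hβ : IsHolMapAt β b.1 := by
    have h1 : IsHolMapAt (fun v : V => β v.1) b := by
      have := ((isHolMap_iff.1 Φ.isHolMap_invFun b).val)
      refine this.congr (Eventually.of_forall fun v => ?_)
      exact (hβV v.1 v.2).symm
    refine ⟨?_, fun f hf => ?_⟩
    · exact (hV.isOpenEmbedding_subtypeVal.continuousAt_iff (x := b) (g := β)).1 h1.1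
    · obtain ⟨F, hF, e⟩ := h1.2 f hf
      refine HolSpace.congr hF ?_
      have h2 : map Subtype.val (𝓝 b) = 𝓝 b.1 := hV.isOpenEmbedding_subtypeVal.map_nhds_eq b
      rw [EventuallyEq, ← h2, eventually_map]
      exact e.symm
  -- The value `0` off `U` is immaterial: `U` is open and only germs at `p` count.
  let α : X → Fin d → ℂ := fun x => if hx : x ∈ U then (Φ.toFun ⟨x, hx⟩).1 else 0
  have hαU : ∀ x (hx : x ∈ U), α x = (Φ.toFun ⟨x, hx⟩).1 := fun x hx => by simp [α, hx]
  have hα : ContinuousAt α p ∧ ∀ f : (Fin d → ℂ) → ℂ, HolSpace.IsHolAt f (α p) →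
      HolSpace.IsHolAt (f ∘ α) p := by
    have h1 : IsHolMapAt (fun x : U => α x.1) ⟨p, hp⟩ := by
      refine ((isHolMap_iff.1 Φ.isHolMap_toFun ⟨p, hp⟩).val).congr
        (Eventually.of_forall fun x => ?_)
      exact (hαU x.1 x.2).symm
    refine ⟨?_, fun f hf => ?_⟩
    · exact (hU.isOpenEmbedding_subtypeVal.continuousAt_iff (x := ⟨p, hp⟩) (g := α)).1 h1.1
    · obtain ⟨F, hF, e⟩ := h1.2 f hf
      refine HolSpace.congr hF ?_
      have h2 : map Subtype.val (𝓝 (⟨p, hp⟩ : U)) = 𝓝 p :=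
        hU.isOpenEmbedding_subtypeVal.map_nhds_eq ⟨p, hp⟩
      rw [EventuallyEq, ← h2, eventually_map]
      exact e.symm
  -- the identity factors through `ℂ^e`
  have hζβ : IsHolMapAt (fun v => ζ (β v)) b.1 := IsHolMapAt.comp (hβb ▸ hζ) hβ
  have hαl : IsHolMapAt (fun w => α (l w)) (ζ p) :=
    IsHolMapAt.comp (φ := l) (ψ := α) (hlp.symm ▸ hα) hl
  have hA : DifferentiableAt ℂ (fun v => ζ (β v)) b.1 :=
    differentiableAt_pi.2 fun i => AnalyticAt.differentiableAt (hζβ.apply i)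
  have hB : DifferentiableAt ℂ (fun w => α (l w)) (ζ (β b.1)) := by
    rw [hβb]
    exact differentiableAt_pi.2 fun i => AnalyticAt.differentiableAt (hαl.apply i)
  have hid : (fun w => α (l w)) ∘ (fun v => ζ (β v)) =ᶠ[𝓝 b.1] _root_.id := by
    have h3 := hβ.1.eventually (p := fun q => l (ζ q) = q) (by rw [hβb]; exact hlζ)
    filter_upwards [h3, hVn] with v hv1 hv2
    simp only [Function.comp_apply, hv1]
    rw [hβV v hv2, hαU _ (Φ.invFun ⟨v, hv2⟩).2]
    exact congrArg Subtype.val (Φ.right_inv ⟨v, hv2⟩)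
  have hcomp := (hB.hasFDerivAt.comp b.1 hA.hasFDerivAt).congr_of_eventuallyEq hid.symm
  have huniq := hcomp.unique (hasFDerivAt_id b.1)
  -- By the chain rule the derivative of `ζ ∘ β` has a left inverse, so ℂ^d injects linearly into
  -- ℂ^e.
  have hinj : Function.Injective (fderiv ℂ (fun v => ζ (β v)) b.1) := by
    intro v w hvw
    have h4 := DFunLike.congr_fun huniq v
    have h5 := DFunLike.congr_fun huniq w
    simp only [ContinuousLinearMap.comp_apply, ContinuousLinearMap.id_apply] at h4 h5
    rw [← h4, ← h5, hvw]
  simpa using LinearMap.finrank_le_finrank_of_injective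
    (f := (fderiv ℂ (fun v => ζ (β v)) b.1).toLinearMap) hinj

end

/-! ### Charts and gluing -/

/-- A holomorphic chart: `φ` maps `ℂ^d` biholomorphically onto the open set `O`, with inverse
given by `ψ`. -/
structure IsHolChart {Z : Type*} [TopologicalSpace Z] [HolSpace Z] {d : ℕ}
    (φ : (Fin d → ℂ) → Z) (ψ : Z → Fin d → ℂ) (O : Set Z) : Prop where
  isOpen : IsOpen O
  mem : ∀ p, φ p ∈ O
  hol : ∀ p, IsHolMapAt φ p
  hol_inv : ∀ q ∈ O, IsHolMapAt ψ q
  left : ∀ p, ψ (φ p) = p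
  right : ∀ q ∈ O, φ (ψ q) = q

namespace IsHolChart

variable {Z : Type*} [TopologicalSpace Z] [HolSpace Z] {d : ℕ} {φ : (Fin d → ℂ) → Z}
  {ψ : Z → Fin d → ℂ} {O : Set Z}

theorem continuous (h : IsHolChart φ ψ O) : Continuous φ :=
  continuous_iff_continuousAt.2 fun p => (h.hol p).1

theorem exists_bihol (h : IsHolChart φ ψ O) :
    ∃ Φ : Bihol (Fin d → ℂ) O, ∀ p, (Φ.toEquiv p : Z) = φ p :=
  ⟨⟨⟨fun p => ⟨φ p, h.mem p⟩, fun q => ψ q.1, h.left, fun q => Subtype.ext (h.right q.1 q.2)⟩,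
    isHolMap_iff.2 fun p => .of_val (h.hol p),
    isHolMap_iff.2 fun q => (h.hol_inv q.1 q.2).comp (.subtype_val q)⟩, fun _ => rfl⟩

theorem isSmoothOfDimAt (h : IsHolChart φ ψ O) {q : Z} (hq : q ∈ O) : IsSmoothOfDimAt Z d q :=
  isSmoothOfDimAt_of_local_inverse O Set.univ h.isOpen hq isOpen_univ ψ φ h.hol_inv
    (fun v _ => h.hol v) (fun _ _ => trivial) (fun v _ => h.mem v) h.right (fun v _ => h.left v)

theorem mem_closure {P : Type*} [TopologicalSpace P] {A : Set P} {φ : (Fin d → ℂ) → P}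
    {D : Set (Fin d → ℂ)} (hD : Dense D) (hA : φ '' D = A) (hφ : Continuous φ)
    (p : Fin d → ℂ) : φ p ∈ closure A := by
  rw [← hA]
  exact image_closure_subset_closure_image hφ ⟨p, hD p, rfl⟩

/-- Charts of a closure are recognized on a dense subset. -/
theorem of_closure {P : Type*} [TopologicalSpace P] [HolSpace P] [T2Space P] {A : Set P}
    {Z : Set P} (hZ : Z ⊆ closure A)
    {φ : (Fin d → ℂ) → P} {ψ : P → Fin d → ℂ} {O : Set P} (hO : IsOpen O)
    (hφO : ∀ p, φ p ∈ O) (hφ : ∀ p, IsHolMapAt φ p) (hψ : ∀ q ∈ O, IsHolMapAt ψ q)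
    (hψφ : ∀ p, ψ (φ p) = p) (hA : A ⊆ Set.range φ) (hφZ : ∀ p, φ p ∈ Z) :
    IsHolChart (fun p => (⟨φ p, hφZ p⟩ : Z)) (fun q => ψ q.1) (Subtype.val ⁻¹' O) where
  isOpen := hO.preimage continuous_subtype_val
  mem := hφO
  hol p := .of_val (hφ p)
  hol_inv q hq := (hψ q.1 hq).comp (.subtype_val q)
  left := hψφ
  right := by
    rintro ⟨q, hq⟩ hqO
    refine Subtype.ext ?_
    -- On `A` the composite `φ ∘ ψ` is the identity. The point `q` is a limit of points of `A`, and
    -- limits are unique in `P`.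
    have hne : (𝓝[A] q).NeBot := mem_closure_iff_nhdsWithin_neBot.1 (hZ hq)
    have hc : ContinuousAt (fun r => φ (ψ r)) q := ((hφ _).comp (hψ q hqO)).1
    have h1 : Tendsto (fun r => φ (ψ r)) (𝓝[A] q) (𝓝 (φ (ψ q))) := hc.mono_left nhdsWithin_le_nhds
    have h2 : Tendsto (fun r => φ (ψ r)) (𝓝[A] q) (𝓝 q) := by
      refine (tendsto_id.mono_left nhdsWithin_le_nhds).congr' ?_
      filter_upwards [self_mem_nhdsWithin] with r hr
      obtain ⟨p, rfl⟩ := hA hr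
      rw [hψφ]
      rfl
    exact tendsto_nhds_unique h1 h2

end IsHolChart

/-- An atlas of charts `ℂ^d → Z` that agree on dense subsets of their domains, which are
parametrized by the set `T`. -/
structure IsHolAtlas {Z : Type*} [TopologicalSpace Z] [HolSpace Z] {d : ℕ} {Γ T : Type*}
    (τ : Γ → T → Fin d → ℂ) (φ : Γ → (Fin d → ℂ) → Z) (ψ : Γ → Z → Fin d → ℂ)
    (O : Γ → Set Z) : Prop where
  chart : ∀ c, IsHolChart (φ c) (ψ c) (O c)
  cover : ∀ q, ∃ c, q ∈ O c
  compat : ∀ c e x, φ c (τ c x) = φ e (τ e x)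

namespace IsHolAtlas

variable {Z Z' : Type*} [TopologicalSpace Z] [HolSpace Z] [TopologicalSpace Z'] [HolSpace Z']
  {d : ℕ} {Γ T : Type*} {τ : Γ → T → Fin d → ℂ} {φ : Γ → (Fin d → ℂ) → Z} {ψ : Γ → Z → Fin d → ℂ}
  {O : Γ → Set Z} {φ' : Γ → (Fin d → ℂ) → Z'} {ψ' : Γ → Z' → Fin d → ℂ} {O' : Γ → Set Z'}

/-- The pairs of parameters with the same image form a closed set because `Z` is Hausdorff, and by
continuity of the coordinate change each such pair is a limit of pairs coming from `T`. The
right-hand side involves only `τ`, so it is the same for every Hausdorff space with such an atlas.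
-/
theorem eq_iff [T2Space Z] (h : IsHolAtlas τ φ ψ O) (hτ : ∀ c, DenseRange (τ c)) (c e : Γ)
    (p q : Fin d → ℂ) :
    φ c p = φ e q ↔ (p, q) ∈ closure (Set.range fun x => (τ c x, τ e x)) := by
  constructor
  · intro hpq
    have hp : φ c p ∈ O e := hpq ▸ (h.chart e).mem q
    have hc : ContinuousAt (fun r => (r, ψ e (φ c r))) p :=
      continuousAt_id.prodMk ((((h.chart e).hol_inv _ hp).comp ((h.chart c).hol p)).1)
    have h1 := mem_closure_image hc (hτ c p)
    rw [hpq, (h.chart e).left] at h1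
    refine closure_mono ?_ h1
    rintro _ ⟨_, ⟨x, rfl⟩, rfl⟩
    refine ⟨x, ?_⟩
    change _ = (τ c x, ψ e (φ c (τ c x)))
    rw [h.compat c e x, (h.chart e).left]
  · intro hpq
    have hcl : IsClosed {r : (Fin d → ℂ) × (Fin d → ℂ) | φ c r.1 = φ e r.2} :=
      isClosed_eq ((h.chart c).continuous.comp continuous_fst)
        ((h.chart e).continuous.comp continuous_snd)
    refine closure_minimal ?_ hcl hpq
    rintro _ ⟨x, rfl⟩
    exact h.compat c e x

theorem exists_map [T2Space Z] [T2Space Z'] (h : IsHolAtlas τ φ ψ O)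
    (h' : IsHolAtlas τ φ' ψ' O') (hτ : ∀ c, DenseRange (τ c)) :
    ∃ f : Z → Z', IsHolMap f ∧ ∀ c p, f (φ c p) = φ' c p := by
  choose c hc using h.cover
  -- Independence of the chosen chart: the coincidence of two chart points in `Z` is translated by
  -- `eq_iff` into a condition on `τ`, and back into a coincidence in `Z'`.
  have key : ∀ e p, φ' (c (φ e p)) (ψ (c (φ e p)) (φ e p)) = φ' e p := by
    intro e p
    rw [h'.eq_iff hτ, ← h.eq_iff hτ, (h.chart _).right _ (hc _)]
  refine ⟨fun q => φ' (c q) (ψ (c q) q), isHolMap_iff.2 fun q => ?_, key⟩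
  have h1 : IsHolMapAt (fun r => φ' (c q) (ψ (c q) r)) q :=
    ((h'.chart _).hol _).comp ((h.chart _).hol_inv q (hc q))
  refine h1.congr ?_
  filter_upwards [(h.chart (c q)).isOpen.mem_nhds (hc q)] with r hr
  have h2 := key (c q) (ψ (c q) r)
  rw [(h.chart (c q)).right r hr] at h2
  exact h2.symm

/-- Hausdorff spaces with atlases of the same shape are isomorphic. -/
theorem exists_bihol [T2Space Z] [T2Space Z'] (h : IsHolAtlas τ φ ψ O)
    (h' : IsHolAtlas τ φ' ψ' O') (hτ : ∀ c, DenseRange (τ c)) :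
    ∃ Φ : Bihol Z Z', ∀ c p, Φ.toEquiv (φ c p) = φ' c p := by
  obtain ⟨f, hf, hfφ⟩ := h.exists_map h' hτ
  obtain ⟨g, hg, hgφ⟩ := h'.exists_map h hτ
  refine ⟨⟨⟨f, g, fun q => ?_, fun q => ?_⟩, hf, hg⟩, hfφ⟩
  · obtain ⟨c, hc⟩ := h.cover q
    rw [← (h.chart c).right q hc, hfφ, hgφ]
  · obtain ⟨c, hc⟩ := h'.cover q
    rw [← (h'.chart c).right q hc, hgφ, hfφ]

end IsHolAtlas

/-! ### Charts of blow-ups -/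

/-- The linear form in the homogeneous coordinates that corresponds to a combination of the
generators. -/
noncomputable def linForm {S : Type*} {ι : Type} [Fintype ι] (C : ι → S → ℂ) (q : S × ℙ ℂ (ι → ℂ)) : ℂ :=
  ∑ k, C k q.1 * q.2.rep k

/-- The scalar is common to all forms, so quotients of two forms can be computed with any
representative. -/
theorem linForm_mk {S : Type*} {ι : Type} [Fintype ι] (s : S) (v : ι → ℂ) (hv : v ≠ 0) :
    ∃ c : ℂ, c ≠ 0 ∧ ∀ D : ι → S → ℂ,
      linForm D (s, Projectivization.mk ℂ v hv) = c * ∑ k, D k s * v k := by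
  obtain ⟨c, hc, e⟩ := Projectivization.exists_rep_mk v hv
  refine ⟨c, hc, fun D => ?_⟩
  simp only [linForm, e, Pi.smul_apply, smul_eq_mul, Finset.mul_sum]
  exact Finset.sum_congr rfl fun k _ => by ring

/-- Homogeneous relations between the generators hold for the homogeneous coordinates. -/
theorem BlowUp.eq_zero_of_graph {S : Type*} [TopologicalSpace S] {ι : Type} {g : ι → S → ℂ}
    {F : S × (ι → ℂ) → ℂ} {q : S × ℙ ℂ (ι → ℂ)} (hF : ContinuousAt F (q.1, q.2.rep))
    (hc : ∀ s v (c : ℂ), F (s, v) = 0 → F (s, c • v) = 0)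
    (hg : ∀ᶠ s in 𝓝 q.1, F (s, fun i => g i s) = 0) (hq : q ∈ BlowUp g) :
    F (q.1, q.2.rep) = 0 := by
  refine Projectivization.closure_induction hF ?_ hq
  filter_upwards [hg] with s hs
  rintro v hv ⟨h, e⟩
  obtain ⟨c, hc'⟩ := (Projectivization.mk_eq_mk_iff' ℂ _ _ hv h).1 e
  change c • (fun i => g i s) = v at hc'
  rw [← hc']
  exact hc s _ c hs

section
variable {S : Type*} [TopologicalSpace S] [HolSpace S]

theorem BlowUp.isHolMap_map {ι : Type} [Fintype ι] (g : ι → S → ℂ) : IsHolMap (BlowUp.map g) :=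
  isHolMap_iff.2 fun q => (IsHolMapAt.subtype_val q).fst

/-- The part of the graph over a dense set is dense in the blow-up. -/
theorem BlowUp.subset_closure {ι T : Type} [Fintype ι] {g : ι → S → ℂ}
    (hg : ∀ i s, HolSpace.IsHolAt (g i) s) {e : T → S} (he : DenseRange e)
    (hge : ∀ x, (fun i => g i (e x)) ≠ 0) :
    BlowUp g ⊆ closure (Set.range fun x => (e x, Projectivization.mk ℂ _ (hge x))) := by
  classical
  refine closure_minimal ?_ isClosed_closure
  rintro ⟨s, p⟩ ⟨h, hp⟩
  -- The filler `p` at common zeros of the generators plays no role: they do not vanish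
  -- simultaneously near `s`, where `f` is the graph map.
  let f : S → S × ℙ ℂ (ι → ℂ) := fun s' =>
    (s', if h : (fun i => g i s') ≠ 0 then Projectivization.mk ℂ _ h else p)
  have hf : ∀ s' (h : (fun i => g i s') ≠ 0), f s' = (s', Projectivization.mk ℂ _ h) := by
    intro s' h
    simp only [f]
    rw [dif_pos h]
  have hc : IsHolMapAt f s := by
    refine (IsHolMapAt.id s).prodMk (IsHolMapAt.mk (f := fun s' i => g i s') (fun i => hg i s) h ?_)
    filter_upwards with s' h'
    rw [dif_pos h']
  have h1 := mem_closure_image hc.1 (he s)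
  rw [hf s h] at h1
  change p = _ at hp
  rw [hp]
  refine closure_mono ?_ h1
  rintro _ ⟨_, ⟨x, rfl⟩, rfl⟩
  exact ⟨x, (hf _ (hge x)).symm⟩

theorem isHolAt_linForm_div {ι : Type} [Fintype ι] {C D : ι → S → ℂ} {q : S × ℙ ℂ (ι → ℂ)}
    (hC : ∀ k, HolSpace.IsHolAt (C k) q.1) (hD : ∀ k, HolSpace.IsHolAt (D k) q.1)
    (h0 : linForm D q ≠ 0) : HolSpace.IsHolAt (fun r => linForm C r / linForm D r) q :=
  (IsHolMapAt.id q).snd.linear_div_linear (fun k => (hC k).fst) (fun k => (hD k).fst) h0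

theorem isOpen_linForm_ne_zero {ι : Type} [Fintype ι] {C : ι → S → ℂ}
    (hC : ∀ k s, HolSpace.IsHolAt (C k) s) : IsOpen {q | linForm C q ≠ 0} := by
  refine isOpen_iff_mem_nhds.2 fun q hq => ?_
  obtain ⟨i, hi⟩ := Projectivization.exists_rep_ne_zero q.2
  have h1 : HolSpace.IsHolAt
      (fun r : S × ℙ ℂ (ι → ℂ) => ∑ k, C k r.1 * (r.2.rep k / r.2.rep i)) q :=
    HolSpace.IsHolAt.sum _ fun k _ => (hC k q.1).fst.mul ((IsHolMapAt.id q).snd.rep_div_rep i k hi)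
  have e : ∀ r : S × ℙ ℂ (ι → ℂ), ∑ k, C k r.1 * (r.2.rep k / r.2.rep i) =
      linForm C r / r.2.rep i := by
    intro r
    rw [linForm, Finset.sum_div]
    exact Finset.sum_congr rfl fun k _ => (mul_div_assoc _ _ _).symm
  have h2 := (HolSpace.continuousAt h1).eventually_ne (y := 0) (by
    rw [e]
    exact div_ne_zero hq hi)
  filter_upwards [h2] with r hr h0
  rw [e, h0, zero_div] at hr
  exact hr rfl

/-- Two families of functions on `S` that generate the same ideal, with the coefficients. -/
structure SameIdeal {ι r : Type} [Fintype ι] [Fintype r] (g : ι → S → ℂ) (m : r → S → ℂ)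
    (G : ι → r → S → ℂ) (C : r → ι → S → ℂ) : Prop where
  hol_left : ∀ k s, HolSpace.IsHolAt (g k) s
  hol_G : ∀ k l s, HolSpace.IsHolAt (G k l) s
  hol_C : ∀ l k s, HolSpace.IsHolAt (C l k) s
  left_eq : ∀ k s, g k s = ∑ l, G k l s * m l s
  right_eq : ∀ l s, m l s = ∑ k, C l k s * g k s

namespace SameIdeal

variable {ι r : Type} [Fintype ι] [Fintype r] {g : ι → S → ℂ} {m : r → S → ℂ}
  {G : ι → r → S → ℂ} {C : r → ι → S → ℂ}

theorem continuous_left (h : SameIdeal g m G C) (k : ι) : Continuous (g k) :=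
  continuous_iff_continuousAt.2 fun s => HolSpace.continuousAt (h.hol_left k s)

theorem continuous_G (h : SameIdeal g m G C) (k : ι) (l : r) : Continuous (G k l) :=
  continuous_iff_continuousAt.2 fun s => HolSpace.continuousAt (h.hol_G k l s)

theorem continuous_C (h : SameIdeal g m G C) (l : r) (k : ι) : Continuous (C l k) :=
  continuous_iff_continuousAt.2 fun s => HolSpace.continuousAt (h.hol_C l k s)

/-- On the blow-up, a homogeneous relation between the functions `m` holds for the linear forms. -/
theorem eq_zero_of_graph (h : SameIdeal g m G C) {F : S × (r → ℂ) → ℂ} {q : S × ℙ ℂ (ι → ℂ)}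
    (hF : ContinuousAt F (q.1, fun l => linForm (C l) q))
    (hc : ∀ s v (c : ℂ), F (s, v) = 0 → F (s, c • v) = 0)
    (hm : ∀ᶠ s in 𝓝 q.1, F (s, fun l => m l s) = 0) (hq : q ∈ BlowUp g) : F (q.1, fun l => linForm (C l) q) = 0 := by
  have hC := h.continuous_C
  refine BlowUp.eq_zero_of_graph (g := g)
    (F := fun p => F (p.1, fun l => ∑ k, C l k p.1 * p.2 k)) ?_ ?_ ?_ hq
  · have h1 : Continuous fun p : S × (ι → ℂ) => (p.1, fun l => ∑ k, C l k p.1 * p.2 k) := by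
      fun_prop
    exact ContinuousAt.comp (g := F) hF h1.continuousAt
  · intro s v c h0
    have : (fun l => ∑ k, C l k s * (c • v) k) = c • fun l => ∑ k, C l k s * v k := by
      funext l
      simp only [Pi.smul_apply, smul_eq_mul, Finset.mul_sum]
      exact Finset.sum_congr rfl fun k _ => by ring
    change F (s, fun l => ∑ k, C l k s * (c • v) k) = 0
    rw [this]
    exact hc s _ c h0
  · filter_upwards [hm] with s hs
    simpa only [← h.right_eq] using hs

/-- Substituting m = Cg into g = Gm gives g = GCg, a linear relation that persists on the closure of
the graph. If all forms given by `C` vanished, all homogeneous coordinates would. -/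
theorem exists_linForm_ne_zero (h : SameIdeal g m G C) {q : S × ℙ ℂ (ι → ℂ)}
    (hq : q ∈ BlowUp g) : ∃ l, linForm (C l) q ≠ 0 := by
  by_contra! h0
  obtain ⟨k, hk⟩ := Projectivization.exists_rep_ne_zero q.2
  refine hk ?_
  have hC := h.continuous_C
  have hG := h.continuous_G
  have h1 := BlowUp.eq_zero_of_graph (g := g)
    (F := fun p => p.2 k - ∑ l, G k l p.1 * ∑ j, C l j p.1 * p.2 j)
    (Continuous.continuousAt (by fun_prop)) ?_ ?_ hq
  · refine (sub_eq_zero.1 h1).trans ?_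
    refine Finset.sum_eq_zero fun l _ => ?_
    have h2 : ∑ j, C l j q.1 * q.2.rep j = 0 := h0 l
    simp only [h2, mul_zero]
  · intro s v c h0
    have : ∑ l, G k l s * ∑ j, C l j s * (c * v j) =
        c * ∑ l, G k l s * ∑ j, C l j s * v j := by
      simp only [Finset.mul_sum]
      exact Finset.sum_congr rfl fun l _ => Finset.sum_congr rfl fun j _ => by ring
    simp only [Pi.smul_apply, smul_eq_mul] at h0 ⊢
    rw [this]
    linear_combination c * h0
  · filter_upwards with s
    simp only [← h.right_eq, ← h.left_eq, sub_self]

end SameIdeal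

/-- A chart `π` in which the functions `m` become multiples of a common factor `t`, by functions
`μ` one of which is equal to `1`; the points `e x` are generic. -/
structure Principalization {r T : Type} {d : ℕ} (m : r → S → ℂ) (e : T → S)
    (π : (Fin d → ℂ) → S) (τ : T → Fin d → ℂ) (t : (Fin d → ℂ) → ℂ)
    (μ : (Fin d → ℂ) → r → ℂ) (l₀ : r) : Prop where
  dense : DenseRange τ
  hol : ∀ p, IsHolMapAt π p
  hol_μ : ∀ l p, HolSpace.IsHolAt (fun p => μ p l) p
  map_τ : ∀ x, π (τ x) = e x
  t_ne_zero : ∀ x, t (τ x) ≠ 0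
  eq_mul : ∀ p l, m l (π p) = t p * μ p l
  eq_one : ∀ p, μ p l₀ = 1

namespace Principalization

variable {ι r T : Type} [Fintype ι] [Fintype r] {d : ℕ} {g : ι → S → ℂ} {m : r → S → ℂ}
  {G : ι → r → S → ℂ} {C : r → ι → S → ℂ} {e : T → S} {π : (Fin d → ℂ) → S}
  {τ : T → Fin d → ℂ} {t : (Fin d → ℂ) → ℂ} {μ : (Fin d → ℂ) → r → ℂ} {l₀ : r}

theorem left_eq_mul (P : Principalization m e π τ t μ l₀) (h : SameIdeal g m G C)
    (p : Fin d → ℂ) (k : ι) : g k (π p) = t p * ∑ l, G k l (π p) * μ p l := by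
  rw [h.left_eq, Finset.mul_sum]
  refine Finset.sum_congr rfl fun l _ => ?_
  rw [P.eq_mul]
  ring

/-- Since m = Cg and g = Gm, one has tCGμ = tμ in the chart. The factor `t` can be cancelled on the
dense set parametrized by `τ`, and then everywhere by continuity. -/
theorem sum_eq (P : Principalization m e π τ t μ l₀) (h : SameIdeal g m G C)
    (p : Fin d → ℂ) (l : r) : ∑ k, C l k (π p) * ∑ j, G k j (π p) * μ p j = μ p l := by
  have hπ : Continuous π := continuous_iff_continuousAt.2 fun p => (P.hol p).1
  have hμ : ∀ l, Continuous fun p => μ p l := fun l =>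
    continuous_iff_continuousAt.2 fun p => HolSpace.continuousAt (P.hol_μ l p)
  have hC := fun l k => (h.continuous_C l k).comp hπ
  have hG := fun k l => (h.continuous_G k l).comp hπ
  have hcl : IsClosed {p | ∑ k, C l k (π p) * ∑ j, G k j (π p) * μ p j = μ p l} :=
    isClosed_eq (continuous_finsetSum _ fun k _ => (hC l k).mul
      (continuous_finsetSum _ fun j _ => (hG k j).mul (hμ j))) (hμ l)
  refine P.dense.induction_on (p := fun p => ∑ k, C l k (π p) * ∑ j, G k j (π p) * μ p j = μ p l)
    p hcl fun x => ?_
  have h1 := h.right_eq l (π (τ x))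
  rw [P.eq_mul] at h1
  refine mul_left_cancel₀ (P.t_ne_zero x) ?_
  rw [h1, Finset.mul_sum]
  refine Finset.sum_congr rfl fun k _ => ?_
  rw [P.left_eq_mul h]
  ring

theorem vec_ne_zero (P : Principalization m e π τ t μ l₀) (h : SameIdeal g m G C)
    (p : Fin d → ℂ) : (fun k => ∑ l, G k l (π p) * μ p l) ≠ 0 := by
  intro h0
  have h1 := P.sum_eq h p l₀
  rw [P.eq_one] at h1
  refine zero_ne_one (α := ℂ) (h1 ▸ ?_)
  exact (Finset.sum_eq_zero fun k _ => by rw [congrFun h0 k]; simp).symm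

/-- The chart of the blow-up. -/
noncomputable def lift (P : Principalization m e π τ t μ l₀) (h : SameIdeal g m G C)
    (p : Fin d → ℂ) : S × ℙ ℂ (ι → ℂ) :=
  (π p, Projectivization.mk ℂ _ (P.vec_ne_zero h p))

theorem linForm_lift (P : Principalization m e π τ t μ l₀) (h : SameIdeal g m G C)
    (p : Fin d → ℂ) : ∃ c : ℂ, c ≠ 0 ∧ ∀ l, linForm (C l) (P.lift h p) = c * μ p l := by
  obtain ⟨c, hc, e⟩ := linForm_mk (π p) _ (P.vec_ne_zero h p)
  refine ⟨c, hc, fun l => ?_⟩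
  rw [lift, e, P.sum_eq h]

theorem linForm_lift_ne_zero (P : Principalization m e π τ t μ l₀) (h : SameIdeal g m G C)
    (p : Fin d → ℂ) : linForm (C l₀) (P.lift h p) ≠ 0 := by
  obtain ⟨c, hc, e⟩ := P.linForm_lift h p
  rw [e, P.eq_one, mul_one]
  exact hc

theorem linForm_lift_div (P : Principalization m e π τ t μ l₀) (h : SameIdeal g m G C)
    (p : Fin d → ℂ) (l : r) : linForm (C l) (P.lift h p) / linForm (C l₀) (P.lift h p) = μ p l := by
  obtain ⟨c, hc, e⟩ := P.linForm_lift h p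
  rw [e, e, P.eq_one, mul_one, mul_div_cancel_left₀ _ hc]

theorem isHolMapAt_lift (P : Principalization m e π τ t μ l₀) (h : SameIdeal g m G C)
    (p : Fin d → ℂ) : IsHolMapAt (P.lift h) p := by
  refine (P.hol p).prodMk (IsHolMapAt.mk (f := fun p k => ∑ l, G k l (π p) * μ p l) ?_
    (P.vec_ne_zero h p) (Eventually.of_forall fun _ _ => rfl))
  intro k
  exact HolSpace.IsHolAt.sum _ fun l _ => ((P.hol p).2 _ (h.hol_G k l _)).mul (P.hol_μ l p)

theorem gen_ne_zero (P : Principalization m e π τ t μ l₀) (h : SameIdeal g m G C)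
    (x : T) : (fun k => g k (e x)) ≠ 0 := by
  intro h0
  have h1 := h.right_eq l₀ (π (τ x))
  rw [P.eq_mul, P.eq_one, mul_one, P.map_τ] at h1
  refine P.t_ne_zero x (h1.trans ?_)
  exact Finset.sum_eq_zero fun k _ => by rw [congrFun h0 k]; simp

/-- At a generic point the lifted vector is the vector of generators divided by `t`. The right-hand
side does not mention the chart, so charts with the same `e` agree there. -/
theorem lift_τ (P : Principalization m e π τ t μ l₀) (h : SameIdeal g m G C) (x : T) :
    P.lift h (τ x) = (e x, Projectivization.mk ℂ _ (P.gen_ne_zero h x)) := by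
  refine Prod.ext (P.map_τ x) (Projectivization.mk_smul_eq _ _ (t (τ x))⁻¹ ?_)
  funext k
  rw [Pi.smul_apply, smul_eq_mul, ← P.map_τ, P.left_eq_mul h, inv_mul_cancel_left₀ (P.t_ne_zero x)]

theorem lift_mem (P : Principalization m e π τ t μ l₀) (h : SameIdeal g m G C)
    (p : Fin d → ℂ) : P.lift h p ∈ BlowUp g := by
  have h1 := IsHolChart.mem_closure P.dense rfl
    (continuous_iff_continuousAt.2 fun p => (P.isHolMapAt_lift h p).1) p
  refine closure_mono ?_ h1
  rintro _ ⟨_, ⟨x, rfl⟩, rfl⟩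
  rw [P.lift_τ h]
  exact ⟨P.gen_ne_zero h x, rfl⟩

/-- Only a left inverse `ψ` of the lift has to be supplied: the lift contains the graph over the
dense set of generic points, so it fills the open set where the form of index `l₀` does not vanish.
-/
theorem isHolChart [T2Space S] (P : Principalization m e π τ t μ l₀) (h : SameIdeal g m G C)
    (he : DenseRange e) {ψ : S × ℙ ℂ (ι → ℂ) → Fin d → ℂ} {O : Set S} (hO : IsOpen O)
    (hπ : ∀ p, π p ∈ O)
    (hψ : ∀ q : S × ℙ ℂ (ι → ℂ), q.1 ∈ O → linForm (C l₀) q ≠ 0 → IsHolMapAt ψ q)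
    (hψφ : ∀ p, ψ (P.lift h p) = p) :
    IsHolChart (fun p => (⟨P.lift h p, P.lift_mem h p⟩ : BlowUp g)) (fun q => ψ q.1)
      {q | q.1.1 ∈ O ∧ linForm (C l₀) q.1 ≠ 0} := by
  refine IsHolChart.of_closure (O := {q | q.1 ∈ O ∧ linForm (C l₀) q ≠ 0})
    (BlowUp.subset_closure h.hol_left he (P.gen_ne_zero h)) ?_ ?_ (P.isHolMapAt_lift h) ?_ hψφ ?_ _
  · exact (hO.preimage continuous_fst).inter (isOpen_linForm_ne_zero (h.hol_C l₀))
  · exact fun p => ⟨hπ p, P.linForm_lift_ne_zero h p⟩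
  · exact fun q hq => hψ q hq.1 hq.2
  · rintro _ ⟨x, rfl⟩
    exact ⟨τ x, P.lift_τ h x⟩

end Principalization

end

/-! ### The toric charts -/

/-- The vector with coordinates `a`, `b`, `c` in the places `i`, `i + 1`, `i + 2` modulo `3`. -/
def cyc (i : Fin 3) (a b c : ℂ) : Fin 3 → ℂ := fun j => ![a, b, c] (j - i)

theorem cyc_zero (i : Fin 3) (a b c : ℂ) : cyc i a b c i = a := by simp [cyc]

theorem cyc_one (i : Fin 3) (a b c : ℂ) : cyc i a b c (i + 1) = b := by simp [cyc]

theorem cyc_two (i : Fin 3) (a b c : ℂ) : cyc i a b c (i + 2) = c := by simp [cyc]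

theorem cyc_eta (i : Fin 3) (x : Fin 3 → ℂ) : cyc i (x i) (x (i + 1)) (x (i + 2)) = x := by
  funext j
  fin_cases i <;> fin_cases j <;> rfl

theorem forall_cyc {P : Fin 3 → Prop} (i : Fin 3) (h0 : P i) (h1 : P (i + 1)) (h2 : P (i + 2))
    (j : Fin 3) : P j := by
  fin_cases i <;> fin_cases j <;> assumption

theorem isHolAt_cyc {X : Type*} [TopologicalSpace X] [HolSpace X] {a b c : X → ℂ} {x : X}
    (ha : HolSpace.IsHolAt a x) (hb : HolSpace.IsHolAt b x) (hc : HolSpace.IsHolAt c x)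
    (i j : Fin 3) : HolSpace.IsHolAt (fun y => cyc i (a y) (b y) (c y) j) x := by
  unfold cyc
  generalize j - i = k
  fin_cases k <;> assumption

/-- The points of `ℂ³` with nonzero coordinates. -/
abbrev Torus : Type := {x : Fin 3 → ℂ // ∀ i, x i ≠ 0}

theorem dense_torus : Dense {x : Fin 3 → ℂ | ∀ i, x i ≠ 0} := by
  have := dense_pi (ι := Fin 3) (α := fun _ => ℂ) Set.univ (s := fun _ => {0}ᶜ)
    (fun _ _ => dense_compl_singleton 0)
  convert this using 1
  ext x
  simp

/-- The monomial chart `ℂ³ → ℂ³`. -/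
def toricBase : Bool → Fin 3 → (Fin 3 → ℂ) → Fin 3 → ℂ
  | true, i, p => cyc i (p 1 * p 2) (p 0 * p 2) (p 0 * p 1 * p 2)
  | false, i, p => cyc i (p 0) (p 1) (p 0 * p 1 * p 2)

/-- The homogeneous coordinates `[a : b : c]` in the monomial charts. -/
def toricPlane : Bool → Fin 3 → (Fin 3 → ℂ) → Fin 3 → ℂ
  | true, i, p => cyc i 1 (p 0) (p 1)
  | false, i, p => cyc i 1 (p 1 * p 2) (p 0 * p 2)

/-- The coordinates on the torus that correspond to the monomial charts. -/
noncomputable def toricCoord : Bool → Fin 3 → Torus → Fin 3 → ℂ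
  | true, i, x => ![x.1 (i + 2) / x.1 i, x.1 (i + 2) / x.1 (i + 1),
      x.1 i * x.1 (i + 1) / x.1 (i + 2)]
  | false, i, x => ![x.1 i, x.1 (i + 1), x.1 (i + 2) / (x.1 i * x.1 (i + 1))]

theorem toricBase_toricCoord (b : Bool) (i : Fin 3) (x : Torus) :
    toricBase b i (toricCoord b i x) = x.1 := by
  have h0 := x.2 i
  have h1 := x.2 (i + 1)
  have h2 := x.2 (i + 2)
  rw [← cyc_eta i x.1]
  cases b <;> simp only [toricBase, toricCoord, Matrix.cons_val] <;> congr 1 <;> field_simp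

theorem toricCoord_ne_zero (b : Bool) (i : Fin 3) (x : Torus) (j : Fin 3) :
    toricCoord b i x j ≠ 0 := by
  have h0 := x.2 i
  have h1 := x.2 (i + 1)
  have h2 := x.2 (i + 2)
  cases b <;> fin_cases j <;> simp [toricCoord, h0, h1, h2]

/-- The exponent matrix is unimodular, so the monomial map is an automorphism of the torus, with
`toricCoord` as its inverse; the range is the whole torus. -/
theorem denseRange_toricCoord (b : Bool) (i : Fin 3) : DenseRange (toricCoord b i) := by
  refine dense_torus.mono fun p hp => ?_
  have h0 : p 0 ≠ 0 := hp 0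
  have h1 : p 1 ≠ 0 := hp 1
  have h2 : p 2 ≠ 0 := hp 2
  have hb : ∀ j, toricBase b i p j ≠ 0 := by
    refine forall_cyc i ?_ ?_ ?_ <;> cases b <;>
      simp only [toricBase, cyc_zero, cyc_one, cyc_two] <;>
      simp [h0, h1, h2]
  refine ⟨⟨toricBase b i p, hb⟩, ?_⟩
  funext j
  cases b <;> fin_cases j <;>
    simp [toricBase, toricCoord, cyc_zero, cyc_one, cyc_two] <;> field_simp

theorem isHolMapAt_toricBase (b : Bool) (i : Fin 3) (p : Fin 3 → ℂ) :
    IsHolMapAt (toricBase b i) p := by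
  refine IsHolMapAt.pi fun j => ?_
  have h := fun k => HolSpace.isHolAt_coord k p
  cases b
  · exact isHolAt_cyc (h 0) (h 1) (((h 0).mul (h 1)).mul (h 2)) i j
  · exact isHolAt_cyc ((h 1).mul (h 2)) ((h 0).mul (h 2)) (((h 0).mul (h 1)).mul (h 2)) i j

theorem isHolAt_toricPlane (b : Bool) (i j : Fin 3) (p : Fin 3 → ℂ) :
    HolSpace.IsHolAt (fun q => toricPlane b i q j) p := by
  have h := fun k => HolSpace.isHolAt_coord k p
  cases b
  · exact isHolAt_cyc (HolSpace.IsHolAt.const 1 p) ((h 1).mul (h 2)) ((h 0).mul (h 2)) i j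
  · exact isHolAt_cyc (HolSpace.IsHolAt.const 1 p) (h 0) (h 1) i j

theorem toricPlane_self (b : Bool) (i : Fin 3) (p : Fin 3 → ℂ) : toricPlane b i p i = 1 := by
  cases b <;> exact cyc_zero _ _ _ _

theorem toricPlane_ne_zero (b : Bool) (i : Fin 3) (p : Fin 3 → ℂ) : toricPlane b i p ≠ 0 :=
  fun h => one_ne_zero ((toricPlane_self b i p).symm.trans (congrFun h i))

theorem axesGen_apply (j : Fin 3) (x : Fin 3 → ℂ) :
    (axesGen j : (Fin 3 → ℂ) → ℂ) x = x j * x (j + 1) := by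
  fin_cases j <;> rfl

/-- The common factor of the generators `axesGen` in the monomial charts. -/
def toricAxesFactor : Bool → (Fin 3 → ℂ) → ℂ
  | true, p => p 0 * p 1 * p 2 ^ 2
  | false, p => p 0 * p 1

theorem toricBase_mul (b : Bool) (i : Fin 3) (p : Fin 3 → ℂ) (j : Fin 3) :
    toricBase b i p j * toricBase b i p (j + 1) = toricAxesFactor b p * toricPlane b i p j := by
  cases b <;> fin_cases i <;> fin_cases j <;>
    simp [toricBase, toricPlane, toricAxesFactor, cyc] <;> ring

/-! ### The first blow-up -/

/-- The generators of the first blow-up are fixed, and identity matrices bring it under the general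
construction. -/
theorem SameIdeal.refl {S : Type*} [TopologicalSpace S] [HolSpace S] {ι : Type} [Fintype ι]
    [DecidableEq ι] (g : ι → S → ℂ) (hg : ∀ k s, HolSpace.IsHolAt (g k) s) :
    SameIdeal g g (fun k l _ => if k = l then 1 else 0) (fun k l _ => if k = l then 1 else 0) where
  hol_left := hg
  hol_G _ _ s := HolSpace.IsHolAt.const _ s
  hol_C _ _ s := HolSpace.IsHolAt.const _ s
  left_eq _ _ := by simp
  right_eq _ _ := by simp

theorem principalization_axesGen (b : Bool) (i : Fin 3) :
    Principalization (fun j x => (axesGen j : (Fin 3 → ℂ) → ℂ) x) (Subtype.val : Torus → _)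
      (toricBase b i) (toricCoord b i) (toricAxesFactor b) (toricPlane b i) i where
  dense := denseRange_toricCoord b i
  hol := isHolMapAt_toricBase b i
  hol_μ := isHolAt_toricPlane b i
  map_τ := toricBase_toricCoord b i
  t_ne_zero x := by
    have h := toricCoord_ne_zero b i x
    cases b <;> simp [toricAxesFactor, h]
  eq_mul p j := by rw [axesGen_apply, toricBase_mul]
  eq_one := toricPlane_self b i

theorem denseRange_torus : DenseRange (Subtype.val : Torus → Fin 3 → ℂ) := by
  rw [DenseRange, Subtype.range_coe_subtype]
  exact dense_torus

theorem sameIdeal_axesGen : SameIdeal (fun j x => (axesGen j : (Fin 3 → ℂ) → ℂ) x)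
    (fun j x => (axesGen j : (Fin 3 → ℂ) → ℂ) x) (fun k l _ => if k = l then 1 else 0)
    (fun k l _ => if k = l then 1 else 0) :=
  SameIdeal.refl _ fun j => (axesGen j).2

/-- The monomial charts, as maps to the first blow-up. -/
noncomputable def toricPoint (b : Bool) (i : Fin 3) (p : Fin 3 → ℂ) : FirstBlowUp :=
  ⟨(principalization_axesGen b i).lift sameIdeal_axesGen p,
    (principalization_axesGen b i).lift_mem sameIdeal_axesGen p⟩

theorem toricPoint_val (b : Bool) (i : Fin 3) (p : Fin 3 → ℂ) :
    (toricPoint b i p).1 =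
      (toricBase b i p, Projectivization.mk ℂ (toricPlane b i p) (toricPlane_ne_zero b i p)) := by
  refine Prod.ext rfl (Projectivization.mk_smul_eq _ _ 1 ?_)
  funext k
  simp

theorem map_toricPoint (b : Bool) (i : Fin 3) (p : Fin 3 → ℂ) :
    BlowUp.map _ (toricPoint b i p) = toricBase b i p := rfl

theorem ratio_toricPoint (b : Bool) (i j : Fin 3) (p : Fin 3 → ℂ) :
    ratio j i (toricPoint b i p) = toricPlane b i p j := by
  rw [ratio, toricPoint_val, Projectivization.rep_div_rep_mk, toricPlane_self, div_one]

theorem toricPoint_mem_firstChart (b : Bool) (i : Fin 3) (p : Fin 3 → ℂ) :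
    toricPoint b i p ∈ firstChart i := by
  change (toricPoint b i p).1.2.rep i ≠ 0
  rw [toricPoint_val, Projectivization.rep_mk_ne_zero_iff, toricPlane_self]
  exact one_ne_zero

theorem isHolMapAt_toricPoint (b : Bool) (i : Fin 3) (p : Fin 3 → ℂ) :
    IsHolMapAt (toricPoint b i) p :=
  .of_val ((principalization_axesGen b i).isHolMapAt_lift sameIdeal_axesGen p)

/-- The generic points of the first blow-up. -/
noncomputable def torusPoint (x : Torus) : FirstBlowUp := toricPoint true 0 (toricCoord true 0 x)

/-- Every chart sends the torus to the graph, so the chart used to define `torusPoint` is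
immaterial. -/
theorem toricPoint_toricCoord (b : Bool) (i : Fin 3) (x : Torus) :
    toricPoint b i (toricCoord b i x) = torusPoint x := by
  refine Subtype.ext ?_
  exact ((principalization_axesGen b i).lift_τ sameIdeal_axesGen x).trans
    ((principalization_axesGen true 0).lift_τ sameIdeal_axesGen x).symm

theorem denseRange_torusPoint : DenseRange torusPoint := by
  intro q
  rw [closure_subtype, ← Set.range_comp]
  have h1 := BlowUp.subset_closure sameIdeal_axesGen.hol_left denseRange_torus
    ((principalization_axesGen true 0).gen_ne_zero sameIdeal_axesGen) q.2
  refine closure_mono ?_ h1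
  rintro _ ⟨x, rfl⟩
  exact ⟨x, (principalization_axesGen true 0).lift_τ sameIdeal_axesGen x⟩

theorem isOpen_firstChart (i : Fin 3) : IsOpen (firstChart i) :=
  (Projectivization.isOpen_rep_ne_zero i).preimage (continuous_snd.comp continuous_subtype_val)

theorem exists_mem_firstChart (q : FirstBlowUp) : ∃ i, q ∈ firstChart i :=
  Projectivization.exists_rep_ne_zero q.1.2

theorem isHolAt_ratio (i j : Fin 3) {q : FirstBlowUp} (hq : q ∈ firstChart i) :
    HolSpace.IsHolAt (ratio j i) q :=
  (IsHolMapAt.subtype_val q).snd.rep_div_rep i j hq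

theorem isHolAt_map (j : Fin 3) (q : FirstBlowUp) :
    HolSpace.IsHolAt (fun q : FirstBlowUp => BlowUp.map _ q j) q :=
  (IsHolMapAt.subtype_val q).fst.apply j

/-! ### Relations between coordinates and ratios; the quadric cones -/

theorem Fin.three_add_two_add_one (i : Fin 3) : i + 2 + 1 = i := by
  fin_cases i <;> rfl

theorem Fin.three_add_one_add_one (i : Fin 3) : i + 1 + 1 = i + 2 := by
  fin_cases i <;> rfl

/-- With homogeneous coordinates w, both x_{i+2}w_i and x_i w_{i+1} equal x₁x₂x₃ on the graph,
because w_j = x_j x_{j+1} there; the relation extends to the closure. -/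
theorem map_eq_ratio_mul {i : Fin 3} {q : FirstBlowUp} (hq : q ∈ firstChart i) :
    BlowUp.map _ q (i + 2) = ratio (i + 1) i q * BlowUp.map _ q i := by
  have h := BlowUp.eq_zero_of_graph
    (F := fun r : (Fin 3 → ℂ) × (Fin 3 → ℂ) => r.1 (i + 2) * r.2 i - r.2 (i + 1) * r.1 i)
    (Continuous.continuousAt (by fun_prop)) ?_ ?_ q.2
  · have hq' : q.1.2.rep i ≠ 0 := hq
    change q.1.1 (i + 2) = q.1.2.rep (i + 1) / q.1.2.rep i * q.1.1 i
    field_simp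
    linear_combination h
  · intro s v c h0
    simp only [Pi.smul_apply, smul_eq_mul] at h0 ⊢
    linear_combination c * h0
  · filter_upwards with x
    simp only [axesGen_apply, Fin.three_add_one_add_one]
    ring

/-- Again x_{i+1}w_{i+2} and x_i w_{i+1} both equal x₁x₂x₃ on the graph. This is the equation of the
cone. -/
theorem map_mul_ratio {i : Fin 3} {q : FirstBlowUp} (hq : q ∈ firstChart i) :
    BlowUp.map _ q (i + 1) * ratio (i + 2) i q = BlowUp.map _ q i * ratio (i + 1) i q := by
  have h := BlowUp.eq_zero_of_graph
    (F := fun r : (Fin 3 → ℂ) × (Fin 3 → ℂ) => r.1 (i + 1) * r.2 (i + 2) - r.1 i * r.2 (i + 1))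
    (Continuous.continuousAt (by fun_prop)) ?_ ?_ q.2
  · have hq' : q.1.2.rep i ≠ 0 := hq
    change q.1.1 (i + 1) * (q.1.2.rep (i + 2) / q.1.2.rep i) =
      q.1.1 i * (q.1.2.rep (i + 1) / q.1.2.rep i)
    field_simp
    linear_combination h
  · intro s v c h0
    simp only [Pi.smul_apply, smul_eq_mul] at h0 ⊢
    linear_combination c * h0
  · filter_upwards with x
    simp only [axesGen_apply, Fin.three_add_one_add_one, Fin.three_add_two_add_one]
    ring

theorem axesGen_eq_ratio_mul {i : Fin 3} {q : FirstBlowUp} (hq : q ∈ firstChart i) (j : Fin 3) :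
    (axesGen j : (Fin 3 → ℂ) → ℂ) (BlowUp.map _ q) =
      ratio j i q * (axesGen i : (Fin 3 → ℂ) → ℂ) (BlowUp.map _ q) := by
  have hc := sameIdeal_axesGen.continuous_left
  have h := BlowUp.eq_zero_of_graph
    (F := fun r : (Fin 3 → ℂ) × (Fin 3 → ℂ) => r.2 i * (axesGen j : (Fin 3 → ℂ) → ℂ) r.1 -
      r.2 j * (axesGen i : (Fin 3 → ℂ) → ℂ) r.1)
    (Continuous.continuousAt (by fun_prop)) ?_ ?_ q.2
  · have hq' : q.1.2.rep i ≠ 0 := hq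
    rw [ratio, div_mul_eq_mul_div, eq_div_iff hq', mul_comm]
    exact sub_eq_zero.1 h
  · intro s v c h0
    simp only [Pi.smul_apply, smul_eq_mul] at h0 ⊢
    linear_combination c * h0
  · filter_upwards with x
    ring

theorem cyc_one_ne_zero (i : Fin 3) (u v : ℂ) : cyc i 1 u v ≠ 0 :=
  fun h => one_ne_zero ((cyc_zero i 1 u v).symm.trans (congrFun h i))

/-- Each point of the cone lies in the image of one of the two monomial charts, whose images lie in
the closure of the graph: the second kind serves where u = v = 0, the first kind elsewhere. -/
theorem mk_cyc_mem_firstBlowUp (i : Fin 3) {w : Fin 4 → ℂ} (hw : w ∈ quadricCone) :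
    (cyc i (w 0) (w 1) (w 2 * w 0),
      Projectivization.mk ℂ (cyc i 1 (w 2) (w 3)) (cyc_one_ne_zero i _ _)) ∈ FirstBlowUp := by
  have hw' : w 1 * w 3 = w 0 * w 2 := hw
  obtain ⟨b, p, h1, h2⟩ : ∃ b p, cyc i (w 0) (w 1) (w 2 * w 0) = toricBase b i p ∧
      cyc i 1 (w 2) (w 3) = toricPlane b i p := by
    by_cases h3 : w 3 = 0
    · by_cases h2 : w 2 = 0
      · exact ⟨false, ![w 0, w 1, 0], by simp [toricBase, h2], by simp [toricPlane, h2, h3]⟩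
      · have h0 : w 0 = 0 := by simpa [h3, h2] using hw'
        -- In a chart of the first kind x_{i+1} = uz and x_i = vz; here u ≠ 0, so z comes from the
        -- first equation.
        refine ⟨true, ![w 2, w 3, w 1 / w 2], ?_, by simp [toricPlane]⟩
        simp only [toricBase, Matrix.cons_val, h0, h3, zero_mul, mul_zero]
        rw [mul_div_cancel₀ _ h2]
    -- Now v ≠ 0, so z comes from x_i = vz; the equation of the cone then gives x_{i+1} = uz.
    · refine ⟨true, ![w 2, w 3, w 0 / w 3], ?_, by simp [toricPlane]⟩
      simp only [toricBase, Matrix.cons_val]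
      congr 1 <;> field_simp
      linear_combination hw'
  have h3 := (toricPoint b i p).2
  rw [toricPoint_val] at h3
  simpa only [h1, h2] using h3

theorem exists_bihol_quadricCone (i : Fin 3) :
    ∃ Φ : Bihol (firstChart i) quadricCone, ∀ p : firstChart i,
      (Φ.toEquiv p : Fin 4 → ℂ) = ![BlowUp.map _ p.1 i, BlowUp.map _ p.1 (i + 1),
        ratio (i + 1) i p.1, ratio (i + 2) i p.1] ∧
      BlowUp.map _ p.1 (i + 2) = ratio (i + 1) i p.1 * BlowUp.map _ p.1 i := by
  refine ⟨⟨⟨fun p => ⟨![BlowUp.map _ p.1 i, BlowUp.map _ p.1 (i + 1), ratio (i + 1) i p.1,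
      ratio (i + 2) i p.1], map_mul_ratio p.2⟩,
    fun w => ⟨⟨_, mk_cyc_mem_firstBlowUp i w.2⟩, ?_⟩, fun p => ?_, fun w => ?_⟩, ?_, ?_⟩,
    fun p => ⟨rfl, map_eq_ratio_mul p.2⟩⟩
  · change (Projectivization.mk ℂ (cyc i 1 (w.1 2) (w.1 3)) (cyc_one_ne_zero i _ _)).rep i ≠ 0
    rw [Projectivization.rep_mk_ne_zero_iff, cyc_zero]
    exact one_ne_zero
  · refine Subtype.ext (Subtype.ext (Prod.ext ?_ ?_))
    · simp only [Matrix.cons_val]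
      rw [← map_eq_ratio_mul p.2, cyc_eta]
      rfl
    · have hp : p.1.1.2.rep i ≠ 0 := p.2
      refine Eq.trans (Projectivization.mk_smul_eq _ p.1.1.2.rep_nonzero (p.1.1.2.rep i)⁻¹ ?_)
        (Projectivization.mk_rep _)
      rw [← cyc_eta i ((p.1.1.2.rep i)⁻¹ • p.1.1.2.rep)]
      simp only [Matrix.cons_val, ratio, Pi.smul_apply, smul_eq_mul, inv_mul_cancel₀ hp]
      congr 1 <;> exact div_eq_inv_mul _ _
  · refine Subtype.ext ?_
    have hr : ∀ j, ratio j i ⟨_, mk_cyc_mem_firstBlowUp i w.2⟩ = cyc i 1 (w.1 2) (w.1 3) j := by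
      intro j
      refine Eq.trans (Projectivization.rep_div_rep_mk _ (cyc_one_ne_zero i _ _) i j) ?_
      rw [cyc_zero, div_one]
    simp only [hr, BlowUp.map, cyc_zero, cyc_one, cyc_two]
    funext k
    fin_cases k <;> rfl
  · refine isHolMap_iff.2 fun p => .of_val (.pi fun k => ?_)
    have hp := IsHolMapAt.subtype_val p
    fin_cases k
    · exact hp.2 _ (isHolAt_map i p.1)
    · exact hp.2 _ (isHolAt_map (i + 1) p.1)
    · exact hp.2 _ (isHolAt_ratio i (i + 1) p.2)
    · exact hp.2 _ (isHolAt_ratio i (i + 2) p.2)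
  · refine isHolMap_iff.2 fun w => .of_val (.of_val (.prodMk (.pi fun j => ?_) ?_))
    · have h := fun k => (IsHolMapAt.subtype_val w).apply k
      exact isHolAt_cyc (h 0) (h 1) ((h 2).mul (h 0)) i j
    · have h := fun k => (IsHolMapAt.subtype_val w).apply k
      exact .mk (f := fun w : quadricCone => cyc i 1 (w.1 2) (w.1 3))
        (isHolAt_cyc (.const 1 w) (h 2) (h 3) i) (cyc_one_ne_zero i _ _)
        (Eventually.of_forall fun _ _ => rfl)

/-! ### Monomial generators of the two ideals -/

section
variable {R : Type*} [CommRing R]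

/-- This allows redundant products to be discarded: a product of generators need only be a multiple
of a retained one. -/
theorem span_mul_span_eq {S T U : Set R} (h : ∀ s ∈ S, ∀ t ∈ T, ∃ u ∈ U, u ∣ s * t)
    (h' : ∀ u ∈ U, ∃ s ∈ S, ∃ t ∈ T, u = s * t) :
    Ideal.span S * Ideal.span T = Ideal.span U := by
  rw [Ideal.span_mul_span']
  refine le_antisymm (Ideal.span_le.2 ?_) (Ideal.span_le.2 ?_)
  · rintro _ ⟨s, hs, t, ht, rfl⟩
    obtain ⟨u, hu, hd⟩ := h s hs t ht
    exact Ideal.mem_of_dvd _ hd (Ideal.subset_span hu)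
  · intro u hu
    obtain ⟨s, hs, t, ht, rfl⟩ := h' u hu
    exact Ideal.subset_span ⟨s, hs, t, ht, rfl⟩

theorem span_pair_mul_span_pair_first (a b c : R) :
    Ideal.span {c, a * b} * Ideal.span {a, b * c} =
      Ideal.span ({a * c, b * c ^ 2, a ^ 2 * b, a * b ^ 2 * c} : Set R) := by
  refine span_mul_span_eq ?_ ?_
  · intro s hs t ht
    simp only [Set.mem_insert_iff, Set.mem_singleton_iff] at hs ht
    rcases hs with hs | hs <;> rcases ht with ht | ht
    · exact ⟨a * c, by simp, 1, by rw [hs, ht]; ring⟩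
    · exact ⟨b * c ^ 2, by simp, 1, by rw [hs, ht]; ring⟩
    · exact ⟨a ^ 2 * b, by simp, 1, by rw [hs, ht]; ring⟩
    · exact ⟨a * c, by simp, b ^ 2, by rw [hs, ht]; ring⟩
  · rintro _ (rfl | rfl | rfl | rfl)
    · exact ⟨c, by simp, a, by simp, by ring⟩
    · exact ⟨c, by simp, b * c, by simp, by ring⟩
    · exact ⟨a * b, by simp, a, by simp, by ring⟩
    · exact ⟨a * b, by simp, b * c, by simp, by ring⟩

theorem span_mul_span_pair_second (a b c : R) :
    Ideal.span {a * c, b * c ^ 2, a ^ 2 * b, a * b ^ 2 * c} * Ideal.span {b, a * c} =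
      Ideal.span ({a * b * c, a ^ 2 * b ^ 2, b ^ 2 * c ^ 2, a ^ 2 * c ^ 2} : Set R) := by
  refine span_mul_span_eq ?_ ?_
  · intro s hs t ht
    simp only [Set.mem_insert_iff, Set.mem_singleton_iff] at hs ht
    rcases hs with hs | hs | hs | hs <;> rcases ht with ht | ht
    · exact ⟨a * b * c, by simp, 1, by rw [hs, ht]; ring⟩
    · exact ⟨a ^ 2 * c ^ 2, by simp, 1, by rw [hs, ht]; ring⟩
    · exact ⟨b ^ 2 * c ^ 2, by simp, 1, by rw [hs, ht]; ring⟩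
    · exact ⟨a * b * c, by simp, c ^ 2, by rw [hs, ht]; ring⟩
    · exact ⟨a ^ 2 * b ^ 2, by simp, 1, by rw [hs, ht]; ring⟩
    · exact ⟨a * b * c, by simp, a ^ 2, by rw [hs, ht]; ring⟩
    · exact ⟨a * b * c, by simp, b ^ 2, by rw [hs, ht]; ring⟩
    · exact ⟨a * b * c, by simp, a * b * c, by rw [hs, ht]; ring⟩
  · rintro _ (rfl | rfl | rfl | rfl)
    · exact ⟨a * c, by simp, b, by simp, by ring⟩
    · exact ⟨a ^ 2 * b, by simp, b, by simp, by ring⟩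
    · exact ⟨b * c ^ 2, by simp, b, by simp, by ring⟩
    · exact ⟨a * c, by simp, a * c, by simp, by ring⟩

theorem span_pair_mul_span_pair_third (a b c : R) :
    Ideal.span {b, a * c} * Ideal.span {c, a * b} =
      Ideal.span ({b * c, a * b ^ 2, a * c ^ 2} : Set R) := by
  refine span_mul_span_eq ?_ ?_
  · intro s hs t ht
    simp only [Set.mem_insert_iff, Set.mem_singleton_iff] at hs ht
    rcases hs with hs | hs <;> rcases ht with ht | ht
    · exact ⟨b * c, by simp, 1, by rw [hs, ht]; ring⟩
    · exact ⟨a * b ^ 2, by simp, 1, by rw [hs, ht]; ring⟩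
    · exact ⟨a * c ^ 2, by simp, 1, by rw [hs, ht]; ring⟩
    · exact ⟨b * c, by simp, a ^ 2, by rw [hs, ht]; ring⟩
  · rintro _ (rfl | rfl | rfl)
    · exact ⟨b, by simp, c, by simp, by ring⟩
    · exact ⟨b, by simp, a * b, by simp, by ring⟩
    · exact ⟨a * c, by simp, c, by simp, by ring⟩

theorem span_axes_mul_span (a b c : R) :
    Ideal.span {a * b, b * c, a * c} * Ideal.span {a * b * c, a ^ 2 * b ^ 2, b ^ 2 * c ^ 2, a ^ 2 * c ^ 2} =
      Ideal.span ({a ^ 2 * b ^ 2 * c, a * b ^ 2 * c ^ 2, a ^ 2 * b * c ^ 2, a ^ 3 * b ^ 3, b ^ 3 * c ^ 3, a ^ 3 * c ^ 3} : Set R) := by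
  refine span_mul_span_eq ?_ ?_
  · intro s hs t ht
    simp only [Set.mem_insert_iff, Set.mem_singleton_iff] at hs ht
    rcases hs with hs | hs | hs <;> rcases ht with ht | ht | ht | ht
    · exact ⟨a ^ 2 * b ^ 2 * c, by simp, 1, by rw [hs, ht]; ring⟩
    · exact ⟨a ^ 3 * b ^ 3, by simp, 1, by rw [hs, ht]; ring⟩
    · exact ⟨a * b ^ 2 * c ^ 2, by simp, b, by rw [hs, ht]; ring⟩
    · exact ⟨a ^ 2 * b * c ^ 2, by simp, a, by rw [hs, ht]; ring⟩
    · exact ⟨a * b ^ 2 * c ^ 2, by simp, 1, by rw [hs, ht]; ring⟩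
    · exact ⟨a ^ 2 * b ^ 2 * c, by simp, b, by rw [hs, ht]; ring⟩
    · exact ⟨b ^ 3 * c ^ 3, by simp, 1, by rw [hs, ht]; ring⟩
    · exact ⟨a ^ 2 * b * c ^ 2, by simp, c, by rw [hs, ht]; ring⟩
    · exact ⟨a ^ 2 * b * c ^ 2, by simp, 1, by rw [hs, ht]; ring⟩
    · exact ⟨a ^ 2 * b ^ 2 * c, by simp, a, by rw [hs, ht]; ring⟩
    · exact ⟨a * b ^ 2 * c ^ 2, by simp, c, by rw [hs, ht]; ring⟩
    · exact ⟨a ^ 3 * c ^ 3, by simp, 1, by rw [hs, ht]; ring⟩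
  · rintro _ (rfl | rfl | rfl | rfl | rfl | rfl)
    · exact ⟨a * b, by simp, a * b * c, by simp, by ring⟩
    · exact ⟨b * c, by simp, a * b * c, by simp, by ring⟩
    · exact ⟨a * c, by simp, a * b * c, by simp, by ring⟩
    · exact ⟨a * b, by simp, a ^ 2 * b ^ 2, by simp, by ring⟩
    · exact ⟨b * c, by simp, b ^ 2 * c ^ 2, by simp, by ring⟩
    · exact ⟨a * c, by simp, a ^ 2 * c ^ 2, by simp, by ring⟩

theorem span_mul_span_eight (a b c : R) :
    Ideal.span {a ^ 2 * b ^ 2 * c, a * b ^ 2 * c ^ 2, a ^ 2 * b * c ^ 2, a ^ 3 * b ^ 3, b ^ 3 * c ^ 3, a ^ 3 * c ^ 3} * Ideal.span {b * c, a * b ^ 2, a * c ^ 2} =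
      Ideal.span ({a ^ 2 * b ^ 3 * c ^ 2, a * b ^ 3 * c ^ 3, a ^ 2 * b ^ 2 * c ^ 3, a ^ 4 * b ^ 5, b ^ 4 * c ^ 4, a ^ 4 * c ^ 5, a ^ 3 * b ^ 4 * c, a ^ 3 * b * c ^ 4} : Set R) := by
  refine span_mul_span_eq ?_ ?_
  · intro s hs t ht
    simp only [Set.mem_insert_iff, Set.mem_singleton_iff] at hs ht
    rcases hs with hs | hs | hs | hs | hs | hs <;> rcases ht with ht | ht | ht
    · exact ⟨a ^ 2 * b ^ 3 * c ^ 2, by simp, 1, by rw [hs, ht]; ring⟩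
    · exact ⟨a ^ 3 * b ^ 4 * c, by simp, 1, by rw [hs, ht]; ring⟩
    · exact ⟨a ^ 2 * b ^ 2 * c ^ 3, by simp, a, by rw [hs, ht]; ring⟩
    · exact ⟨a * b ^ 3 * c ^ 3, by simp, 1, by rw [hs, ht]; ring⟩
    · exact ⟨a ^ 2 * b ^ 3 * c ^ 2, by simp, b, by rw [hs, ht]; ring⟩
    · exact ⟨a ^ 2 * b ^ 2 * c ^ 3, by simp, c, by rw [hs, ht]; ring⟩
    · exact ⟨a ^ 2 * b ^ 2 * c ^ 3, by simp, 1, by rw [hs, ht]; ring⟩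
    · exact ⟨a ^ 2 * b ^ 3 * c ^ 2, by simp, a, by rw [hs, ht]; ring⟩
    · exact ⟨a ^ 3 * b * c ^ 4, by simp, 1, by rw [hs, ht]; ring⟩
    · exact ⟨a ^ 3 * b ^ 4 * c, by simp, 1, by rw [hs, ht]; ring⟩
    · exact ⟨a ^ 4 * b ^ 5, by simp, 1, by rw [hs, ht]; ring⟩
    · exact ⟨a ^ 2 * b ^ 3 * c ^ 2, by simp, a ^ 2, by rw [hs, ht]; ring⟩
    · exact ⟨b ^ 4 * c ^ 4, by simp, 1, by rw [hs, ht]; ring⟩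
    · exact ⟨a * b ^ 3 * c ^ 3, by simp, b ^ 2, by rw [hs, ht]; ring⟩
    · exact ⟨a * b ^ 3 * c ^ 3, by simp, c ^ 2, by rw [hs, ht]; ring⟩
    · exact ⟨a ^ 3 * b * c ^ 4, by simp, 1, by rw [hs, ht]; ring⟩
    · exact ⟨a ^ 2 * b ^ 2 * c ^ 3, by simp, a ^ 2, by rw [hs, ht]; ring⟩
    · exact ⟨a ^ 4 * c ^ 5, by simp, 1, by rw [hs, ht]; ring⟩
  · rintro _ (rfl | rfl | rfl | rfl | rfl | rfl | rfl | rfl)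
    · exact ⟨a ^ 2 * b ^ 2 * c, by simp, b * c, by simp, by ring⟩
    · exact ⟨a * b ^ 2 * c ^ 2, by simp, b * c, by simp, by ring⟩
    · exact ⟨a ^ 2 * b * c ^ 2, by simp, b * c, by simp, by ring⟩
    · exact ⟨a ^ 3 * b ^ 3, by simp, a * b ^ 2, by simp, by ring⟩
    · exact ⟨b ^ 3 * c ^ 3, by simp, b * c, by simp, by ring⟩
    · exact ⟨a ^ 3 * c ^ 3, by simp, a * c ^ 2, by simp, by ring⟩
    · exact ⟨a ^ 2 * b ^ 2 * c, by simp, a * b ^ 2, by simp, by ring⟩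
    · exact ⟨a ^ 2 * b * c ^ 2, by simp, a * c ^ 2, by simp, by ring⟩

end

/-- Monomial generators of the ideal `J`. -/
noncomputable def genJ : Option (Fin 3) → holFun (Fin 3 → ℂ)
  | none => coord3 0 * coord3 1 * coord3 2
  | some j => axesGen j ^ 2

/-- Monomial generators of the ideal `H`. -/
noncomputable def genH : Fin 8 → holFun (Fin 3 → ℂ) :=
  ![coord3 0 ^ 2 * coord3 1 ^ 3 * coord3 2 ^ 2, coord3 0 * coord3 1 ^ 3 * coord3 2 ^ 3,
    coord3 0 ^ 2 * coord3 1 ^ 2 * coord3 2 ^ 3, coord3 0 ^ 4 * coord3 1 ^ 5,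
    coord3 1 ^ 4 * coord3 2 ^ 4, coord3 0 ^ 4 * coord3 2 ^ 5,
    coord3 0 ^ 3 * coord3 1 ^ 4 * coord3 2, coord3 0 ^ 3 * coord3 1 * coord3 2 ^ 4]

/-- `J` is generated by x₁x₂x₃ and the squares of the three generators of the ideal of the axes.
This shape makes the blow-up of each cone have just two charts. -/
theorem idealJ_eq : idealJ = Ideal.span (Set.range genJ) := by
  have h : Set.range genJ = {coord3 0 * coord3 1 * coord3 2, coord3 0 ^ 2 * coord3 1 ^ 2,
      coord3 1 ^ 2 * coord3 2 ^ 2, coord3 0 ^ 2 * coord3 2 ^ 2} := by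
    ext f
    constructor
    · rintro ⟨_ | j, rfl⟩
      · exact Or.inl rfl
      · fin_cases j
        · exact Or.inr (Or.inl (mul_pow _ _ _))
        · exact Or.inr (Or.inr (Or.inl (mul_pow _ _ _)))
        · exact Or.inr (Or.inr (Or.inr ((mul_pow _ _ _).trans (mul_comm _ _))))
    · rintro (rfl | rfl | rfl | rfl)
      · exact ⟨none, rfl⟩
      · exact ⟨some 0, mul_pow _ _ _⟩
      · exact ⟨some 1, mul_pow _ _ _⟩
      · exact ⟨some 2, (mul_pow _ _ _).trans (mul_comm _ _)⟩
  have hc : coord3 2 * coord3 0 = coord3 0 * coord3 2 := mul_comm _ _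
  rw [h, idealJ, hc, span_pair_mul_span_pair_first, span_mul_span_pair_second]

/-- The factors of `H` are regrouped as the ideal of the axes, then `J`, then (x₂, x₃x₁)(x₃, x₁x₂).
-/
theorem idealH_eq : idealH = Ideal.span (Set.range genH) := by
  have h : Set.range genH = {coord3 0 ^ 2 * coord3 1 ^ 3 * coord3 2 ^ 2,
      coord3 0 * coord3 1 ^ 3 * coord3 2 ^ 3,
      coord3 0 ^ 2 * coord3 1 ^ 2 * coord3 2 ^ 3, coord3 0 ^ 4 * coord3 1 ^ 5,
      coord3 1 ^ 4 * coord3 2 ^ 4, coord3 0 ^ 4 * coord3 2 ^ 5,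
      coord3 0 ^ 3 * coord3 1 ^ 4 * coord3 2, coord3 0 ^ 3 * coord3 1 * coord3 2 ^ 4} := by
    simp only [genH, Matrix.range_cons, Matrix.range_empty, Set.union_empty, Set.singleton_union]
  have hc : coord3 2 * coord3 0 = coord3 0 * coord3 2 := mul_comm _ _
  rw [h, ← span_mul_span_eight, ← span_axes_mul_span, ← span_pair_mul_span_pair_third,
    ← span_mul_span_pair_second, ← span_pair_mul_span_pair_first, idealH, hc]
  ring

/-- The membership coefficients are global holomorphic functions and can be pulled back. For `B` the
map `f` is the identity; for `Y` it is the blowing-down map of `X`. -/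
theorem SameIdeal.of_span {S : Type*} [TopologicalSpace S] [HolSpace S] {f : S → Fin 3 → ℂ}
    (hf : ∀ s, IsHolMapAt f s) {ι r : Type} [Fintype ι] [Fintype r]
    {g : ι → holFun (Fin 3 → ℂ)} {m : r → holFun (Fin 3 → ℂ)}
    (h : Ideal.span (Set.range g) = Ideal.span (Set.range m)) :
    ∃ G C, SameIdeal (fun k s => (g k : (Fin 3 → ℂ) → ℂ) (f s))
      (fun l s => (m l : (Fin 3 → ℂ) → ℂ) (f s)) G C := by
  have h1 : ∀ k, ∃ c : r → holFun (Fin 3 → ℂ), ∑ l, c l * m l = g k := fun k =>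
    Ideal.mem_span_range_iff_exists_fun.1 (h ▸ Ideal.subset_span ⟨k, rfl⟩)
  have h2 : ∀ l, ∃ c : ι → holFun (Fin 3 → ℂ), ∑ k, c k * g k = m l := fun l =>
    Ideal.mem_span_range_iff_exists_fun.1 (h ▸ Ideal.subset_span ⟨l, rfl⟩)
  choose G hG using h1
  choose C hC using h2
  refine ⟨fun k l s => (G k l : (Fin 3 → ℂ) → ℂ) (f s),
    fun l k s => (C l k : (Fin 3 → ℂ) → ℂ) (f s), ⟨fun k s => (hf s).2 _ ((g k).2 _),
    fun k l s => (hf s).2 _ ((G k l).2 _), fun l k s => (hf s).2 _ ((C l k).2 _),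
    fun k s => ?_, fun l s => ?_⟩⟩
  · rw [← hG]
    simp
  · rw [← hC]
    simp

/-! ### The second blow-up -/

/-- The common factor of the generators of `J` in the monomial charts. -/
def toricFactorJ : Bool → (Fin 3 → ℂ) → ℂ
  | true, p => p 0 ^ 2 * p 1 ^ 2 * p 2 ^ 3
  | false, p => p 0 ^ 2 * p 1 ^ 2

/-- The generators of `J` in the monomial charts, divided by their common factor. -/
def toricQuotJ : Bool → Fin 3 → (Fin 3 → ℂ) → Option (Fin 3) → ℂ
  | true, _, _, none => 1
  | true, i, p, some j => p 2 * toricPlane true i p j ^ 2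
  | false, _, p, none => p 2
  | false, i, p, some j => toricPlane false i p j ^ 2

/-- The generator of `J` that is the common factor in a monomial chart. -/
def toricIndexJ : Bool → Fin 3 → Option (Fin 3)
  | true, _ => none
  | false, i => some i

theorem genJ_none_apply (x : Fin 3 → ℂ) : (genJ none : (Fin 3 → ℂ) → ℂ) x = x 0 * x 1 * x 2 := rfl

theorem genJ_some_apply (j : Fin 3) (x : Fin 3 → ℂ) :
    (genJ (some j) : (Fin 3 → ℂ) → ℂ) x = (axesGen j : (Fin 3 → ℂ) → ℂ) x ^ 2 := rfl

theorem principalization_genJ (b : Bool) (i : Fin 3) :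
    Principalization (fun l (q : FirstBlowUp) => (genJ l : (Fin 3 → ℂ) → ℂ) (BlowUp.map _ q))
      torusPoint (toricPoint b i) (toricCoord b i) (toricFactorJ b) (toricQuotJ b i)
      (toricIndexJ b i) where
  dense := denseRange_toricCoord b i
  hol := isHolMapAt_toricPoint b i
  hol_μ l p := by
    have h := fun j => isHolAt_toricPlane b i j p
    have h2 := HolSpace.isHolAt_coord 2 p
    rcases b with _ | _ <;> rcases l with _ | j <;> simp only [toricQuotJ, pow_two]
    · exact h2
    · exact (h j).mul (h j)
    · exact .const 1 p
    · exact h2.mul ((h j).mul (h j))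
  map_τ := toricPoint_toricCoord b i
  t_ne_zero x := by
    have h := toricCoord_ne_zero b i x
    cases b <;> simp [toricFactorJ, h]
  eq_mul p l := by
    rw [map_toricPoint]
    rcases l with _ | j
    · rw [genJ_none_apply]
      cases b <;> fin_cases i <;> simp [toricBase, toricFactorJ, toricQuotJ, cyc] <;> ring
    · rw [genJ_some_apply, axesGen_apply, toricBase_mul]
      cases b <;> simp only [toricAxesFactor, toricFactorJ, toricQuotJ] <;> ring
  eq_one p := by
    cases b <;> simp [toricQuotJ, toricIndexJ, toricPlane_self]

section
variable {n : ℕ} {g : Fin n → holFun (Fin 3 → ℂ)} {G : Fin n → Option (Fin 3) → FirstBlowUp → ℂ}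
  {C : Option (Fin 3) → Fin n → FirstBlowUp → ℂ}

/-- The inverses of the monomial charts of the second blow-up. -/
noncomputable def secondCoord (C : Option (Fin 3) → Fin n → FirstBlowUp → ℂ) (b : Bool)
    (i : Fin 3) (q : FirstBlowUp × ℙ ℂ (Fin n → ℂ)) : Fin 3 → ℂ :=
  match b with
  | true => ![ratio (i + 1) i q.1, ratio (i + 2) i q.1,
      linForm (C (some i)) q / linForm (C none) q]
  | false => ![BlowUp.map _ q.1 i, BlowUp.map _ q.1 (i + 1),
      linForm (C none) q / linForm (C (some i)) q]

/-- The third coordinates of the two charts over one cone are mutually inverse quotients of the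
forms belonging to (x_i x_{i+1})² and x₁x₂x₃, as for the standard charts of a projective line. -/
theorem isHolChart_second
    (h : SameIdeal (fun k (q : FirstBlowUp) => (g k : (Fin 3 → ℂ) → ℂ) (BlowUp.map _ q))
      (fun l (q : FirstBlowUp) => (genJ l : (Fin 3 → ℂ) → ℂ) (BlowUp.map _ q)) G C)
    (b : Bool) (i : Fin 3) :
    IsHolChart (fun p => (⟨(principalization_genJ b i).lift h p,
        (principalization_genJ b i).lift_mem h p⟩ : SecondBlowUp g))
      (fun q => secondCoord C b i q.1)
      {q | q.1.1 ∈ firstChart i ∧ linForm (C (toricIndexJ b i)) q.1 ≠ 0} := by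
  refine (principalization_genJ b i).isHolChart h denseRange_torusPoint (isOpen_firstChart i)
    (toricPoint_mem_firstChart b i) (ψ := secondCoord C b i) ?_ ?_
  · intro q hq h0
    refine .pi fun k => ?_
    have hd := fun l => isHolAt_linForm_div (fun k => h.hol_C l k q.1)
      (fun k => h.hol_C (toricIndexJ b i) k q.1) h0
    cases b <;> fin_cases k
    · exact (isHolAt_map i q.1).fst
    · exact (isHolAt_map (i + 1) q.1).fst
    · exact hd none
    · exact (isHolAt_ratio i (i + 1) hq).fst
    · exact (isHolAt_ratio i (i + 2) hq).fst
    · exact hd (some i)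
  · intro p
    have hd := (principalization_genJ b i).linForm_lift_div h p
    have hr := fun j => ratio_toricPoint b i j p
    funext k
    cases b <;> fin_cases k
    · exact cyc_zero _ _ _ _
    · exact cyc_one _ _ _ _
    · exact hd none
    · exact (hr (i + 1)).trans (cyc_one _ _ _ _)
    · exact (hr (i + 2)).trans (cyc_two _ _ _ _)
    · refine (hd (some i)).trans ?_
      simp [toricQuotJ, toricPlane_self]

/-- Where w_i ≠ 0, the generator (x_j x_{j+1})² is (w_j/w_i)² times (x_i x_{i+1})², so the forms for
x₁x₂x₃ and (x_i x_{i+1})² cannot both vanish. -/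
theorem exists_linForm_second_ne_zero
    (h : SameIdeal (fun k (q : FirstBlowUp) => (g k : (Fin 3 → ℂ) → ℂ) (BlowUp.map _ q))
      (fun l (q : FirstBlowUp) => (genJ l : (Fin 3 → ℂ) → ℂ) (BlowUp.map _ q)) G C)
    (q : SecondBlowUp g) {i : Fin 3} (hq : q.1.1 ∈ firstChart i) :
    ∃ b, linForm (C (toricIndexJ b i)) q.1 ≠ 0 := by
  obtain ⟨_ | j, hl⟩ := h.exists_linForm_ne_zero q.2
  · exact ⟨true, hl⟩
  · refine ⟨false, fun h0 => hl ?_⟩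
    have hr : ContinuousAt (ratio j i) q.1.1 := HolSpace.continuousAt (isHolAt_ratio i j hq)
    have h1 := h.eq_zero_of_graph
      (F := fun r => r.2 (some j) - ratio j i r.1 ^ 2 * r.2 (some i)) ?_ ?_ ?_ q.2
    · change linForm (C (some i)) q.1 = 0 at h0
      simpa [h0] using h1
    · have hr' := ContinuousAt.comp (g := ratio j i)
        (f := fun r : FirstBlowUp × (Option (Fin 3) → ℂ) => r.1)
        (x := (q.1.1, fun l => linForm (C l) q.1)) hr continuous_fst.continuousAt
      have ha : ∀ l, Continuous fun r : FirstBlowUp × (Option (Fin 3) → ℂ) => r.2 l := fun l =>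
        (continuous_apply l).comp continuous_snd
      exact (ha _).continuousAt.sub ((hr'.pow 2).mul (ha _).continuousAt)
    · intro s v c h0
      simp only [Pi.smul_apply, smul_eq_mul] at h0 ⊢
      linear_combination c * h0
    · filter_upwards [(isOpen_firstChart i).mem_nhds hq] with s hs
      simp only [genJ_some_apply]
      rw [axesGen_eq_ratio_mul hs j]
      ring

theorem isHolAtlas_second
    (h : SameIdeal (fun k (q : FirstBlowUp) => (g k : (Fin 3 → ℂ) → ℂ) (BlowUp.map _ q))
      (fun l (q : FirstBlowUp) => (genJ l : (Fin 3 → ℂ) → ℂ) (BlowUp.map _ q)) G C) :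
    IsHolAtlas (fun c : Bool × Fin 3 => toricCoord c.1 c.2)
      (fun c p => (⟨(principalization_genJ c.1 c.2).lift h p,
        (principalization_genJ c.1 c.2).lift_mem h p⟩ : SecondBlowUp g))
      (fun c q => secondCoord C c.1 c.2 q.1)
      (fun c => {q | q.1.1 ∈ firstChart c.2 ∧ linForm (C (toricIndexJ c.1 c.2)) q.1 ≠ 0}) where
  chart c := isHolChart_second h c.1 c.2
  cover q := by
    obtain ⟨i, hi⟩ := exists_mem_firstChart q.1.1
    obtain ⟨b, hb⟩ := exists_linForm_second_ne_zero h q hi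
    exact ⟨(b, i), hi, hb⟩
  compat c e x := by
    refine Subtype.ext ?_
    exact ((principalization_genJ c.1 c.2).lift_τ h x).trans
      ((principalization_genJ e.1 e.2).lift_τ h x).symm

theorem exists_charts_second (hg : Ideal.span (Set.range g) = idealJ) (i : Fin 3) :
    ∃ U U' : Set (SecondBlowUp g), IsOpen U ∧ IsOpen U' ∧
      U ∪ U' = {q | BlowUp.map _ q ∈ firstChart i} ∧
      (∃ φ : Bihol (Fin 3 → ℂ) U, ∀ u v z : ℂ,
        let p : FirstBlowUp := BlowUp.map _ (φ.toEquiv ![u, v, z]).1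
        ratio (i + 1) i p = u ∧ ratio (i + 2) i p = v ∧
          BlowUp.map _ p i = v * z ∧ BlowUp.map _ p (i + 1) = u * z ∧
          BlowUp.map _ p (i + 2) = u * v * z) ∧
      (∃ φ : Bihol (Fin 3 → ℂ) U', ∀ s t z : ℂ,
        let p : FirstBlowUp := BlowUp.map _ (φ.toEquiv ![s, t, z]).1
        ratio (i + 1) i p = t * z ∧ ratio (i + 2) i p = s * z ∧
          BlowUp.map _ p i = s ∧ BlowUp.map _ p (i + 1) = t ∧
          BlowUp.map _ p (i + 2) = s * t * z) := by
  obtain ⟨G, C, h⟩ := SameIdeal.of_span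
    (isHolMap_iff.1 (BlowUp.isHolMap_map fun i => (axesGen i : (Fin 3 → ℂ) → ℂ)))
    (hg.trans idealJ_eq)
  have ht := isHolChart_second h true i
  have hf := isHolChart_second h false i
  refine ⟨_, _, ht.isOpen, hf.isOpen, ?_, ?_, ?_⟩
  · ext q
    constructor
    · rintro (hq | hq) <;> exact hq.1
    · intro hq
      obtain ⟨b, hb⟩ := exists_linForm_second_ne_zero h q hq
      cases b
      · exact Or.inr ⟨hq, hb⟩
      · exact Or.inl ⟨hq, hb⟩
  · obtain ⟨φ, hφ⟩ := ht.exists_bihol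
    refine ⟨φ, fun u v z => ?_⟩
    have hp : BlowUp.map _ (φ.toEquiv ![u, v, z]).1 = toricPoint true i ![u, v, z] := by
      rw [hφ]
      rfl
    simp only [hp, ratio_toricPoint, map_toricPoint]
    exact ⟨cyc_one _ _ _ _, cyc_two _ _ _ _, cyc_zero _ _ _ _, cyc_one _ _ _ _, cyc_two _ _ _ _⟩
  · obtain ⟨φ, hφ⟩ := hf.exists_bihol
    refine ⟨φ, fun s t z => ?_⟩
    have hp : BlowUp.map _ (φ.toEquiv ![s, t, z]).1 = toricPoint false i ![s, t, z] := by
      rw [hφ]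
      rfl
    simp only [hp, ratio_toricPoint, map_toricPoint]
    exact ⟨cyc_one _ _ _ _, cyc_two _ _ _ _, cyc_zero _ _ _ _, cyc_one _ _ _ _, cyc_two _ _ _ _⟩

end

/-! ### The blow-up along `H` -/

/-- The common factor of the generators of `H` in the monomial charts. -/
def toricFactorH : Bool → Fin 3 → (Fin 3 → ℂ) → ℂ
  | true, i, p => p 0 ^ 3 * p 1 ^ 3 * p 2 ^ 5 * (toricBase true i p 1 * toricBase true i p 2)
  | false, i, p => p 0 ^ 3 * p 1 ^ 3 * ![p 0 * p 1 ^ 2, p 0 * p 1, p 0 ^ 2 * p 1] i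

/-- The three generators `x₁x₂²`, `x₂x₃`, `x₃²x₁` of `(x₂, x₃x₁)(x₃, x₁x₂)` in the charts of the
second kind, divided by their common factor. -/
def toricQuot : Fin 3 → (Fin 3 → ℂ) → Fin 3 → ℂ :=
  ![fun p => ![1, p 2, p 0 ^ 2 * p 2 ^ 2], fun p => ![p 0 ^ 2 * p 2, 1, p 1 ^ 2 * p 2],
    fun p => ![p 1 ^ 2 * p 2 ^ 2, p 2, 1]]

/-- The generators of `H` in the monomial charts, divided by their common factor. -/
def toricQuotH : Bool → Fin 3 → (Fin 3 → ℂ) → Fin 8 → ℂ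
  | true, i, p => ![toricPlane true i p 0, toricPlane true i p 1, toricPlane true i p 2,
      p 2 ^ 2 * toricPlane true i p 0 ^ 5, p 2 * toricPlane true i p 1 ^ 3,
      p 2 ^ 2 * toricPlane true i p 2 ^ 5, p 2 * toricPlane true i p 0 ^ 3,
      p 2 * toricPlane true i p 2 ^ 3]
  | false, i, p => ![toricPlane false i p 0 * p 2 * toricQuot i p 1,
      toricPlane false i p 1 * p 2 * toricQuot i p 1,
      toricPlane false i p 2 * p 2 * toricQuot i p 1, toricPlane false i p 0 ^ 3 * toricQuot i p 0,
      toricPlane false i p 1 ^ 3 * toricQuot i p 1, toricPlane false i p 2 ^ 3 * toricQuot i p 2,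
      toricPlane false i p 0 * p 2 * toricQuot i p 0, toricPlane false i p 2 * p 2 * toricQuot i p 2]

/-- The generator of `H` that is the common factor in a monomial chart. -/
def toricIndexH : Bool → Fin 3 → Fin 8
  | true => ![0, 1, 2]
  | false => ![3, 4, 5]

/-- The generator of `H` that gives the third coordinate in a monomial chart. -/
def thirdIndexH : Bool → Fin 3 → Fin 8
  | true => ![6, 4, 7]
  | false => ![6, 1, 7]

theorem genH_apply (x : Fin 3 → ℂ) (l : Fin 8) : (genH l : (Fin 3 → ℂ) → ℂ) x =
    ![x 0 ^ 2 * x 1 ^ 3 * x 2 ^ 2, x 0 * x 1 ^ 3 * x 2 ^ 3, x 0 ^ 2 * x 1 ^ 2 * x 2 ^ 3,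
      x 0 ^ 4 * x 1 ^ 5, x 1 ^ 4 * x 2 ^ 4, x 0 ^ 4 * x 2 ^ 5, x 0 ^ 3 * x 1 ^ 4 * x 2,
      x 0 ^ 3 * x 1 * x 2 ^ 4] l := by
  fin_cases l <;> rfl

theorem isHolAt_toricQuot (i j : Fin 3) (p : Fin 3 → ℂ) :
    HolSpace.IsHolAt (fun p => toricQuot i p j) p := by
  have h := fun j => HolSpace.isHolAt_coord j p
  fin_cases i <;> fin_cases j
  · exact .const 1 p
  · exact h 2
  · exact ((h 0).pow 2).mul ((h 2).pow 2)
  · exact ((h 0).pow 2).mul (h 2)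
  · exact .const 1 p
  · exact ((h 1).pow 2).mul (h 2)
  · exact ((h 1).pow 2).mul ((h 2).pow 2)
  · exact h 2
  · exact .const 1 p

theorem isHolAt_toricQuotH (b : Bool) (i : Fin 3) (l : Fin 8) (p : Fin 3 → ℂ) :
    HolSpace.IsHolAt (fun p => toricQuotH b i p l) p := by
  have h := fun j => isHolAt_toricPlane b i j p
  have hz := HolSpace.isHolAt_coord 2 p
  have hr := fun j => isHolAt_toricQuot i j p
  cases b <;> fin_cases l
  · exact ((h 0).mul hz).mul (hr 1)
  · exact ((h 1).mul hz).mul (hr 1)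
  · exact ((h 2).mul hz).mul (hr 1)
  · exact ((h 0).pow 3).mul (hr 0)
  · exact ((h 1).pow 3).mul (hr 1)
  · exact ((h 2).pow 3).mul (hr 2)
  · exact ((h 0).mul hz).mul (hr 0)
  · exact ((h 2).mul hz).mul (hr 2)
  · exact h 0
  · exact h 1
  · exact h 2
  · exact (hz.pow 2).mul ((h 0).pow 5)
  · exact hz.mul ((h 1).pow 3)
  · exact (hz.pow 2).mul ((h 2).pow 5)
  · exact hz.mul ((h 0).pow 3)
  · exact hz.mul ((h 2).pow 3)

theorem principalization_genH (b : Bool) (i : Fin 3) :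
    Principalization (fun l => (genH l : (Fin 3 → ℂ) → ℂ)) (Subtype.val : Torus → _)
      (toricBase b i) (toricCoord b i) (toricFactorH b i) (toricQuotH b i)
      (toricIndexH b i) where
  dense := denseRange_toricCoord b i
  hol := isHolMapAt_toricBase b i
  hol_μ := isHolAt_toricQuotH b i
  map_τ := toricBase_toricCoord b i
  t_ne_zero x := by
    have h := toricCoord_ne_zero b i x
    cases b
    · have h0 := h 0
      have h1 := h 1
      generalize toricCoord false i x = p at *
      fin_cases i <;> simp [toricFactorH, h0, h1]
    · simp only [toricFactorH, toricBase_toricCoord]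
      simp [h, x.2]
  eq_mul p l := by
    rw [genH_apply]
    cases b <;> fin_cases i <;> fin_cases l <;>
      simp [toricBase, toricFactorH, toricQuotH, toricPlane, toricQuot, cyc] <;> ring
  eq_one p := by
    cases b <;> fin_cases i <;> simp [toricQuotH, toricIndexH, toricPlane, toricQuot, cyc]

section
variable {m : ℕ} {h : Fin m → holFun (Fin 3 → ℂ)} {G : Fin m → Fin 8 → (Fin 3 → ℂ) → ℂ}
  {C : Fin 8 → Fin m → (Fin 3 → ℂ) → ℂ}

/-- The inverses of the monomial charts of the blow-up along `H`. -/
noncomputable def coordH (C : Fin 8 → Fin m → (Fin 3 → ℂ) → ℂ) (b : Bool) (i : Fin 3)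
    (q : (Fin 3 → ℂ) × ℙ ℂ (Fin m → ℂ)) : Fin 3 → ℂ :=
  match b with
  | true => ![linForm (C (toricIndexH true (i + 1))) q / linForm (C (toricIndexH true i)) q,
      linForm (C (toricIndexH true (i + 2))) q / linForm (C (toricIndexH true i)) q,
      linForm (C (thirdIndexH true i)) q / linForm (C (toricIndexH true i)) q]
  | false => ![q.1 i, q.1 (i + 1),
      linForm (C (thirdIndexH false i)) q / linForm (C (toricIndexH false i)) q]

/-- The first three generators of `H` are x₁x₂x₃·x₂x₃ times the generators of the ideal of the axes,
so they reproduce [a : b : c]. -/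
theorem toricQuotH_true (i j : Fin 3) (p : Fin 3 → ℂ) :
    toricQuotH true i p (toricIndexH true j) = toricPlane true i p j := by
  fin_cases j <;> rfl

theorem toricQuotH_third (b : Bool) (i : Fin 3) (p : Fin 3 → ℂ) :
    toricQuotH b i p (thirdIndexH b i) = p 2 := by
  cases b <;> fin_cases i <;> simp [toricQuotH, thirdIndexH, toricPlane, toricQuot, cyc]

/-- The monomial charts of the blow-up along `H`. -/
noncomputable def chartH
    (hC : SameIdeal (fun k => (h k : (Fin 3 → ℂ) → ℂ)) (fun l => (genH l : (Fin 3 → ℂ) → ℂ)) G C)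
    (b : Bool) (i : Fin 3) (p : Fin 3 → ℂ) : BlowUp fun k => (h k : (Fin 3 → ℂ) → ℂ) :=
  ⟨(principalization_genH b i).lift hC p, (principalization_genH b i).lift_mem hC p⟩

theorem isHolChart_chartH
    (hC : SameIdeal (fun k => (h k : (Fin 3 → ℂ) → ℂ)) (fun l => (genH l : (Fin 3 → ℂ) → ℂ)) G C)
    (b : Bool) (i : Fin 3) :
    IsHolChart (chartH hC b i) (fun q => coordH C b i q.1)
      {q | q.1.1 ∈ Set.univ ∧ linForm (C (toricIndexH b i)) q.1 ≠ 0} := by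
  refine (principalization_genH b i).isHolChart hC denseRange_torus isOpen_univ
    (fun _ => Set.mem_univ _) (ψ := coordH C b i) ?_ ?_
  · intro q _ h0
    refine .pi fun k => ?_
    have hd := fun l => isHolAt_linForm_div (fun k => hC.hol_C l k q.1)
      (fun k => hC.hol_C (toricIndexH b i) k q.1) h0
    have hx := (IsHolMapAt.id q).fst
    cases b <;> fin_cases k
    · exact hx.apply i
    · exact hx.apply (i + 1)
    · exact hd _
    · exact hd _
    · exact hd _
    · exact hd _
  · intro p
    have hd := (principalization_genH b i).linForm_lift_div hC p
    funext k
    cases b <;> fin_cases k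
    · exact cyc_zero _ _ _ _
    · exact cyc_one _ _ _ _
    · exact (hd _).trans (toricQuotH_third _ _ _)
    · exact (hd _).trans ((toricQuotH_true i (i + 1) p).trans (cyc_one _ _ _ _))
    · exact (hd _).trans ((toricQuotH_true i (i + 2) p).trans (cyc_two _ _ _ _))
    · exact (hd _).trans (toricQuotH_third _ _ _)

/-- Six of the eight monomials are unit entries in the six charts. The squares of the other two,
with indices 6 and 7, are products of two of those six, so their forms vanish when the six forms do.
-/
theorem exists_linForm_H_ne_zero
    (hC : SameIdeal (fun k => (h k : (Fin 3 → ℂ) → ℂ)) (fun l => (genH l : (Fin 3 → ℂ) → ℂ)) G C)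
    (q : BlowUp fun k => (h k : (Fin 3 → ℂ) → ℂ)) :
    ∃ c : Bool × Fin 3, linForm (C (toricIndexH c.1 c.2)) q.1 ≠ 0 := by
  by_contra! h0
  have key : ∀ l l₁ l₂, linForm (C l₁) q.1 = 0 →
      (∀ x, (genH l : (Fin 3 → ℂ) → ℂ) x ^ 2 =
        (genH l₁ : (Fin 3 → ℂ) → ℂ) x * (genH l₂ : (Fin 3 → ℂ) → ℂ) x) →
      linForm (C l) q.1 = 0 := by
    intro l l₁ l₂ h1 hl
    have h2 := hC.eq_zero_of_graph (F := fun r => r.2 l ^ 2 - r.2 l₁ * r.2 l₂)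
      (Continuous.continuousAt (by fun_prop)) ?_ ?_ q.2
    · simpa [h1] using h2
    · intro s v c h0
      simp only [Pi.smul_apply, smul_eq_mul] at h0 ⊢
      linear_combination c ^ 2 * h0
    · filter_upwards with x
      rw [hl, sub_self]
  obtain ⟨l, hl⟩ := hC.exists_linForm_ne_zero q.2
  refine hl ?_
  fin_cases l
  · exact h0 (true, 0)
  · exact h0 (true, 1)
  · exact h0 (true, 2)
  · exact h0 (false, 0)
  · exact h0 (false, 1)
  · exact h0 (false, 2)
  · refine key 6 0 3 (h0 (true, 0)) fun x => ?_
    simp only [genH_apply, Matrix.cons_val]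
    ring
  · refine key 7 2 5 (h0 (true, 2)) fun x => ?_
    simp only [genH_apply, Matrix.cons_val]
    ring

theorem isHolAtlas_chartH
    (hC : SameIdeal (fun k => (h k : (Fin 3 → ℂ) → ℂ)) (fun l => (genH l : (Fin 3 → ℂ) → ℂ)) G C) :
    IsHolAtlas (fun c : Bool × Fin 3 => toricCoord c.1 c.2) (fun c => chartH hC c.1 c.2)
      (fun c q => coordH C c.1 c.2 q.1)
      (fun c => {q | q.1.1 ∈ Set.univ ∧ linForm (C (toricIndexH c.1 c.2)) q.1 ≠ 0}) where
  chart c := isHolChart_chartH hC c.1 c.2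
  cover q := by
    obtain ⟨c, hc⟩ := exists_linForm_H_ne_zero hC q
    exact ⟨c, Set.mem_univ _, hc⟩
  compat c e x := by
    refine Subtype.ext ?_
    exact ((principalization_genH c.1 c.2).lift_τ hC x).trans
      ((principalization_genH e.1 e.2).lift_τ hC x).symm

theorem exists_sameIdeal_H (hh : Ideal.span (Set.range h) = idealH) :
    ∃ G C, SameIdeal (fun k => (h k : (Fin 3 → ℂ) → ℂ)) (fun l => (genH l : (Fin 3 → ℂ) → ℂ)) G C :=
  SameIdeal.of_span (f := fun s => s) (fun s => IsHolMapAt.id s) (hh.trans idealH_eq)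

/-- Both atlases are parametrized by `toricCoord` and lie over the same maps `toricBase`, whence the
isomorphism and its compatibility with the projections. -/
theorem exists_bihol_second {n : ℕ} {g : Fin n → holFun (Fin 3 → ℂ)}
    (hg : Ideal.span (Set.range g) = idealJ) (hh : Ideal.span (Set.range h) = idealH) :
    ∃ Ψ : Bihol (SecondBlowUp g) (BlowUp fun k => (h k : (Fin 3 → ℂ) → ℂ)), ∀ q,
      BlowUp.map _ (Ψ.toEquiv q) = BlowUp.map _ (BlowUp.map _ q) := by
  obtain ⟨G, C, hC⟩ := exists_sameIdeal_H hh
  obtain ⟨G', C', hC'⟩ := SameIdeal.of_span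
    (isHolMap_iff.1 (BlowUp.isHolMap_map fun i => (axesGen i : (Fin 3 → ℂ) → ℂ)))
    (hg.trans idealJ_eq)
  have hY := isHolAtlas_second hC'
  obtain ⟨Ψ, hΨ⟩ := hY.exists_bihol (isHolAtlas_chartH hC) fun c => denseRange_toricCoord c.1 c.2
  refine ⟨Ψ, fun q => ?_⟩
  obtain ⟨c, hc⟩ := hY.cover q
  rw [← (hY.chart c).right q hc, hΨ]
  rfl

theorem isComplexManifold_H (hh : Ideal.span (Set.range h) = idealH) :
    IsComplexManifold (BlowUp fun k => (h k : (Fin 3 → ℂ) → ℂ)) 3 := by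
  obtain ⟨G, C, hC⟩ := exists_sameIdeal_H hh
  refine ⟨inferInstance, inferInstance, fun q => ?_⟩
  obtain ⟨c, hc⟩ := (isHolAtlas_chartH hC).cover q
  exact ((isHolAtlas_chartH hC).chart c).isSmoothOfDimAt hc

end

/-! ### Quasi-projective toric varieties -/

/-- Functions given by a monomial. -/
def IsMonomialFun {d : ℕ} (f : (Fin d → ℂ) → ℂ) : Prop :=
  ∃ a : Fin d → ℕ, ∀ p, f p = ∏ k, p k ^ a k

namespace IsMonomialFun

variable {d : ℕ} {f g : (Fin d → ℂ) → ℂ}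

theorem one : IsMonomialFun fun _ : Fin d → ℂ => 1 := ⟨fun _ => 0, fun p => by simp⟩

theorem coord (k : Fin d) : IsMonomialFun fun p : Fin d → ℂ => p k :=
  ⟨Pi.single k 1, fun p => by
    rw [Finset.prod_eq_single k] <;> simp +contextual⟩

theorem mul (hf : IsMonomialFun f) (hg : IsMonomialFun g) : IsMonomialFun fun p => f p * g p := by
  obtain ⟨a, ha⟩ := hf
  obtain ⟨b, hb⟩ := hg
  refine ⟨a + b, fun p => ?_⟩
  simp only [ha, hb, Pi.add_apply, pow_add, Finset.prod_mul_distrib]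

theorem pow (hf : IsMonomialFun f) (n : ℕ) : IsMonomialFun fun p => f p ^ n := by
  induction n with
  | zero => simpa using one
  | succ n ih => simpa only [pow_succ] using ih.mul hf

theorem isHolAt (hf : IsMonomialFun f) (p : Fin d → ℂ) : HolSpace.IsHolAt f p := by
  obtain ⟨a, ha⟩ := hf
  have h : f = fun p => ∏ k, p k ^ a k := funext ha
  rw [h, HolSpace.isHolAt_iff_analyticAt]
  exact Finset.analyticAt_fun_prod _ fun k _ => (HolSpace.analyticAt_proj k p).pow (a k)

theorem continuous (hf : IsMonomialFun f) : Continuous f :=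
  continuous_iff_continuousAt.2 fun p => HolSpace.continuousAt (hf.isHolAt p)

theorem cyc {a b c : (Fin d → ℂ) → ℂ} (ha : IsMonomialFun a) (hb : IsMonomialFun b)
    (hc : IsMonomialFun c) (i j : Fin 3) :
    IsMonomialFun fun p => _root_.cyc i (a p) (b p) (c p) j := by
  unfold _root_.cyc
  generalize j - i = k
  fin_cases k <;> assumption

end IsMonomialFun

theorem MvPolynomial.IsHomogeneous.eval_smul_eq {σ : Type*} {f : MvPolynomial σ ℂ} {d : ℕ}
    (hf : f.IsHomogeneous d) (c : ℂ) (v : σ → ℂ) : eval (c • v) f = c ^ d * eval v f := by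
  simp only [eval_eq, Finset.mul_sum]
  refine Finset.sum_congr rfl fun m hm => ?_
  simp only [Pi.smul_apply, smul_eq_mul, mul_pow, Finset.prod_mul_distrib]
  have h := hf (mem_support_iff.1 hm)
  rw [Finset.prod_pow_eq_pow_sum]
  have hd : ∑ i ∈ m.support, m i = d := by
    rw [← h, Finsupp.weight_apply, Finsupp.sum]
    simp
  rw [hd]
  ring

section
variable {d N : ℕ} {Γ T : Type} {τ : Γ → T → Fin d → ℂ} {μ : Γ → (Fin d → ℂ) → Fin (N + 1) → ℂ}
  {θ : T → Fin (N + 1) → ℂ} {l₀ : Γ → Fin (N + 1)} {idx : Γ → Fin d → Fin (N + 1)}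

/-- The homogeneous polynomials that vanish on a parametrized set. -/
def homogeneousRelations (θ : T → Fin (N + 1) → ℂ) : Set (MvPolynomial (Fin (N + 1)) ℂ) :=
  {f | (∃ e : ℕ, f.IsHomogeneous e) ∧ ∀ x, MvPolynomial.eval (θ x) f = 0}

theorem mem_projZeros_mk {S : Set (MvPolynomial (Fin (N + 1)) ℂ)}
    (hS : ∀ f ∈ S, ∃ e : ℕ, f.IsHomogeneous e) (v : Fin (N + 1) → ℂ) (hv : v ≠ 0) :
    Projectivization.mk ℂ v hv ∈ projZeros S ↔ ∀ f ∈ S, MvPolynomial.eval v f = 0 := by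
  obtain ⟨c, hc, e⟩ := Projectivization.exists_rep_mk v hv
  refine forall₂_congr fun f hf => ?_
  obtain ⟨k, hk⟩ := hS f hf
  rw [e, hk.eval_smul_eq, mul_eq_zero, or_iff_right (pow_ne_zero _ hc)]

/-- Monomial charts that agree on dense sets make up a quasi-projective variety. -/
theorem exists_isHolAtlas_of_monomial (hτ : ∀ c, DenseRange (τ c))
    (hμ : ∀ c j, IsMonomialFun fun p => μ c p j) (h1 : ∀ c p, μ c p (l₀ c) = 1)
    (hidx : ∀ c p k, μ c p (idx c k) = p k)
    (hθ : ∀ c x, ∃ t : ℂ, t ≠ 0 ∧ θ x = t • μ c (τ c x)) :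
    ∃ (φ : Γ → (Fin d → ℂ) → ↥(projZeros (homogeneousRelations θ) \
        projZeros (Set.range fun c => MvPolynomial.X (l₀ c)))) (ψ : _) (O : _),
      IsHolAtlas τ φ ψ O := by
  have hne : ∀ c p, μ c p ≠ 0 := fun c p h0 => one_ne_zero ((h1 c p).symm.trans (congrFun h0 _))
  have hX : ∀ f ∈ Set.range fun c => (MvPolynomial.X (l₀ c) : MvPolynomial (Fin (N + 1)) ℂ),
      ∃ e : ℕ, f.IsHomogeneous e := by
    rintro _ ⟨c, rfl⟩
    exact ⟨1, MvPolynomial.isHomogeneous_X _ _⟩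
  have hμτ : ∀ c x f, f ∈ homogeneousRelations θ → MvPolynomial.eval (μ c (τ c x)) f = 0 := by
    rintro c x f ⟨⟨e, he⟩, hf⟩
    obtain ⟨t, ht, h⟩ := hθ c x
    have h2 := hf x
    rw [h, he.eval_smul_eq, mul_eq_zero] at h2
    exact h2.resolve_left (pow_ne_zero _ ht)
  have hmem : ∀ c p, Projectivization.mk ℂ (μ c p) (hne c p) ∈
      projZeros (homogeneousRelations θ) \
        projZeros (Set.range fun c => MvPolynomial.X (l₀ c)) := by
    intro c p
    rw [Set.mem_sdiff, mem_projZeros_mk (fun f hf => hf.1), mem_projZeros_mk hX]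
    constructor
    · intro f hf
      -- The relations hold on the dense torus, hence on the whole chart.
      have hc : Continuous fun p => MvPolynomial.eval (μ c p) f :=
        (MvPolynomial.continuous_eval f).comp (continuous_pi fun j => (hμ c j).continuous)
      exact (hτ c).induction_on (p := fun p => MvPolynomial.eval (μ c p) f = 0) p
        (isClosed_eq hc continuous_const) fun x => hμτ c x f hf
    · intro h
      have h2 := h _ ⟨c, rfl⟩
      rw [MvPolynomial.eval_X, h1] at h2
      exact one_ne_zero h2
  refine ⟨fun c p => ⟨_, hmem c p⟩, fun c q k => q.1.rep (idx c k) / q.1.rep (l₀ c),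
    fun c => {q | q.1.rep (l₀ c) ≠ 0}, ?_, ?_, ?_⟩
  · intro c
    refine ⟨(Projectivization.isOpen_rep_ne_zero _).preimage continuous_subtype_val, ?_, ?_, ?_,
      ?_, ?_⟩
    · intro p
      change Projectivization.rep (Projectivization.mk ℂ (μ c p) (hne c p)) (l₀ c) ≠ 0
      rw [Projectivization.rep_mk_ne_zero_iff, h1]
      exact one_ne_zero
    · intro p
      exact .of_val (.mk (f := μ c) (fun j => (hμ c j).isHolAt p) (hne c p)
        (Eventually.of_forall fun _ _ => rfl))
    · intro q hq
      exact .pi fun k => (IsHolMapAt.subtype_val q).rep_div_rep _ _ hq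
    · intro p
      funext k
      exact (Projectivization.rep_div_rep_mk _ (hne c p) _ _).trans (by rw [h1, hidx, div_one])
    · intro q hq
      refine Subtype.ext ?_
      refine Eq.trans (Projectivization.mk_smul_eq _ q.1.rep_nonzero (q.1.rep (l₀ c))⁻¹ ?_)
        q.1.mk_rep
      funext j
      obtain ⟨a, ha⟩ : ∃ a : Fin d → ℕ, ∀ p, μ c p j = ∏ k, p k ^ a k := hμ c j
      -- The identity expressing the monomial μ_j through the chart coordinates, homogenized; both
      -- terms have degree 1 + ∑ a_k. It forces a point with nonzero coordinate `l₀ c` to lie in the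
      -- image of the chart.
      let f : MvPolynomial (Fin (N + 1)) ℂ :=
        MvPolynomial.X j * MvPolynomial.X (l₀ c) ^ (∑ k, a k) -
          MvPolynomial.X (l₀ c) * ∏ k, MvPolynomial.X (idx c k) ^ a k
      have hf : f ∈ homogeneousRelations θ := by
        constructor
        · refine ⟨1 + ∑ k, a k, MvPolynomial.IsHomogeneous.sub ?_ ?_⟩
          · have := (MvPolynomial.isHomogeneous_X ℂ j).mul
              ((MvPolynomial.isHomogeneous_X ℂ (l₀ c)).pow (∑ k, a k))
            rwa [one_mul] at this
          · refine (MvPolynomial.isHomogeneous_X ℂ (l₀ c)).mul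
              (MvPolynomial.IsHomogeneous.prod _ _ _ fun k _ => ?_)
            have := (MvPolynomial.isHomogeneous_X ℂ (idx c k)).pow (a k)
            rwa [one_mul] at this
        · intro x
          obtain ⟨t, ht, h⟩ := hθ c x
          simp only [f, map_sub, map_mul, map_pow, map_prod, MvPolynomial.eval_X, h,
            Pi.smul_apply, smul_eq_mul, h1, hidx, ha, mul_pow, Finset.prod_mul_distrib,
            Finset.prod_pow_eq_pow_sum, mul_one]
          ring
      have h2 := q.2.1 f hf
      simp only [f, map_sub, map_mul, map_pow, map_prod, MvPolynomial.eval_X] at h2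
      have hq' : q.1.rep (l₀ c) ≠ 0 := hq
      rw [ha, Pi.smul_apply, smul_eq_mul]
      simp only [div_pow, Finset.prod_div_distrib, Finset.prod_pow_eq_pow_sum]
      field_simp
      linear_combination -h2
  · intro q
    -- The removed set is the common zero set of the coordinates `l₀ c`, so at every remaining point
    -- some chart applies.
    have h := q.2.2
    simp only [projZeros, Set.mem_ofPred_eq, Set.forall_mem_range, MvPolynomial.eval_X,
      not_forall] at h
    exact h
  · intro c e x
    refine Subtype.ext ?_
    obtain ⟨s, hs, h2⟩ := hθ c x
    obtain ⟨t, ht, h3⟩ := hθ e x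
    refine Projectivization.mk_smul_eq _ _ (s⁻¹ * t) ?_
    rw [mul_smul, ← h3, h2, smul_smul, inv_mul_cancel₀ hs, one_smul]

/-- The projective model built from μ has the same `τ` as `Z`, and the uniqueness of gluing
identifies the two. -/
theorem isQuasiProjective_of_monomial {Z : Type*} [TopologicalSpace Z] [HolSpace Z] [T2Space Z]
    {φ : Γ → (Fin d → ℂ) → Z} {ψ : Γ → Z → Fin d → ℂ} {O : Γ → Set Z}
    (h : IsHolAtlas τ φ ψ O) (hτ : ∀ c, DenseRange (τ c))
    (hμ : ∀ c j, IsMonomialFun fun p => μ c p j) (h1 : ∀ c p, μ c p (l₀ c) = 1)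
    (hidx : ∀ c p k, μ c p (idx c k) = p k)
    (hθ : ∀ c x, ∃ t : ℂ, t ≠ 0 ∧ θ x = t • μ c (τ c x)) : IsQuasiProjective Z := by
  obtain ⟨φ', ψ', O', h'⟩ := exists_isHolAtlas_of_monomial hτ hμ h1 hidx hθ
  obtain ⟨Φ, -⟩ := h.exists_bihol h' hτ
  refine ⟨N, _, _, ?_, ⟨Φ⟩⟩
  rintro f (hf | ⟨c, rfl⟩)
  · exact hf.1
  · exact ⟨1, MvPolynomial.isHomogeneous_X _ _⟩

end

/-! ### The projective embedding -/

/-- The twelve homogeneous coordinates of the embedding, arranged from three vectors. -/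
def embVec (A B x : Fin 3 → ℂ) : Fin 12 → ℂ :=
  ![A 0, A 1, A 2, B 0, B 1, B 2, B 0 * x 0, B 1 * x 1, B 2 * x 2, B 0 * x 1, B 1 * x 2, B 2 * x 0]

theorem smul_embVec (t : ℂ) (A B x : Fin 3 → ℂ) :
    t • embVec A B x = embVec (t • A) (t • B) x := by
  funext l
  fin_cases l <;> simp [embVec, mul_assoc]

/-- The embedding in the monomial charts. -/
def toricEmb : Bool → Fin 3 → (Fin 3 → ℂ) → Fin 12 → ℂ
  | true, i, p => embVec (toricPlane true i p) (fun j => p 2 * toricPlane true i p j ^ 3)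
      (toricBase true i p)
  | false, i, p => embVec (fun j => p 2 * toricPlane false i p j)
      (fun j => toricPlane false i p j ^ 3) (toricBase false i p)

/-- The homogeneous coordinate of the embedding that is `1` in a monomial chart. -/
def embIndex : Bool → Fin 3 → Fin 12
  | true => ![0, 1, 2]
  | false => ![3, 4, 5]

/-- The homogeneous coordinates of the embedding that give the coordinates of a monomial chart. -/
def embCoordIndex : Bool → Fin 3 → Fin 3 → Fin 12
  | true => ![![1, 2, 3], ![2, 0, 4], ![0, 1, 5]]
  | false => ![![6, 9, 0], ![7, 10, 1], ![8, 11, 2]]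

theorem isMonomialFun_embVec {d : ℕ} {A B x : (Fin d → ℂ) → Fin 3 → ℂ}
    (hA : ∀ j, IsMonomialFun fun p => A p j) (hB : ∀ j, IsMonomialFun fun p => B p j)
    (hx : ∀ j, IsMonomialFun fun p => x p j) (l : Fin 12) :
    IsMonomialFun fun p => embVec (A p) (B p) (x p) l := by
  fin_cases l
  · exact hA 0
  · exact hA 1
  · exact hA 2
  · exact hB 0
  · exact hB 1
  · exact hB 2
  · exact (hB 0).mul (hx 0)
  · exact (hB 1).mul (hx 1)
  · exact (hB 2).mul (hx 2)
  · exact (hB 0).mul (hx 1)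
  · exact (hB 1).mul (hx 2)
  · exact (hB 2).mul (hx 0)

theorem isMonomialFun_toricEmb (b : Bool) (i : Fin 3) (l : Fin 12) :
    IsMonomialFun fun p => toricEmb b i p l := by
  have h := fun k : Fin 3 => IsMonomialFun.coord k
  cases b
  · have hκ : ∀ j, IsMonomialFun fun p => toricPlane false i p j :=
      .cyc .one ((h 1).mul (h 2)) ((h 0).mul (h 2)) i
    exact isMonomialFun_embVec (fun j => (h 2).mul (hκ j)) (fun j => (hκ j).pow 3)
      (.cyc (h 0) (h 1) (((h 0).mul (h 1)).mul (h 2)) i) l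
  · have hκ : ∀ j, IsMonomialFun fun p => toricPlane true i p j := .cyc .one (h 0) (h 1) i
    exact isMonomialFun_embVec hκ (fun j => (h 2).mul ((hκ j).pow 3))
      (.cyc ((h 1).mul (h 2)) ((h 0).mul (h 2)) (((h 0).mul (h 1)).mul (h 2)) i) l

/-- The embedding on the torus. -/
def torusEmb (x : Fin 3 → ℂ) : Fin 12 → ℂ :=
  embVec (fun j => x 0 * x 1 * x 2 * (x j * x (j + 1))) (fun j => (x j * x (j + 1)) ^ 3) x

/-- The entries of `A` and `B` are x₁x₂x₃·m_j and m_j³ with m_j = x_j x_{j+1}, elements of the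
product of `J` and the ideal of the axes. Hence the factor is the product of the common factors of
these two ideals. -/
theorem torusEmb_toricBase (b : Bool) (i : Fin 3) (p : Fin 3 → ℂ) :
    torusEmb (toricBase b i p) = (toricFactorJ b p * toricAxesFactor b p) • toricEmb b i p := by
  have h : toricBase b i p 0 * toricBase b i p 1 * toricBase b i p 2 =
      toricFactorJ b p * toricQuotJ b i p none := (principalization_genJ b i).eq_mul p none
  cases b
  · rw [toricEmb, smul_embVec, torusEmb]
    congr 1 <;> funext j <;>
      simp only [h, toricBase_mul, toricFactorJ, toricQuotJ, toricAxesFactor, Pi.smul_apply,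
        smul_eq_mul] <;> ring
  · rw [toricEmb, smul_embVec, torusEmb]
    congr 1 <;> funext j <;>
      simp only [h, toricBase_mul, toricFactorJ, toricQuotJ, toricAxesFactor, Pi.smul_apply,
        smul_eq_mul] <;> ring

theorem isQuasiProjective_H {m : ℕ} {h : Fin m → holFun (Fin 3 → ℂ)}
    (hh : Ideal.span (Set.range h) = idealH) :
    IsQuasiProjective (BlowUp fun k => (h k : (Fin 3 → ℂ) → ℂ)) := by
  obtain ⟨G, C, hC⟩ := exists_sameIdeal_H hh
  refine isQuasiProjective_of_monomial (isHolAtlas_chartH hC) (N := 11)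
    (μ := fun c => toricEmb c.1 c.2) (θ := fun x : Torus => torusEmb x.1)
    (l₀ := fun c => embIndex c.1 c.2) (idx := fun c => embCoordIndex c.1 c.2)
    (fun c => denseRange_toricCoord c.1 c.2) (fun c => isMonomialFun_toricEmb c.1 c.2) ?_ ?_ ?_
  · rintro ⟨b, i⟩ p
    cases b <;> fin_cases i <;> simp [toricEmb, embIndex, embVec, toricPlane, cyc]
  · rintro ⟨b, i⟩ p k
    cases b <;> fin_cases i <;> fin_cases k <;>
      simp [toricEmb, embCoordIndex, embVec, toricPlane, toricBase, cyc]
  · rintro ⟨b, i⟩ x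
    refine ⟨toricFactorJ b (toricCoord b i x) * toricAxesFactor b (toricCoord b i x), ?_, ?_⟩
    swap
    · rw [← torusEmb_toricBase, toricBase_toricCoord]
    · have h := toricCoord_ne_zero b i x
      cases b <;> simp [toricFactorJ, toricAxesFactor, h]

/-! ### The exceptional divisor over the origin -/

section
variable {m : ℕ} {h : Fin m → holFun (Fin 3 → ℂ)} {G : Fin m → Fin 8 → (Fin 3 → ℂ) → ℂ}
  {C : Fin 8 → Fin m → (Fin 3 → ℂ) → ℂ}

/-- The linear map that embeds the exceptional plane. -/
def excMatrix (G : Fin m → Fin 8 → (Fin 3 → ℂ) → ℂ) : Matrix (Fin m) (Fin 3) ℂ :=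
  fun k j => G k (toricIndexH true j) 0

/-- The linear map that gives the homogeneous coordinates on the exceptional plane. -/
def excInvMatrix (C : Fin 8 → Fin m → (Fin 3 → ℂ) → ℂ) : Matrix (Fin 3) (Fin m) ℂ :=
  fun j k => C (toricIndexH true j) k 0

theorem toricBase_true_eq_zero (i : Fin 3) {p : Fin 3 → ℂ} (hp : p 2 = 0) :
    toricBase true i p = 0 := by
  rw [← cyc_eta i 0]
  simp [toricBase, hp]

/-- On p₂ = 0 all generators of `H` after the first three have quotient 0, and the base point is
constantly 0. The chart is therefore linear in [a : b : c]. -/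
theorem sum_excMatrix (k : Fin m) (i : Fin 3) {p : Fin 3 → ℂ} (hp : p 2 = 0) :
    ∑ l, G k l (toricBase true i p) * toricQuotH true i p l =
      (excMatrix G).mulVec (toricPlane true i p) k := by
  rw [toricBase_true_eq_zero i hp, Fin.sum_univ_eight]
  simp only [toricQuotH, hp, Matrix.cons_val, ne_eq, OfNat.ofNat_ne_zero, not_false_eq_true,
    zero_pow, zero_mul, mul_zero, add_zero, Matrix.mulVec, dotProduct, Fin.sum_univ_three,
    excMatrix, toricIndexH]

theorem cyc_scaled (i : Fin 3) {w : Fin 3 → ℂ} (hw : w i ≠ 0) :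
    w = w i • cyc i 1 (w (i + 1) / w i) (w (i + 2) / w i) := by
  refine funext (forall_cyc i ?_ ?_ ?_) <;>
    simp only [Pi.smul_apply, smul_eq_mul, cyc_zero, cyc_one, cyc_two, mul_one] <;> field_simp

/-- This is the identity CGμ = μ of `Principalization.sum_eq` at points with p₂ = 0; every nonzero
vector is a multiple of such a μ. -/
theorem excInvMatrix_mulVec
    (hC : SameIdeal (fun k => (h k : (Fin 3 → ℂ) → ℂ)) (fun l => (genH l : (Fin 3 → ℂ) → ℂ)) G C)
    (w : Fin 3 → ℂ) : (excInvMatrix C).mulVec ((excMatrix G).mulVec w) = w := by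
  by_cases hw : w = 0
  · simp [hw]
  obtain ⟨i, hi⟩ := Function.ne_iff.1 hw
  have hi' : w i ≠ 0 := hi
  have key : ∀ p : Fin 3 → ℂ, p 2 = 0 →
      (excInvMatrix C).mulVec ((excMatrix G).mulVec (toricPlane true i p)) =
        toricPlane true i p := by
    intro p hp
    funext j
    have h1 := (principalization_genH true i).sum_eq hC p (toricIndexH true j)
    simp only [sum_excMatrix _ i hp] at h1
    rw [toricQuotH_true, toricBase_true_eq_zero i hp] at h1
    exact h1
  have h2 := key ![w (i + 1) / w i, w (i + 2) / w i, 0] rfl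
  have h3 : w = w i • toricPlane true i ![w (i + 1) / w i, w (i + 2) / w i, 0] := cyc_scaled i hi'
  rw [h3, Matrix.mulVec_smul, Matrix.mulVec_smul, h2]

theorem excMatrix_mulVec_ne_zero
    (hC : SameIdeal (fun k => (h k : (Fin 3 → ℂ) → ℂ)) (fun l => (genH l : (Fin 3 → ℂ) → ℂ)) G C)
    {w : Fin 3 → ℂ} (hw : w ≠ 0) : (excMatrix G).mulVec w ≠ 0 := by
  intro h0
  have h1 := excInvMatrix_mulVec hC w
  rw [h0, Matrix.mulVec_zero] at h1
  exact hw h1.symm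

theorem chartH_true_val
    (hC : SameIdeal (fun k => (h k : (Fin 3 → ℂ) → ℂ)) (fun l => (genH l : (Fin 3 → ℂ) → ℂ)) G C)
    (i : Fin 3) {p : Fin 3 → ℂ} (hp : p 2 = 0) :
    (chartH hC true i p).1 = (0, Projectivization.mk ℂ ((excMatrix G).mulVec (toricPlane true i p))
      (excMatrix_mulVec_ne_zero hC (toricPlane_ne_zero true i p))) := by
  refine Prod.ext (toricBase_true_eq_zero i hp) (Projectivization.mk_smul_eq _ _ 1 ?_)
  funext k
  rw [one_smul]
  exact sum_excMatrix k i hp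

theorem excPoint_mem
    (hC : SameIdeal (fun k => (h k : (Fin 3 → ℂ) → ℂ)) (fun l => (genH l : (Fin 3 → ℂ) → ℂ)) G C)
    (κ : ℙ ℂ (Fin 3 → ℂ)) {i : Fin 3} (hi : κ.rep i ≠ 0) :
    (0, Projectivization.mk ℂ _ (excMatrix_mulVec_ne_zero hC κ.rep_nonzero)) =
      (chartH hC true i ![κ.rep (i + 1) / κ.rep i, κ.rep (i + 2) / κ.rep i, 0]).1 := by
  rw [chartH_true_val hC i rfl]
  refine Prod.ext rfl (Projectivization.mk_smul_eq _ _ (κ.rep i) ?_)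
  rw [← Matrix.mulVec_smul]
  exact congrArg _ (cyc_scaled i hi)

/-- The embedding of the exceptional plane. -/
noncomputable def excPoint
    (hC : SameIdeal (fun k => (h k : (Fin 3 → ℂ) → ℂ)) (fun l => (genH l : (Fin 3 → ℂ) → ℂ)) G C)
    (κ : ℙ ℂ (Fin 3 → ℂ)) : BlowUp fun k => (h k : (Fin 3 → ℂ) → ℂ) :=
  ⟨(0, Projectivization.mk ℂ _ (excMatrix_mulVec_ne_zero hC κ.rep_nonzero)), by
    obtain ⟨i, hi⟩ := Projectivization.exists_rep_ne_zero κ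
    rw [excPoint_mem hC κ hi]
    exact Subtype.property _⟩

theorem excPoint_eq_chartH
    (hC : SameIdeal (fun k => (h k : (Fin 3 → ℂ) → ℂ)) (fun l => (genH l : (Fin 3 → ℂ) → ℂ)) G C)
    (κ : ℙ ℂ (Fin 3 → ℂ)) {i : Fin 3} (hi : κ.rep i ≠ 0) :
    excPoint hC κ = chartH hC true i ![κ.rep (i + 1) / κ.rep i, κ.rep (i + 2) / κ.rep i, 0] :=
  Subtype.ext (excPoint_mem hC κ hi)

theorem chartH_true_mem_range
    (hC : SameIdeal (fun k => (h k : (Fin 3 → ℂ) → ℂ)) (fun l => (genH l : (Fin 3 → ℂ) → ℂ)) G C)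
    (i : Fin 3) {p : Fin 3 → ℂ} (hp : p 2 = 0) : chartH hC true i p ∈ Set.range (excPoint hC) := by
  refine ⟨Projectivization.mk ℂ _ (toricPlane_ne_zero true i p), ?_⟩
  have hr := Projectivization.rep_div_rep_mk _ (toricPlane_ne_zero true i p) i
  rw [excPoint_eq_chartH hC _ (i := i)
    ((Projectivization.rep_mk_ne_zero_iff _ _ _).2 (by simp [toricPlane_self])), hr, hr]
  congr 1
  simp only [toricPlane, cyc_zero, cyc_one, cyc_two, div_one]
  funext k
  fin_cases k
  · rfl
  · rfl
  · exact hp.symm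

theorem isHolMapAt_excPoint
    (hC : SameIdeal (fun k => (h k : (Fin 3 → ℂ) → ℂ)) (fun l => (genH l : (Fin 3 → ℂ) → ℂ)) G C)
    (κ : ℙ ℂ (Fin 3 → ℂ)) : IsHolMapAt (excPoint hC) κ :=
  .of_val ((IsHolMapAt.const 0 κ).prodMk ((IsHolMapAt.id κ).mk_linear (excMatrix G)
    fun κ => ⟨excMatrix_mulVec_ne_zero hC κ.rep_nonzero, rfl⟩))

theorem continuous_excPoint
    (hC : SameIdeal (fun k => (h k : (Fin 3 → ℂ) → ℂ)) (fun l => (genH l : (Fin 3 → ℂ) → ℂ)) G C) :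
    Continuous (excPoint hC) :=
  continuous_iff_continuousAt.2 fun κ => (isHolMapAt_excPoint hC κ).1

theorem excInvMatrix_mulVec_excPoint
    (hC : SameIdeal (fun k => (h k : (Fin 3 → ℂ) → ℂ)) (fun l => (genH l : (Fin 3 → ℂ) → ℂ)) G C)
    (κ : ℙ ℂ (Fin 3 → ℂ)) : ∃ c : ℂ, c ≠ 0 ∧
      (excInvMatrix C).mulVec (excPoint hC κ).1.2.rep = c • κ.rep := by
  obtain ⟨c, hc, e⟩ := Projectivization.exists_rep_mk _
    (excMatrix_mulVec_ne_zero hC κ.rep_nonzero)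
  refine ⟨c, hc, ?_⟩
  change (excInvMatrix C).mulVec (Projectivization.mk ℂ _ _).rep = _
  rw [e, Matrix.mulVec_smul, excInvMatrix_mulVec hC]

/-- The embedding is induced by an injective linear map, and its inverse by a linear left inverse.
-/
theorem exists_bihol_excPoint
    (hC : SameIdeal (fun k => (h k : (Fin 3 → ℂ) → ℂ)) (fun l => (genH l : (Fin 3 → ℂ) → ℂ)) G C) :
    Nonempty (Bihol (Set.range (excPoint hC)) (ℙ ℂ (Fin 3 → ℂ))) := by
  have hne : ∀ q : Set.range (excPoint hC), (excInvMatrix C).mulVec q.1.1.2.rep ≠ 0 := by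
    rintro ⟨_, κ, rfl⟩
    obtain ⟨c, hc, e⟩ := excInvMatrix_mulVec_excPoint hC κ
    rw [e]
    exact smul_ne_zero hc κ.rep_nonzero
  have hmk : ∀ κ (h0 : (excInvMatrix C).mulVec (excPoint hC κ).1.2.rep ≠ 0),
      Projectivization.mk ℂ _ h0 = κ := by
    intro κ h0
    obtain ⟨c, hc, e⟩ := excInvMatrix_mulVec_excPoint hC κ
    exact (Projectivization.mk_smul_eq _ κ.rep_nonzero c e).trans κ.mk_rep
  refine ⟨⟨⟨fun q => Projectivization.mk ℂ _ (hne q), fun κ => ⟨excPoint hC κ, κ, rfl⟩, ?_, ?_⟩,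
    isHolMap_iff.2 fun q => ?_, isHolMap_iff.2 fun κ => .of_val (isHolMapAt_excPoint hC κ)⟩⟩
  · rintro ⟨_, κ, rfl⟩
    exact Subtype.ext (congrArg (excPoint hC) (hmk κ _))
  · exact fun κ => hmk κ _
  · exact IsHolMapAt.mk_linear (φ := fun q : Set.range (excPoint hC) => q.1.1.2)
      ((IsHolMapAt.subtype_val q).val.snd) (excInvMatrix C) fun q => ⟨hne q, rfl⟩

/-! ### The fibre over the origin -/

theorem toricBase_line (b : Bool) (i : Fin 3) (z : ℂ) : toricBase b i ![0, 0, z] = 0 := by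
  rw [← cyc_eta i 0]
  cases b <;> simp [toricBase]

/-- Off p₂ = 0 in a chart of the first kind, and everywhere in one of the second kind, the fibre
over 0 is the p₂-axis. -/
theorem eq_line_of_toricBase_eq_zero {b : Bool} {i : Fin 3} {p : Fin 3 → ℂ}
    (hp : toricBase b i p = 0) (h2 : b = true → p 2 ≠ 0) : ![0, 0, p 2] = p := by
  have h : p 0 = 0 ∧ p 1 = 0 := by
    have e0 := congrFun hp i
    have e1 := congrFun hp (i + 1)
    cases b
    · simp only [toricBase, cyc_zero, cyc_one] at e0 e1
      exact ⟨e0, e1⟩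
    · simp only [toricBase, cyc_zero, cyc_one] at e0 e1
      exact ⟨(mul_eq_zero.1 e1).resolve_right (h2 rfl), (mul_eq_zero.1 e0).resolve_right (h2 rfl)⟩
  funext k
  fin_cases k
  · exact h.1.symm
  · exact h.2.symm
  · rfl

theorem map_chartH
    (hC : SameIdeal (fun k => (h k : (Fin 3 → ℂ) → ℂ)) (fun l => (genH l : (Fin 3 → ℂ) → ℂ)) G C)
    (b : Bool) (i : Fin 3) (p : Fin 3 → ℂ) :
    BlowUp.map _ (chartH hC b i p) = toricBase b i p := rfl

/-- Off the plane the fibre is locally a piece of the p₂-axis of a chart, so it is a local retract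
of ℂ¹ and cannot have dimension 2. -/
theorem not_isSmoothOfDimAt_fibre
    (hC : SameIdeal (fun k => (h k : (Fin 3 → ℂ) → ℂ)) (fun l => (genH l : (Fin 3 → ℂ) → ℂ)) G C)
    (q : ↥(BlowUp.map (fun k => (h k : (Fin 3 → ℂ) → ℂ)) ⁻¹' {0}))
    (hq : q.1 ∉ Set.range (excPoint hC)) :
    ¬ IsSmoothOfDimAt ↥(BlowUp.map (fun k => (h k : (Fin 3 → ℂ) → ℂ)) ⁻¹' {0}) 2 q := by
  intro hs
  obtain ⟨⟨b, i⟩, hc⟩ := (isHolAtlas_chartH hC).cover q.1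
  have hch := isHolChart_chartH hC b i
  have hbase : ∀ r : ↥(BlowUp.map (fun k => (h k : (Fin 3 → ℂ) → ℂ)) ⁻¹' {0}),
      r.1 ∈ {q : BlowUp fun k => (h k : (Fin 3 → ℂ) → ℂ) |
        q.1.1 ∈ Set.univ ∧ linForm (C (toricIndexH b i)) q.1 ≠ 0} →
      toricBase b i (coordH C b i r.1.1) = 0 := by
    intro r hr
    rw [← map_chartH hC, hch.right _ hr]
    exact r.2
  have hψ : IsHolMapAt (fun r : ↥(BlowUp.map (fun k => (h k : (Fin 3 → ℂ) → ℂ)) ⁻¹' {0}) =>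
      coordH C b i r.1.1) q := (hch.hol_inv q.1 hc).comp (.subtype_val q)
  have h2 : b = true → coordH C b i q.1.1 2 ≠ 0 := by
    rintro rfl h0
    refine hq ?_
    rw [← hch.right q.1 hc]
    exact chartH_true_mem_range hC i h0
  have hev : ∀ᶠ r in 𝓝 q, b = true → coordH C b i r.1.1 2 ≠ 0 := by
    cases b
    · exact Eventually.of_forall fun _ h => absurd h (by simp)
    · exact ((HolSpace.continuousAt (hψ.apply 2)).eventually_ne (h2 rfl)).mono fun _ hr _ => hr
  have hle := hs.le_of_retract (e := 1) (fun r _ => coordH C b i r.1.1 2)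
    (fun w => ⟨chartH hC b i ![0, 0, w 0], toricBase_line b i (w 0)⟩) (.pi fun _ => hψ.apply 2)
    ?_ ?_
  · exact absurd hle (by norm_num)
  · refine .of_val (IsHolMapAt.comp (ψ := chartH hC b i) (φ := fun w : Fin 1 → ℂ => ![0, 0, w 0])
      (hch.hol _) (.pi fun k => ?_))
    fin_cases k
    · exact .const 0 _
    · exact .const 0 _
    · exact HolSpace.isHolAt_coord 0 _
  · filter_upwards [hev, (hch.isOpen.preimage continuous_subtype_val).mem_nhds hc] with r hr1 hr2
    refine Subtype.ext ?_
    change chartH hC b i ![0, 0, coordH C b i r.1.1 2] = r.1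
    rw [eq_line_of_toricBase_eq_zero (hbase r hr2) hr1]
    exact hch.right _ hr2

/-- In the chart of the first kind with index 0 the equation p₀p₂ = 0 gives p₂ = 0 wherever p₀ ≠ 0.
There the fibre is the plane alone, with coordinates p₀ and p₁. -/
theorem isSmoothOfDimAt_fibre
    (hC : SameIdeal (fun k => (h k : (Fin 3 → ℂ) → ℂ)) (fun l => (genH l : (Fin 3 → ℂ) → ℂ)) G C)
    (q : ↥(BlowUp.map (fun k => (h k : (Fin 3 → ℂ) → ℂ)) ⁻¹' {0})) {κ : ℙ ℂ (Fin 3 → ℂ)}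
    (hκ : ∀ i, κ.rep i ≠ 0) (hq : q.1 = excPoint hC κ) :
    IsSmoothOfDimAt ↥(BlowUp.map (fun k => (h k : (Fin 3 → ℂ) → ℂ)) ⁻¹' {0}) 2 q := by
  have hch := isHolChart_chartH hC true 0
  have hleft : ∀ p, coordH C true 0 (chartH hC true 0 p).1 = p := hch.left
  have hbase : ∀ r : ↥(BlowUp.map (fun k => (h k : (Fin 3 → ℂ) → ℂ)) ⁻¹' {0}),
      r.1 ∈ {q : BlowUp fun k => (h k : (Fin 3 → ℂ) → ℂ) |
        q.1.1 ∈ Set.univ ∧ linForm (C (toricIndexH true 0)) q.1 ≠ 0} →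
      coordH C true 0 r.1.1 0 ≠ 0 → coordH C true 0 r.1.1 2 = 0 := by
    intro r hr h0
    have h1 : toricBase true 0 (coordH C true 0 r.1.1) = 0 := by
      rw [← map_chartH hC, hch.right _ hr]
      exact r.2
    exact (mul_eq_zero.1 (congrFun h1 1)).resolve_left h0
  have hcont : ContinuousOn (fun q : BlowUp fun k => (h k : (Fin 3 → ℂ) → ℂ) =>
      coordH C true 0 q.1 0) {q | q.1.1 ∈ Set.univ ∧ linForm (C (toricIndexH true 0)) q.1 ≠ 0} :=
    fun r hr => (HolSpace.continuousAt ((hch.hol_inv r hr).apply 0)).continuousWithinAt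
  have hV : IsOpen {v : Fin 2 → ℂ | v 0 ≠ 0} := isOpen_ne_fun (continuous_apply 0) continuous_const
  refine isSmoothOfDimAt_of_local_inverse
    (Subtype.val ⁻¹' ({q | q.1.1 ∈ Set.univ ∧ linForm (C (toricIndexH true 0)) q.1 ≠ 0} ∩
      (fun q : BlowUp fun k => (h k : (Fin 3 → ℂ) → ℂ) => coordH C true 0 q.1 0) ⁻¹' {0}ᶜ))
    {v | v 0 ≠ 0} ?_ ?_ hV (fun r => ![coordH C true 0 r.1.1 0, coordH C true 0 r.1.1 1])
    (fun v => ⟨chartH hC true 0 ![v 0, v 1, 0], toricBase_true_eq_zero 0 rfl⟩) ?_ ?_ ?_ ?_ ?_ ?_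
  · exact (hcont.isOpen_inter_preimage hch.isOpen isOpen_compl_singleton).preimage
      continuous_subtype_val
  · rw [Set.mem_preimage, hq, excPoint_eq_chartH hC κ (hκ 0)]
    refine ⟨hch.mem _, ?_⟩
    change coordH C true 0 (chartH hC true 0 _).1 0 ≠ 0
    rw [hleft]
    exact div_ne_zero (hκ 1) (hκ 0)
  · intro r hr
    have h1 := (hch.hol_inv r.1 hr.1).comp (.subtype_val r)
    refine .pi fun k => ?_
    fin_cases k
    · exact h1.apply 0
    · exact h1.apply 1
  · intro v _
    refine .of_val (IsHolMapAt.comp (ψ := chartH hC true 0)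
      (φ := fun v : Fin 2 → ℂ => ![v 0, v 1, 0]) (hch.hol _) (.pi fun k => ?_))
    fin_cases k
    · exact HolSpace.isHolAt_coord 0 v
    · exact HolSpace.isHolAt_coord 1 v
    · exact .const 0 v
  · exact fun r hr => hr.2
  · intro v hv
    refine ⟨hch.mem _, ?_⟩
    change coordH C true 0 (chartH hC true 0 ![v 0, v 1, 0]).1 0 ≠ 0
    rw [hleft]
    exact hv
  · intro r hr
    refine Subtype.ext ?_
    have h1 : (![coordH C true 0 r.1.1 0, coordH C true 0 r.1.1 1, 0] : Fin 3 → ℂ) =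
        coordH C true 0 r.1.1 := by
      funext k
      fin_cases k
      · rfl
      · rfl
      · exact (hbase r hr.1 hr.2).symm
    change chartH hC true 0 ![coordH C true 0 r.1.1 0, coordH C true 0 r.1.1 1, 0] = r.1
    rw [h1]
    exact hch.right _ hr.1
  · intro v _
    change ![coordH C true 0 (chartH hC true 0 ![v 0, v 1, 0]).1 0,
      coordH C true 0 (chartH hC true 0 ![v 0, v 1, 0]).1 1] = v
    rw [hleft]
    funext k
    fin_cases k <;> rfl

theorem Projectivization.dense_rep_ne_zero :
    Dense {κ : ℙ ℂ (Fin 3 → ℂ) | ∀ i, κ.rep i ≠ 0} := by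
  rw [← isOpenQuotientMap_mk'.dense_preimage_iff]
  have ho : IsOpenMap (Subtype.val : {v : Fin 3 → ℂ // v ≠ 0} → Fin 3 → ℂ) :=
    isOpen_ne.isOpenMap_subtype_val
  convert dense_torus.preimage ho using 1
  ext v
  exact forall_congr' fun i => rep_mk_ne_zero_iff v.1 v.2 i

/-- The plane is compact, hence closed, and contains every smooth point of dimension 2. Conversely
its points with nonzero homogeneous coordinates are such points and are dense in it. -/
theorem componentsOfDim_fibre
    (hC : SameIdeal (fun k => (h k : (Fin 3 → ℂ) → ℂ)) (fun l => (genH l : (Fin 3 → ℂ) → ℂ)) G C) :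
    componentsOfDim (BlowUp.map (fun k => (h k : (Fin 3 → ℂ) → ℂ)) ⁻¹' {0}) 2 =
      Set.range (excPoint hC) := by
  refine Set.Subset.antisymm (closure_minimal ?_ ?_) ?_
  · rintro _ ⟨q, hq, rfl⟩
    by_contra h0
    exact not_isSmoothOfDimAt_fibre hC q h0 hq
  · exact (isCompact_range (continuous_excPoint hC)).isClosed
  · rintro _ ⟨κ, rfl⟩
    have h1 := image_closure_subset_closure_image (continuous_excPoint hC)
      ⟨κ, Projectivization.dense_rep_ne_zero κ, rfl⟩
    refine closure_mono ?_ h1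
    rintro _ ⟨κ', hκ', rfl⟩
    exact ⟨⟨excPoint hC κ', rfl⟩, isSmoothOfDimAt_fibre hC _ hκ' rfl, rfl⟩

theorem exists_bihol_componentsOfDim (hh : Ideal.span (Set.range h) = idealH) :
    Nonempty (Bihol
      (componentsOfDim (BlowUp.map (fun k => (h k : (Fin 3 → ℂ) → ℂ)) ⁻¹' {0}) 2)
      (ℙ ℂ (Fin 3 → ℂ))) := by
  obtain ⟨G, C, hC⟩ := exists_sameIdeal_H hh
  rw [componentsOfDim_fibre hC]
  exact exists_bihol_excPoint hC

end

/-! ### The theorem -/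

theorem mainTheorem2 {m n : ℕ}
    (h : Fin m → holFun (Fin 3 → ℂ)) (hh : Ideal.span (Set.range h) = idealH)
    (g : Fin n → holFun (Fin 3 → ℂ)) (hg : Ideal.span (Set.range g) = idealJ) :
    -- the three charts of the first blow-up `X` are quadric cones
    (∀ i : Fin 3, ∃ Φ : Bihol (firstChart i) quadricCone, ∀ p : firstChart i,
      (Φ.toEquiv p : Fin 4 → ℂ) = ![BlowUp.map _ p.1 i, BlowUp.map _ p.1 (i + 1),
        ratio (i + 1) i p.1, ratio (i + 2) i p.1] ∧
      BlowUp.map _ p.1 (i + 2) = ratio (i + 1) i p.1 * BlowUp.map _ p.1 i) ∧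
    -- over each of them, the second blow-up `Y` is covered by two explicit charts
    (∀ i : Fin 3, ∃ U U' : Set (SecondBlowUp g), IsOpen U ∧ IsOpen U' ∧
      U ∪ U' = {q | BlowUp.map _ q ∈ firstChart i} ∧
      (∃ φ : Bihol (Fin 3 → ℂ) U, ∀ u v z : ℂ,
        let p : FirstBlowUp := BlowUp.map _ (φ.toEquiv ![u, v, z]).1
        ratio (i + 1) i p = u ∧ ratio (i + 2) i p = v ∧
          BlowUp.map _ p i = v * z ∧ BlowUp.map _ p (i + 1) = u * z ∧
          BlowUp.map _ p (i + 2) = u * v * z) ∧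
      (∃ φ : Bihol (Fin 3 → ℂ) U', ∀ s t z : ℂ,
        let p : FirstBlowUp := BlowUp.map _ (φ.toEquiv ![s, t, z]).1
        ratio (i + 1) i p = t * z ∧ ratio (i + 2) i p = s * z ∧
          BlowUp.map _ p i = s ∧ BlowUp.map _ p (i + 1) = t ∧
          BlowUp.map _ p (i + 2) = s * t * z)) ∧
    -- `Y` is the blow-up of `ℂ³` along the ideal `H`
    (∃ Ψ : Bihol (SecondBlowUp g) (BlowUp fun k => (h k : (Fin 3 → ℂ) → ℂ)), ∀ q,
      BlowUp.map _ (Ψ.toEquiv q) = BlowUp.map _ (BlowUp.map _ q)) ∧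
    -- this blow-up is a smooth quasi-projective manifold
    IsComplexManifold (BlowUp fun k => (h k : (Fin 3 → ℂ) → ℂ)) 3 ∧
    IsQuasiProjective (BlowUp fun k => (h k : (Fin 3 → ℂ) → ℂ)) ∧
    -- the divisorial part of its fibre over the origin is a projective plane
    Nonempty (Bihol
      (componentsOfDim (BlowUp.map (fun k => (h k : (Fin 3 → ℂ) → ℂ)) ⁻¹' {0}) 2)
      (ℙ ℂ (Fin 3 → ℂ))) := by
  exact ⟨exists_bihol_quadricCone, exists_charts_second hg, exists_bihol_second hg hh,
    isComplexManifold_H hh, isQuasiProjective_H hh, exists_bihol_componentsOfDim hh⟩
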